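/- **Setup.** Let $R$ be a commutative noetherian ring, $F$ a free $R$-module of rank $n\ge 3$, $X\colon F\to F^*$ a homomorphism with dual $X^*\colon F\to F^*$, $u,v\in F$, and $\eta\in\bigwedge^nF$, $\varepsilon\in\bigwedge^nF^*$ with $\eta(\varepsilon)=1$. Here $\bigwedge^{\bullet} F^*$ acts on $\bigwedge^{\bullet} F$ (and symmetrically $\bigwedge^{\bullet} F$ on $\bigwedge^{\bullet} F^*$): elements of degree one act as graded derivations, $\alpha(a_1\wedge\dots\wedge a_s)=\sum_j(-1)^{j+1}\alpha(a_j)\,a_1\wedge\dots\widehat{a_j}\dots\wedge a_s$, and $(\alpha\wedge\beta)(a)=\alpha(\beta(a))$. For $x\in\bigwedge^s$ write $\Delta(x)=\sum_j x_1^{[j]}\otimes x_{s-1}^{[j]}$ for the component of the comultiplication in $\bigwedge^1\otimes\bigwedge^{s-1}$. Subscripts of elements denote degrees; $\bigwedge^tF=0$ for $t<0$. All indices are integers. **The complex $\mathbb F$.** $\mathbb F_r=\bigoplus_{i=1}^4\bigoplus_t\mathbb F_r(i)^{(t)}$ with $\mathbb F_r(1)^{(t)}=\bigwedge^tF^*\otimes\bigwedge^{r+1-t}F^*$,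 $\mathbb F_r(2)^{(t)}=\mathbb F_r(3)^{(t)}=\bigwedge^tF\otimes\bigwedge^{r-t}F^*$ and $\mathbb F_r(4)^{(t)}=\bigwedge^tF^*\otimes\bigwedge^{r-1-t}F^*$. The map $f_r\colon\mathbb F_r\to\mathbb F_{r-1}$ sends * $\alpha_t\otimes\beta_s\in\mathbb F_r(1)^{(t)}$ to $\big(\alpha_t\otimes v(\beta_s)+(-1)^ru(\alpha_t)\otimes\beta_s\big)\in\mathbb F_{r-1}(1)$ $+\sum_i[\beta_1^{[i]}\wedge(\bigwedge^{n-t}X^*)(\alpha_t[\eta])](\eta)\otimes\beta_{s-1}^{[i]}\in\mathbb F_{r-1}(2)^{(t-1)}$ $+\sum_j[\alpha_1^{[j]}\wedge(\bigwedge^{n-s}X)(\beta_s[\eta])](\eta)\otimes\alpha_{t-1}^{[j]}\in\mathbb F_{r-1}(3)^{(s-1)}$; * $a_t\otimes\beta_s\in\mathbb F_r(2)^{(t)}$ to $(-1)^r(\bigwedge^tX)(a_t)\otimes\beta_s\in\mathbb F_{r-1}(1)^{(t)}$ $+\big(a_t\otimes v(\beta_s)+(-1)^{r+1}[X^*(u)](a_t)\otimes\beta_s\big)\in\mathbb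 F_{r-1}(2)$ $+\sum_j(\bigwedge^{t-1}X)(a_{t-1}^{[j]})\otimes a_1^{[j]}(\beta_s)\in\mathbb F_{r-1}(4)^{(t-1)}$; * $a_t\otimes\beta_s\in\mathbb F_r(3)^{(t)}$ to $(-1)^{r+1}\beta_s\otimes(\bigwedge^tX^*)(a_t)\in\mathbb F_{r-1}(1)^{(s)}$ $+\big((-1)^{r+1}a_t\otimes u(\beta_s)+[X(v)](a_t)\otimes\beta_s\big)\in\mathbb F_{r-1}(3)$ $-\sum_ja_1^{[j]}(\beta_s)\otimes(\bigwedge^{t-1}X^*)(a_{t-1}^{[j]})\in\mathbb F_{r-1}(4)^{(s-1)}$; * $\alpha_t\otimes\beta_s\in\mathbb F_r(4)^{(t)}$ to $(-1)^r[(\bigwedge^{n-t}X^*)(\alpha_t[\eta])](\eta)\otimes\beta_s\in\mathbb F_{r-1}(2)^{(t)}$ $+(-1)^r[(\bigwedge^{n-s}X)(\beta_s[\eta])](\eta)\otimes\alpha_t\in\mathbb F_{r-1}(3)^{(s)}$ $+\big(\alpha_t\otimes v(\beta_s)+(-1)^ru(\alpha_t)\otimes\beta_s\big)\in\mathbb F_{r-1}(4)$.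 **Splittings.** Let $\mu_s\colon F\otimes\bigwedge^sF^*\to\bigwedge^{s-1}F^*$, $\mu_s(a_1\otimes\alpha_s)=a_1(\alpha_s)$, and $\sigma_s\colon\bigwedge^sF^*\to\bigwedge^{n-1}F\otimes\bigwedge^{s-1}F^*$, $\sigma_s(\alpha_s)=\sum_i\alpha_1^{[i]}(\eta)\otimes\alpha_{s-1}^{[i]}$. Fix any homomorphisms $\ell_s\colon\bigwedge^sF^*\to F\otimes\bigwedge^{s+1}F^*$ and $\lambda_s\colon\bigwedge^{n-1}F\otimes\bigwedge^sF^*\to\bigwedge^{s+1}F^*$ with $\mu_{s+1}\ell_s=\mathrm{id}$ for $s\ne n$, $\ell_n=0$, $\lambda_s\sigma_{s+1}=\mathrm{id}$ for $s\ne-1$, $\lambda_{-1}=0$. For $i=2,3$ put $[\mathbb F_r(i)^{(n-1)}]'=\operatorname{Ker}\lambda_{r+1-n}$, $[\mathbb F_r(i)^{(n-1)}]''=\operatorname{Im}\sigma_{r+2-n}$, $[\mathbb F_r(i)^{(1)}]'=\operatorname{Ker}\mu_{r-1}$, $[\mathbb F_r(i)^{(1)}]''=\operatorname{Im}\ell_{r-2}$.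 **The submodules of $\mathbb F_r$.** With $\chi(S)=1$ if $S$ is true and $0$ otherwise: * $\widehat{\mathbb M}_r=\sum_{t\notin\{0,n,r+1,r+1-n\}}\mathbb F_r(1)^{(t)}+\sum_{i=2,3}\Big([\mathbb F_r(i)^{(n-1)}]'+\sum_{2\le t\le n-2}\mathbb F_r(i)^{(t)}+[\mathbb F_r(i)^{(1)}]'\Big)+\sum_{t\notin\{0,n,r-1,r-1-n\}}\mathbb F_r(4)^{(t)}$; and $\mathbb M_r=\widehat{\mathbb M}_r$, except $\mathbb M_0=\widehat{\mathbb M}_0+\mathbb F_0(3)^{(0)}$, $\mathbb M_2=\widehat{\mathbb M}_2+[\mathbb F_2(3)^{(1)}]''$, $\mathbb M_{2n-2}=\widehat{\mathbb M}_{2n-2}+[\mathbb F_{2n-2}(3)^{(n-1)}]''$, $\mathbb M_{2n}=\widehat{\mathbb M}_{2n}+\mathbb F_{2n}(3)^{(n)}$. * $\widehat{\mathbb N}_r=\chi(n\le r\le2n-1)\mathbb F_r(1)^{(n)}+\chi(n\le r\le2n-2)\mathbb F_r(1)^{(r+1-n)}+\chi(0\le r\le n)\mathbb F_r(2)^{(0)}+\chi(2\le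 r\le n+1)[\mathbb F_r(2)^{(1)}]''+\chi(1\le r\le n)\mathbb F_r(3)^{(0)}+\chi(3\le r\le n+1)[\mathbb F_r(3)^{(1)}]''+\chi(n+1\le r\le2n+1)\mathbb F_r(4)^{(n)}+\chi(n+1\le r\le2n)\mathbb F_r(4)^{(r-1-n)}$. * $\mathbb N_r=\widehat{\mathbb N}_r+f_{r+1}(\widehat{\mathbb N}_{r+1})$, with $n_r=f_r|_{\mathbb N_r}$. * $\mathbb L_r=\chi(-1\le r\le n-1)\mathbb F_r(1)^{(0)}+\chi(0\le r\le n-1)\mathbb F_r(1)^{(r+1)}+\chi(n-1\le r\le2n-2)[\mathbb F_r(2)^{(n-1)}]''+\chi(n\le r\le2n)\mathbb F_r(2)^{(n)}+\chi(n-1\le r\le2n-3)[\mathbb F_r(3)^{(n-1)}]''+\chi(n\le r\le2n-1)\mathbb F_r(3)^{(n)}+\chi(1\le r\le n)\mathbb F_r(4)^{(0)}+\chi(2\le r\le n)\mathbb F_r(4)^{(r-1)}$. One has $\mathbb F_r=\mathbb L_r\oplus\mathbb M_r\oplus\widehat{\mathbb N}_r$; let $\pi_r^{\mathbb L}$, $\pi_r^{\mathbb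 M}$ be the projections. **The maps.** Define $\tau_r\colon\mathbb L_r\to\widehat{\mathbb N}_{r+1}$ on the summands of $\mathbb L_r$ (in the order listed above) by * $1\otimes\beta_{r+1}\mapsto(-1)^{r+1}\,1\otimes\beta_{r+1}\in\mathbb F_{r+1}(2)^{(0)}$; * $\alpha_{r+1}\otimes1\mapsto(-1)^r\,1\otimes\alpha_{r+1}\in\mathbb F_{r+1}(3)^{(0)}$; * $\sigma_{r+2-n}(\beta)\mapsto\varepsilon\otimes\beta\in\mathbb F_{r+1}(1)^{(n)}$, $+\,\delta_{r,n-1}(-1)^nv(\beta)\otimes\varepsilon\in\mathbb F_n(3)^{(0)}$; * $\eta\otimes\beta_{r-n}\mapsto(-1)^{r+1}\varepsilon\otimes\beta_{r-n}\in\mathbb F_{r+1}(4)^{(n)}$, $+\,\delta_{r,n}\beta_0\,\ell_{n-1}[u(\varepsilon)]\in[\mathbb F_{n+1}(3)^{(1)}]''$; * $\sigma_{r+2-n}(\beta)\mapsto\beta\otimes\varepsilon\in\mathbb F_{r+1}(1)^{(r+2-n)}$, $-\,\delta_{r,n-1}u(\beta)\otimes\varepsilon\in\mathbb F_n(2)^{(0)}$;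 * $\eta\otimes\beta_{r-n}\mapsto(-1)^{r+1}\beta_{r-n}\otimes\varepsilon\in\mathbb F_{r+1}(4)^{(r-n)}$, $+\,\delta_{r,n}(-1)^n\beta_0\,\ell_{n-1}[v(\varepsilon)]\in[\mathbb F_{n+1}(2)^{(1)}]''$; * $1\otimes\beta_{r-1}\mapsto\ell_{r-1}(\beta_{r-1})\in[\mathbb F_{r+1}(2)^{(1)}]''$; * $\alpha_{r-1}\otimes1\mapsto-\ell_{r-1}(\alpha_{r-1})\in[\mathbb F_{r+1}(3)^{(1)}]''$. Define $\psi_r\colon\mathbb F_r\to\mathbb M_r$ by $\psi_r|_{\mathbb M_r}=\mathrm{id}$, $\psi_r|_{\widehat{\mathbb N}_r}=0$, $\psi_r|_{\mathbb L_r}=-\pi_r^{\mathbb M}\circ f_{r+1}\circ\tau_r$; define $m_r=\psi_{r-1}\circ f_r|_{\mathbb M_r}\colon\mathbb M_r\to\mathbb M_{r-1}$ and $\rho_r=\mathrm{incl}-\tau_{r-1}\circ\pi_{r-1}^{\mathbb L}\circ f_r\colon\mathbb M_r\to\mathbb F_r$. **Proposition.** For every choice of the data and of the splittings: $\mathbb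 F_r=\mathbb L_r\oplus\mathbb M_r\oplus\widehat{\mathbb N}_r$ for all $r$; $(\mathbb F,f)$ is a complex and $(\mathbb N,n)$ is a subcomplex of it; and (a) the complex $(\mathbb N,n)$ is split exact (its identity map is null-homotopic); (b) the modules and maps $\{m_r\colon\mathbb M_r\to\mathbb M_{r-1}\}$ form a complex $(\mathbb M,m)$; (c) the maps $\psi_r\colon\mathbb F_r\to\mathbb M_r$ form a map of complexes, and $0\to(\mathbb N,n)\xrightarrow{\mathrm{incl}}(\mathbb F,f)\xrightarrow{\psi}(\mathbb M,m)\to0$ is a short exact sequence of complexes; (d) the maps $\rho_r\colon\mathbb M_r\to\mathbb F_r$ form a map of complexes, and $\psi_r\circ\rho_r=\mathrm{id}_{\mathbb M_r}$ for all $r$. -/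

import Mathlib

open scoped TensorProduct
open CategoryTheory

namespace SeqMat

noncomputable section

universe u v

/-! ### Complexes of submodules of a fixed module

All modules of the complexes below are submodules of one ambient module `V`, graded by `ℤ`, with
differentials of degree `-1`.  The following turns such data into Mathlib's chain complexes. -/

section Complexes

variable {R : Type u} [CommRing R] {V : Type v} [AddCommGroup V] [Module R V]

/-- The submodules `C r` of `V` and the (restrictions of the) maps `d r` form a complex
`⋯ → C r → C (r - 1) → ⋯`. -/
structure IsComplex (C : ℤ → Submodule R V) (d : ℤ → V →ₗ[R] V) : Prop where
  map_mem : ∀ r : ℤ, ∀ x ∈ C r, d r x ∈ C (r - 1)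
  d_comp_d : ∀ r : ℤ, ∀ x ∈ C r, d (r - 1) (d r x) = 0

/-- The chain complex of `R`-modules with modules `C r` and differentials `d r`. -/
def IsComplex.toChainComplex {C : ℤ → Submodule R V} {d : ℤ → V →ₗ[R] V} (h : IsComplex C d) :
    ChainComplex (ModuleCat.{v} R) ℤ where
  X r := ModuleCat.of R (C r)
  d i j :=
    if hij : j + 1 = i then
      ModuleCat.ofHom ((d i).restrict (p := C i) (q := C j) (fun x hx => by
        have hj : j = i - 1 := by omega
        subst hj
        exact h.map_mem i x hx))
    else 0
  shape i j hij := dif_neg hij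
  d_comp_d' i j k hij hjk := by
    have hij' : j + 1 = i := hij
    have hjk' : k + 1 = j := hjk
    rw [dif_pos hij', dif_pos hjk']
    ext x
    have hj : j = i - 1 := by omega
    subst hj
    exact h.d_comp_d i x.1 x.2

/-- The (restrictions of the) maps `φ r : C r → C' r` form a map of complexes. -/
structure IsChainMap (C : ℤ → Submodule R V) (d : ℤ → V →ₗ[R] V)
    (C' : ℤ → Submodule R V) (d' : ℤ → V →ₗ[R] V) (φ : ℤ → V →ₗ[R] V) : Prop where
  map_mem : ∀ r : ℤ, ∀ x ∈ C r, φ r x ∈ C' r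
  comm : ∀ r : ℤ, ∀ x ∈ C r, d' r (φ r x) = φ (r - 1) (d r x)

/-- The morphism of chain complexes given by the maps `φ r`. -/
def IsChainMap.toHom {C C' : ℤ → Submodule R V} {d d' φ : ℤ → V →ₗ[R] V}
    (h : IsChainMap C d C' d' φ) (hC : IsComplex C d) (hC' : IsComplex C' d') :
    hC.toChainComplex ⟶ hC'.toChainComplex where
  f r := ModuleCat.ofHom ((φ r).restrict (p := C r) (q := C' r) (h.map_mem r))
  comm' i j hij := by
    have hij' : j + 1 = i := hij
    dsimp only [IsComplex.toChainComplex]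
    rw [dif_pos hij', dif_pos hij']
    ext x
    have hj : j = i - 1 := by omega
    subst hj
    exact h.comm i x.1 x.2

end Complexes

/-! ### Multilinear algebra -/

section Multilinear

variable (R : Type u) [CommRing R] (M : Type v) [AddCommGroup M] [Module R M]

/-- `⋀ᵗ M` for an integer `t`, as a submodule of the exterior algebra; it is `0` for `t < 0`. -/
def extPow (t : ℤ) : Submodule R (ExteriorAlgebra R M) :=
  match t with
  | Int.ofNat k => ⋀[R]^k M
  | Int.negSucc _ => ⊥

/-- The projection of the exterior algebra onto its component of degree `t`. -/
def extProj (t : ℤ) : ExteriorAlgebra R M →ₗ[R] ExteriorAlgebra R M :=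
  match t with
  | Int.ofNat k => GradedAlgebra.proj (fun i : ℕ => ⋀[R]^i M) k
  | Int.negSucc _ => 0

/-- The diagonal map `m ↦ m ⊗ 1 + 1 ⊗ m` into the graded tensor product. -/
def diag : M →ₗ[R] (fun i : ℕ => ⋀[R]^i M) ᵍ⊗[R] (fun i : ℕ => ⋀[R]^i M) :=
  (GradedTensorProduct.includeLeft (fun i : ℕ => ⋀[R]^i M)
      (fun i : ℕ => ⋀[R]^i M)).toLinearMap ∘ₗ ExteriorAlgebra.ι R +
    (GradedTensorProduct.includeRight (fun i : ℕ => ⋀[R]^i M)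
      (fun i : ℕ => ⋀[R]^i M)).toLinearMap ∘ₗ ExteriorAlgebra.ι R

theorem diag_sq (m : M) : diag R M m * diag R M m = 0 := by
  have h1 : ExteriorAlgebra.ι R m ∈ ⋀[R]^1 M := by
    simp [ExteriorAlgebra.exteriorPower]
  have e := GradedTensorProduct.tmul_coe_mul_coe_tmul (R := R) (fun i : ℕ => ⋀[R]^i M)
    (fun i : ℕ => ⋀[R]^i M) (1 : ExteriorAlgebra R M) (⟨ExteriorAlgebra.ι R m, h1⟩ : ⋀[R]^1 M)
    (⟨ExteriorAlgebra.ι R m, h1⟩ : ⋀[R]^1 M) (1 : ExteriorAlgebra R M)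
  have e2 := GradedTensorProduct.tmul_one_mul_one_tmul (R := R) (fun i : ℕ => ⋀[R]^i M)
    (fun i : ℕ => ⋀[R]^i M) (ExteriorAlgebra.ι R m) (ExteriorAlgebra.ι R m)
  have e3 : GradedTensorProduct.includeLeft (R := R) (fun i : ℕ => ⋀[R]^i M)
      (fun i : ℕ => ⋀[R]^i M) (ExteriorAlgebra.ι R m) *
      GradedTensorProduct.includeLeft (R := R) (fun i : ℕ => ⋀[R]^i M)
      (fun i : ℕ => ⋀[R]^i M) (ExteriorAlgebra.ι R m) = 0 := by
    rw [← map_mul, ExteriorAlgebra.ι_sq_zero, map_zero]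
  have e4 : GradedTensorProduct.includeRight (R := R) (fun i : ℕ => ⋀[R]^i M)
      (fun i : ℕ => ⋀[R]^i M) (ExteriorAlgebra.ι R m) *
      GradedTensorProduct.includeRight (R := R) (fun i : ℕ => ⋀[R]^i M)
      (fun i : ℕ => ⋀[R]^i M) (ExteriorAlgebra.ι R m) = 0 := by
    rw [← map_mul, ExteriorAlgebra.ι_sq_zero, map_zero]
  simp only [diag, LinearMap.add_apply, LinearMap.comp_apply, AlgHom.toLinearMap_apply, add_mul,
    mul_add, e3, e4, zero_add, add_zero]
  simp only [mul_one, one_mul, uzpow_one] at e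
  have e5 : GradedTensorProduct.includeRight (R := R) (fun i : ℕ => ⋀[R]^i M)
      (fun i : ℕ => ⋀[R]^i M) (ExteriorAlgebra.ι R m) *
      GradedTensorProduct.includeLeft (R := R) (fun i : ℕ => ⋀[R]^i M)
      (fun i : ℕ => ⋀[R]^i M) (ExteriorAlgebra.ι R m) = _ := e
  have e6 : GradedTensorProduct.includeLeft (R := R) (fun i : ℕ => ⋀[R]^i M)
      (fun i : ℕ => ⋀[R]^i M) (ExteriorAlgebra.ι R m) *
      GradedTensorProduct.includeRight (R := R) (fun i : ℕ => ⋀[R]^i M)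
      (fun i : ℕ => ⋀[R]^i M) (ExteriorAlgebra.ι R m) = _ := e2
  rw [e5, e6]
  simp

/-- Co-multiplication `Δ : ⋀M → ⋀M ⊗ ⋀M`, the algebra map induced by the diagonal map of `M`. -/
def comul : ExteriorAlgebra R M →ₐ[R]
    (fun i : ℕ => ⋀[R]^i M) ᵍ⊗[R] (fun i : ℕ => ⋀[R]^i M) :=
  ExteriorAlgebra.lift R ⟨diag R M, diag_sq R M⟩

/-- The part of co-multiplication in `⋀¹M ⊗ ⋀M`: on `⋀ˢM` it is the component
`⋀ˢM → ⋀¹M ⊗ ⋀ˢ⁻¹M` of `Δ`. -/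
def comulOne : ExteriorAlgebra R M →ₗ[R] ExteriorAlgebra R M ⊗[R] ExteriorAlgebra R M :=
  LinearMap.rTensor (ExteriorAlgebra R M) (extProj R M 1) ∘ₗ
    (GradedTensorProduct.of R (fun i : ℕ => ⋀[R]^i M)
      (fun i : ℕ => ⋀[R]^i M)).symm.toLinearMap ∘ₗ (comul R M).toLinearMap

/-- The augmentation `⋀M → ⋀⁰M = R`. -/
def aug : ExteriorAlgebra R M →ₗ[R] R :=
  (ExteriorAlgebra.algebraMapInv (R := R) (M := M)).toLinearMap

variable {R M}

/-- A linear map `e : N → M*` makes each element of `N` act on `⋀M` as a graded derivation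
(contraction); this is the induced `⋀N`-module structure on `⋀M`,
`(a ∧ b)(x) = a (b (x))`. -/
def contr {N : Type*} [AddCommGroup N] [Module R N] (e : N →ₗ[R] Module.Dual R M) :
    ExteriorAlgebra R N →ₐ[R] Module.End R (ExteriorAlgebra R M) :=
  ExteriorAlgebra.lift R
    ⟨CliffordAlgebra.contractLeft (Q := (0 : QuadraticForm R M)) ∘ₗ e, fun m =>
      LinearMap.ext fun x =>
        CliffordAlgebra.contractLeft_contractLeft (Q := (0 : QuadraticForm R M)) (d := e m) x⟩

/-- The image of `P' ⊗ Q'` in `P ⊗ Q`, for submodules `P'` and `Q'`. -/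
def tens {P Q : Type*} [AddCommGroup P] [AddCommGroup Q] [Module R P] [Module R Q]
    (P' : Submodule R P) (Q' : Submodule R Q) : Submodule R (P ⊗[R] Q) :=
  LinearMap.range (TensorProduct.mapIncl P' Q')

end Multilinear

section Setup

variable (R : Type u) [CommRing R] (F : Type v) [AddCommGroup F] [Module R F]

/-- `⋀F` -/
abbrev Ex : Type (max u v) := ExteriorAlgebra R F

/-- `⋀F*` -/
abbrev Co : Type (max u v) := ExteriorAlgebra R (Module.Dual R F)

/-- The ambient module: the four summands contain, respectively,
`𝔽(1)`, `𝔽(2)`, `𝔽(3)` and `𝔽(4)`. -/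
abbrev Tot : Type (max u v) :=
  (Co R F ⊗[R] Co R F) × (Ex R F ⊗[R] Co R F) × (Ex R F ⊗[R] Co R F) × (Co R F ⊗[R] Co R F)

variable {R F}

/-- The action of `⋀F*` on `⋀F`. -/
def actD : Co R F →ₐ[R] Module.End R (Ex R F) := contr LinearMap.id

/-- The action of `⋀F` on `⋀F*`. -/
def actF : Ex R F →ₐ[R] Module.End R (Co R F) := contr (Module.Dual.eval R F)

variable (R F)

/-! Inclusions of, and projections to, the four summands of the ambient module. -/

def in1 : Co R F ⊗[R] Co R F →ₗ[R] Tot R F := LinearMap.inl R _ _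

def in2 : Ex R F ⊗[R] Co R F →ₗ[R] Tot R F := LinearMap.inr R _ _ ∘ₗ LinearMap.inl R _ _

def in3 : Ex R F ⊗[R] Co R F →ₗ[R] Tot R F :=
  LinearMap.inr R _ _ ∘ₗ LinearMap.inr R _ _ ∘ₗ LinearMap.inl R _ _

def in4 : Co R F ⊗[R] Co R F →ₗ[R] Tot R F :=
  LinearMap.inr R _ _ ∘ₗ LinearMap.inr R _ _ ∘ₗ LinearMap.inr R _ _

def pr1 : Tot R F →ₗ[R] Co R F ⊗[R] Co R F := LinearMap.fst R _ _

def pr2 : Tot R F →ₗ[R] Ex R F ⊗[R] Co R F := LinearMap.fst R _ _ ∘ₗ LinearMap.snd R _ _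

def pr3 : Tot R F →ₗ[R] Ex R F ⊗[R] Co R F :=
  LinearMap.fst R _ _ ∘ₗ LinearMap.snd R _ _ ∘ₗ LinearMap.snd R _ _

def pr4 : Tot R F →ₗ[R] Co R F ⊗[R] Co R F :=
  LinearMap.snd R _ _ ∘ₗ LinearMap.snd R _ _ ∘ₗ LinearMap.snd R _ _

/-- `⋀ˢF* ⊗ ⋀ᵗF*` -/
def cc (s t : ℤ) : Submodule R (Co R F ⊗[R] Co R F) :=
  tens (extPow R (Module.Dual R F) s) (extPow R (Module.Dual R F) t)

/-- `⋀ˢF ⊗ ⋀ᵗF*` -/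
def ec (s t : ℤ) : Submodule R (Ex R F ⊗[R] Co R F) :=
  tens (extPow R F s) (extPow R (Module.Dual R F) t)

/-- The projection of `⋀F* ⊗ ⋀F*` onto `⋀ˢF* ⊗ ⋀ᵗF*`. -/
def ccProj (s t : ℤ) : Co R F ⊗[R] Co R F →ₗ[R] Co R F ⊗[R] Co R F :=
  TensorProduct.map (extProj R (Module.Dual R F) s) (extProj R (Module.Dual R F) t)

/-- The projection of `⋀F ⊗ ⋀F*` onto `⋀ˢF ⊗ ⋀ᵗF*`. -/
def ecProj (s t : ℤ) : Ex R F ⊗[R] Co R F →ₗ[R] Ex R F ⊗[R] Co R F :=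
  TensorProduct.map (extProj R F s) (extProj R (Module.Dual R F) t)

/-- `𝔽_r(1)^{(t)} = ⋀ᵗF* ⊗ ⋀^{r+1-t}F*` -/
def F1 (r t : ℤ) : Submodule R (Tot R F) := (cc R F t (r + 1 - t)).map (in1 R F)

/-- `𝔽_r(2)^{(t)} = ⋀ᵗF ⊗ ⋀^{r-t}F*` -/
def F2 (r t : ℤ) : Submodule R (Tot R F) := (ec R F t (r - t)).map (in2 R F)

/-- `𝔽_r(3)^{(t)} = ⋀ᵗF ⊗ ⋀^{r-t}F*` -/
def F3 (r t : ℤ) : Submodule R (Tot R F) := (ec R F t (r - t)).map (in3 R F)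

/-- `𝔽_r(4)^{(t)} = ⋀ᵗF* ⊗ ⋀^{r-1-t}F*` -/
def F4 (r t : ℤ) : Submodule R (Tot R F) := (cc R F t (r - 1 - t)).map (in4 R F)

/-- `𝔽_r`, the (direct) sum of all `𝔽_r(i)^{(t)}`. -/
def FF (r : ℤ) : Submodule R (Tot R F) :=
  (⨆ t : ℤ, F1 R F r t) ⊔ (⨆ t : ℤ, F2 R F r t) ⊔ (⨆ t : ℤ, F3 R F r t) ⊔ (⨆ t : ℤ, F4 R F r t)

/-- `μ : a₁ ⊗ α ↦ a₁(α)`; on `F ⊗ ⋀ˢF*` this is `μ_s`. -/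
def mu : Ex R F ⊗[R] Co R F →ₗ[R] Co R F := TensorProduct.lift (actF (R := R) (F := F)).toLinearMap

/-- `c ⊗ y ↦ c y` for `c ∈ ⋀⁰ = R` (and `0` on `⋀ˢ ⊗ ⋀`, `s > 0`). -/
def dropL : Co R F ⊗[R] Co R F →ₗ[R] Co R F :=
  TensorProduct.lift (LinearMap.lsmul R (Co R F) ∘ₗ aug R (Module.Dual R F))

/-- `x ⊗ c ↦ c x` for `c ∈ ⋀⁰ = R` (and `0` on `⋀ ⊗ ⋀ˢ`, `s > 0`). -/
def dropR : Co R F ⊗[R] Co R F →ₗ[R] Co R F :=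
  dropL R F ∘ₗ (TensorProduct.comm R (Co R F) (Co R F)).toLinearMap

end Setup

/-- The data: a homomorphism `X : F → F*`, elements `u, v` of `F`, and orientation elements
`η ∈ ⋀ⁿF`, `ε ∈ ⋀ⁿF*` with `η(ε) = 1`. -/
structure Data (R : Type u) [CommRing R] (F : Type v) [AddCommGroup F] [Module R F] (n : ℕ) where
  X : F →ₗ[R] Module.Dual R F
  u : F
  v : F
  eta : Ex R F
  eps : Co R F
  eta_mem : eta ∈ extPow R F n
  eps_mem : eps ∈ extPow R (Module.Dual R F) n
  compat : actF eta eps = 1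

namespace Data

variable {R : Type u} [CommRing R] {F : Type v} [AddCommGroup F] [Module R F] {n : ℕ}
  (D : Data R F n)

/-- The dual map `X* : F = F** → F*`, `X*(a)(b) = X(b)(a)`. -/
def Xs : F →ₗ[R] Module.Dual R F := D.X.flip

/-- `⋀X : ⋀F → ⋀F*` -/
def extX : Ex R F →ₐ[R] Co R F := ExteriorAlgebra.map D.X

/-- `⋀X* : ⋀F → ⋀F*` -/
def extXs : Ex R F →ₐ[R] Co R F := ExteriorAlgebra.map D.Xs

/-- The action of `u` on `⋀F*`. -/
def uAct : Co R F →ₗ[R] Co R F := actF (ExteriorAlgebra.ι R D.u)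

/-- The action of `v` on `⋀F*`. -/
def vAct : Co R F →ₗ[R] Co R F := actF (ExteriorAlgebra.ι R D.v)

/-- `α ↦ α[η]` -/
def onEta : Co R F →ₗ[R] Ex R F := (actD (R := R) (F := F)).toLinearMap.flip D.eta

/-- For `Y : ⋀F → ⋀F*`, the bilinear map `(α, β₁) ↦ [β₁ ∧ Y(α[η])](η)`. -/
def insertion (Y : Ex R F →ₐ[R] Co R F) : Co R F →ₗ[R] Co R F →ₗ[R] Ex R F :=
  ((LinearMap.mul R (Co R F)).flip ∘ₗ Y.toLinearMap ∘ₗ D.onEta).compr₂ D.onEta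

/-- For `Y : ⋀F → ⋀F*`, the map `α ⊗ β ↦ ∑ᵢ [β₁^{[i]} ∧ Y(α[η])](η) ⊗ β_{s-1}^{[i]}`, where
`∑ᵢ β₁^{[i]} ⊗ β_{s-1}^{[i]}` is the component of `Δ(β)` in `⋀¹F* ⊗ ⋀ˢ⁻¹F*`. -/
def gather (Y : Ex R F →ₐ[R] Co R F) : Co R F ⊗[R] Co R F →ₗ[R] Ex R F ⊗[R] Co R F :=
  TensorProduct.lift ((LinearMap.rTensorHom (Co R F) ∘ₗ D.insertion Y).compl₂
    (comulOne R (Module.Dual R F)))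

/-- For `Y : ⋀F → ⋀F*`, the map `a ⊗ β ↦ ∑ⱼ Y(a_{t-1}^{[j]}) ⊗ a₁^{[j]}(β)`, where
`∑ⱼ a₁^{[j]} ⊗ a_{t-1}^{[j]}` is the component of `Δ(a)` in `⋀¹F ⊗ ⋀ᵗ⁻¹F`. -/
def scatter (Y : Ex R F →ₐ[R] Co R F) : Ex R F ⊗[R] Co R F →ₗ[R] Co R F ⊗[R] Co R F :=
  TensorProduct.map Y.toLinearMap (mu R F) ∘ₗ
    (TensorProduct.assoc R (Ex R F) (Ex R F) (Co R F)).toLinearMap ∘ₗ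
    LinearMap.rTensor (Co R F) ((TensorProduct.comm R (Ex R F) (Ex R F)).toLinearMap ∘ₗ
      comulOne R F)

/-- `α ⊗ β ↦ β ⊗ α` -/
def swap : Co R F ⊗[R] Co R F →ₗ[R] Co R F ⊗[R] Co R F :=
  (TensorProduct.comm R (Co R F) (Co R F)).toLinearMap

/-- `f_r(1)`: `α ⊗ β` maps to the sum of
`α ⊗ v(β)` and `(-1)^r u(α) ⊗ β` in `𝔽_{r-1}(1)`,
`∑ᵢ [β₁^{[i]} ∧ (⋀X*)(α[η])](η) ⊗ β_{s-1}^{[i]}` in `𝔽_{r-1}(2)`, and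
`∑ⱼ [α₁^{[j]} ∧ (⋀X)(β[η])](η) ⊗ α_{t-1}^{[j]}` in `𝔽_{r-1}(3)`. -/
def f1 (r : ℤ) : Co R F ⊗[R] Co R F →ₗ[R] Tot R F :=
  in1 R F ∘ₗ (LinearMap.lTensor (Co R F) D.vAct
      + r.negOnePow • LinearMap.rTensor (Co R F) D.uAct)
    + in2 R F ∘ₗ D.gather D.extXs
    + in3 R F ∘ₗ D.gather D.extX ∘ₗ swap

/-- `f_r(2)`: `a ⊗ β` maps to the sum of
`(-1)^r (⋀X)(a) ⊗ β` in `𝔽_{r-1}(1)`,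
`a ⊗ v(β)` and `(-1)^{r+1} [X*(u)](a) ⊗ β` in `𝔽_{r-1}(2)`, and
`∑ⱼ (⋀X)(a_{t-1}^{[j]}) ⊗ a₁^{[j]}(β)` in `𝔽_{r-1}(4)`. -/
def f2 (r : ℤ) : Ex R F ⊗[R] Co R F →ₗ[R] Tot R F :=
  in1 R F ∘ₗ (r.negOnePow • LinearMap.rTensor (Co R F) D.extX.toLinearMap)
    + in2 R F ∘ₗ (LinearMap.lTensor (Ex R F) D.vAct
      + (r + 1).negOnePow •
        LinearMap.rTensor (Co R F) (actD (ExteriorAlgebra.ι R (D.Xs D.u))))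
    + in4 R F ∘ₗ scatter D.extX

/-- `f_r(3)`: `a ⊗ β` maps to the sum of
`(-1)^{r+1} β ⊗ (⋀X*)(a)` in `𝔽_{r-1}(1)`,
`(-1)^{r+1} a ⊗ u(β)` and `[X(v)](a) ⊗ β` in `𝔽_{r-1}(3)`, and
`-∑ⱼ a₁^{[j]}(β) ⊗ (⋀X*)(a_{t-1}^{[j]})` in `𝔽_{r-1}(4)`. -/
def f3 (r : ℤ) : Ex R F ⊗[R] Co R F →ₗ[R] Tot R F :=
  in1 R F ∘ₗ ((r + 1).negOnePow •
      (swap ∘ₗ LinearMap.rTensor (Co R F) D.extXs.toLinearMap))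
    + in3 R F ∘ₗ ((r + 1).negOnePow • LinearMap.lTensor (Ex R F) D.uAct
      + LinearMap.rTensor (Co R F) (actD (ExteriorAlgebra.ι R (D.X D.v))))
    - in4 R F ∘ₗ swap ∘ₗ scatter D.extXs

/-- `f_r(4)`: `α ⊗ β` maps to the sum of
`(-1)^r [(⋀X*)(α[η])](η) ⊗ β` in `𝔽_{r-1}(2)`,
`(-1)^r [(⋀X)(β[η])](η) ⊗ α` in `𝔽_{r-1}(3)`, and
`α ⊗ v(β)` and `(-1)^r u(α) ⊗ β` in `𝔽_{r-1}(4)`. -/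
def f4 (r : ℤ) : Co R F ⊗[R] Co R F →ₗ[R] Tot R F :=
  in2 R F ∘ₗ (r.negOnePow •
      LinearMap.rTensor (Co R F) (D.onEta ∘ₗ D.extXs.toLinearMap ∘ₗ D.onEta))
    + in3 R F ∘ₗ (r.negOnePow •
      (LinearMap.rTensor (Co R F) (D.onEta ∘ₗ D.extX.toLinearMap ∘ₗ D.onEta) ∘ₗ swap))
    + in4 R F ∘ₗ (LinearMap.lTensor (Co R F) D.vAct
      + r.negOnePow • LinearMap.rTensor (Co R F) D.uAct)

/-- The map `f_r : 𝔽_r → 𝔽_{r-1}` (given on the whole ambient module by the same formulas). -/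
def f (r : ℤ) : Tot R F →ₗ[R] Tot R F :=
  D.f1 r ∘ₗ pr1 R F + D.f2 r ∘ₗ pr2 R F + D.f3 r ∘ₗ pr3 R F + D.f4 r ∘ₗ pr4 R F

/-- `σ : α ↦ ∑ᵢ α₁^{[i]}(η) ⊗ α_{s-1}^{[i]}`; on `⋀ˢF*` this is
`σ_s : ⋀ˢF* → ⋀ⁿ⁻¹F ⊗ ⋀ˢ⁻¹F*`. -/
def sigma : Co R F →ₗ[R] Ex R F ⊗[R] Co R F :=
  LinearMap.rTensor (Co R F) D.onEta ∘ₗ comulOne R (Module.Dual R F)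

/-- Scalar coefficient extraction `e ⊗ β ↦ ε(e) β` on `⋀ⁿF ⊗ ⋀F*`, so that `η ⊗ β ↦ β`. -/
def topCoeff : Ex R F ⊗[R] Co R F →ₗ[R] Co R F :=
  TensorProduct.lift (LinearMap.lsmul R (Co R F) ∘ₗ aug R F ∘ₗ actD D.eps)

end Data

/-- A fixed choice of splittings `ℓ_s : ⋀ˢF* → F ⊗ ⋀ˢ⁺¹F*` of `μ_{s+1}` for `s ≠ n`, with
`ℓ_n = 0`, and `λ_s : ⋀ⁿ⁻¹F ⊗ ⋀ˢF* → ⋀ˢ⁺¹F*` of `σ_{s+1}` for `s ≠ -1` (`λ_{-1} = 0` is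
automatic, its source being zero).  The family `(ℓ_s)` is recorded as one homogeneous map on `⋀F*`;
the family `(λ_s)` as one map on `⋀F ⊗ ⋀F*`, of which only the restriction to `⋀ⁿ⁻¹F ⊗ ⋀F*`
matters. -/
structure Splittings {R : Type u} [CommRing R] {F : Type v} [AddCommGroup F] [Module R F] {n : ℕ}
    (D : Data R F n) where
  ell : Co R F →ₗ[R] Ex R F ⊗[R] Co R F
  lam : Ex R F ⊗[R] Co R F →ₗ[R] Co R F
  ell_mem : ∀ s : ℤ, ∀ x ∈ extPow R (Module.Dual R F) s, ell x ∈ ec R F 1 (s + 1)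
  mu_ell : ∀ s : ℤ, s ≠ n → ∀ x ∈ extPow R (Module.Dual R F) s, mu R F (ell x) = x
  ell_top : ∀ x ∈ extPow R (Module.Dual R F) n, ell x = 0
  lam_mem : ∀ s : ℤ, ∀ x ∈ ec R F (n - 1) s, lam x ∈ extPow R (Module.Dual R F) (s + 1)
  lam_sigma : ∀ s : ℤ, s ≠ -1 → ∀ x ∈ extPow R (Module.Dual R F) (s + 1), lam (D.sigma x) = x

namespace Splittings

variable {R : Type u} [CommRing R] {F : Type v} [AddCommGroup F] [Module R F] {n : ℕ}
  {D : Data R F n} (S : Splittings D)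

/-! The submodules `[𝔽_r(i)^{(n-1)}]'`, `[𝔽_r(i)^{(n-1)}]''`, `[𝔽_r(i)^{(1)}]'`, `[𝔽_r(i)^{(1)}]''`
for `i = 2, 3`, as submodules of `⋀F ⊗ ⋀F*`. -/

/-- `[𝔽_r(i)^{(n-1)}]' = Ker λ_{r+1-n}` -/
def topKer (r : ℤ) : Submodule R (Ex R F ⊗[R] Co R F) :=
  ec R F (n - 1) (r + 1 - n) ⊓ LinearMap.ker S.lam

/-- `[𝔽_r(i)^{(n-1)}]'' = Im σ_{r+2-n}` -/
def topIm (_ : Splittings D) (r : ℤ) : Submodule R (Ex R F ⊗[R] Co R F) :=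
  (extPow R (Module.Dual R F) (r + 2 - n)).map D.sigma

/-- `[𝔽_r(i)^{(1)}]' = Ker μ_{r-1}` -/
def botKer (_ : Splittings D) (r : ℤ) : Submodule R (Ex R F ⊗[R] Co R F) :=
  ec R F 1 (r - 1) ⊓ LinearMap.ker (mu R F)

/-- `[𝔽_r(i)^{(1)}]'' = Im ℓ_{r-2}` -/
def botIm (r : ℤ) : Submodule R (Ex R F ⊗[R] Co R F) :=
  (extPow R (Module.Dual R F) (r - 2)).map S.ell

/-- `𝕄̂_r` -/
def Mhat (r : ℤ) : Submodule R (Tot R F) :=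
  (⨆ (t : ℤ) (_ : t ∉ ({0, (n : ℤ), r + 1, r + 1 - n} : Set ℤ)), F1 R F r t)
    ⊔ (S.topKer r).map (in2 R F)
    ⊔ (⨆ (t : ℤ) (_ : 2 ≤ t ∧ t ≤ n - 2), F2 R F r t)
    ⊔ (S.botKer r).map (in2 R F)
    ⊔ (S.topKer r).map (in3 R F)
    ⊔ (⨆ (t : ℤ) (_ : 2 ≤ t ∧ t ≤ n - 2), F3 R F r t)
    ⊔ (S.botKer r).map (in3 R F)
    ⊔ (⨆ (t : ℤ) (_ : t ∉ ({0, (n : ℤ), r - 1, r - 1 - n} : Set ℤ)), F4 R F r t)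

/-- `𝕄_r` -/
def MM (r : ℤ) : Submodule R (Tot R F) :=
  if r = 0 then S.Mhat 0 ⊔ F3 R F 0 0
  else if r = 2 then S.Mhat 2 ⊔ (S.botIm 2).map (in3 R F)
  else if r = 2 * n - 2 then S.Mhat (2 * n - 2) ⊔ (S.topIm (2 * n - 2)).map (in3 R F)
  else if r = 2 * n then S.Mhat (2 * n) ⊔ F3 R F (2 * n) n
  else S.Mhat r

/-- `ℕ̂_r` -/
def Nhat (r : ℤ) : Submodule R (Tot R F) :=
  (if n ≤ r ∧ r ≤ 2 * n - 1 then F1 R F r n else ⊥)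
    ⊔ (if n ≤ r ∧ r ≤ 2 * n - 2 then F1 R F r (r + 1 - n) else ⊥)
    ⊔ (if 0 ≤ r ∧ r ≤ n then F2 R F r 0 else ⊥)
    ⊔ (if 2 ≤ r ∧ r ≤ n + 1 then (S.botIm r).map (in2 R F) else ⊥)
    ⊔ (if 1 ≤ r ∧ r ≤ n then F3 R F r 0 else ⊥)
    ⊔ (if 3 ≤ r ∧ r ≤ n + 1 then (S.botIm r).map (in3 R F) else ⊥)
    ⊔ (if n + 1 ≤ r ∧ r ≤ 2 * n + 1 then F4 R F r n else ⊥)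
    ⊔ (if n + 1 ≤ r ∧ r ≤ 2 * n then F4 R F r (r - 1 - n) else ⊥)

/-- `ℕ_r = ℕ̂_r + f_{r+1}(ℕ̂_{r+1})` -/
def NN (r : ℤ) : Submodule R (Tot R F) :=
  S.Nhat r ⊔ (S.Nhat (r + 1)).map (D.f (r + 1))

/-- `𝕃_r` -/
def LL (r : ℤ) : Submodule R (Tot R F) :=
  (if -1 ≤ r ∧ r ≤ n - 1 then F1 R F r 0 else ⊥)
    ⊔ (if 0 ≤ r ∧ r ≤ n - 1 then F1 R F r (r + 1) else ⊥)
    ⊔ (if n - 1 ≤ r ∧ r ≤ 2 * n - 2 then (S.topIm r).map (in2 R F) else ⊥)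
    ⊔ (if n ≤ r ∧ r ≤ 2 * n then F2 R F r n else ⊥)
    ⊔ (if n - 1 ≤ r ∧ r ≤ 2 * n - 3 then (S.topIm r).map (in3 R F) else ⊥)
    ⊔ (if n ≤ r ∧ r ≤ 2 * n - 1 then F3 R F r n else ⊥)
    ⊔ (if 1 ≤ r ∧ r ≤ n then F4 R F r 0 else ⊥)
    ⊔ (if 2 ≤ r ∧ r ≤ n then F4 R F r (r - 1) else ⊥)

/-! For `i = 2, 3` and a map `g` on `⋀F ⊗ ⋀F*`, resp. for `i = 1, 4` and degrees `s, t`, the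
endomorphism of the ambient module that acts on the `i`-th summand as `g`, resp. as the projection
onto `⋀ˢF* ⊗ ⋀ᵗF*`, and kills the other summands. -/

def on1 (_ : Splittings D) (s t : ℤ) : Tot R F →ₗ[R] Tot R F := in1 R F ∘ₗ ccProj R F s t ∘ₗ pr1 R F

def on2 (_ : Splittings D) (g : Ex R F ⊗[R] Co R F →ₗ[R] Ex R F ⊗[R] Co R F) :
    Tot R F →ₗ[R] Tot R F := in2 R F ∘ₗ g ∘ₗ pr2 R F

def on3 (_ : Splittings D) (g : Ex R F ⊗[R] Co R F →ₗ[R] Ex R F ⊗[R] Co R F) :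
    Tot R F →ₗ[R] Tot R F := in3 R F ∘ₗ g ∘ₗ pr3 R F

def on4 (_ : Splittings D) (s t : ℤ) : Tot R F →ₗ[R] Tot R F := in4 R F ∘ₗ ccProj R F s t ∘ₗ pr4 R F

/-- The projection `σ ∘ λ` of `𝔽_r(i)^{(n-1)}` onto `[𝔽_r(i)^{(n-1)}]''`, for `i = 2, 3`. -/
def topProj (r : ℤ) : Ex R F ⊗[R] Co R F →ₗ[R] Ex R F ⊗[R] Co R F :=
  D.sigma ∘ₗ S.lam ∘ₗ ecProj R F (n - 1) (r + 1 - n)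

/-- The projection `ℓ ∘ μ` of `𝔽_r(i)^{(1)}` onto `[𝔽_r(i)^{(1)}]''`, for `i = 2, 3`. -/
def botProj (r : ℤ) : Ex R F ⊗[R] Co R F →ₗ[R] Ex R F ⊗[R] Co R F :=
  S.ell ∘ₗ mu R F ∘ₗ ecProj R F 1 (r - 1)

/-- `π^𝕃_r`, the projection of `𝔽_r = 𝕃_r ⊕ 𝕄_r ⊕ ℕ̂_r` onto `𝕃_r`. -/
def piL (r : ℤ) : Tot R F →ₗ[R] Tot R F :=
  (if -1 ≤ r ∧ r ≤ n - 1 then S.on1 0 (r + 1) else 0)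
    + (if 0 ≤ r ∧ r ≤ n - 1 then S.on1 (r + 1) 0 else 0)
    + (if n - 1 ≤ r ∧ r ≤ 2 * n - 2 then S.on2 (S.topProj r) else 0)
    + (if n ≤ r ∧ r ≤ 2 * n then S.on2 (ecProj R F n (r - n)) else 0)
    + (if n - 1 ≤ r ∧ r ≤ 2 * n - 3 then S.on3 (S.topProj r) else 0)
    + (if n ≤ r ∧ r ≤ 2 * n - 1 then S.on3 (ecProj R F n (r - n)) else 0)
    + (if 1 ≤ r ∧ r ≤ n then S.on4 0 (r - 1) else 0)
    + (if 2 ≤ r ∧ r ≤ n then S.on4 (r - 1) 0 else 0)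

/-- `π^𝕄_r`, the projection of `𝔽_r = 𝕃_r ⊕ 𝕄_r ⊕ ℕ̂_r` onto `𝕄_r`. -/
def piM (r : ℤ) : Tot R F →ₗ[R] Tot R F :=
  (∑ t ∈ Finset.Icc (0 : ℤ) n \ {0, (n : ℤ), r + 1, r + 1 - n}, S.on1 t (r + 1 - t))
    + S.on2 (ecProj R F (n - 1) (r + 1 - n) - S.topProj r)
    + (∑ t ∈ Finset.Icc (2 : ℤ) (n - 2), S.on2 (ecProj R F t (r - t)))
    + S.on2 (ecProj R F 1 (r - 1) - S.botProj r)
    + S.on3 (ecProj R F (n - 1) (r + 1 - n) - S.topProj r)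
    + (∑ t ∈ Finset.Icc (2 : ℤ) (n - 2), S.on3 (ecProj R F t (r - t)))
    + S.on3 (ecProj R F 1 (r - 1) - S.botProj r)
    + (∑ t ∈ Finset.Icc (0 : ℤ) n \ {0, (n : ℤ), r - 1, r - 1 - n}, S.on4 t (r - 1 - t))
    + (if r = 0 then S.on3 (ecProj R F 0 0) else 0)
    + (if r = 2 then S.on3 (S.botProj 2) else 0)
    + (if r = 2 * n - 2 then S.on3 (S.topProj (2 * n - 2)) else 0)
    + (if r = 2 * n then S.on3 (ecProj R F n n) else 0)

/-- `σ(β) ↦ β` on `[𝔽_r(i)^{(n-1)}]''`, where `β ∈ ⋀^{r+2-n}F*`. -/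
def unsigma (r : ℤ) : Ex R F ⊗[R] Co R F →ₗ[R] Co R F :=
  S.lam ∘ₗ ecProj R F (n - 1) (r + 1 - n)

/-- `η ⊗ β ↦ β` on `𝔽_r(i)^{(n)}`, `i = 2, 3`, where `β ∈ ⋀^{r-n}F*`. -/
def untop (_ : Splittings D) (r : ℤ) : Ex R F ⊗[R] Co R F →ₗ[R] Co R F :=
  D.topCoeff ∘ₗ ecProj R F n (r - n)

/-- `β ↦ 1 ⊗ β` -/
def oneT (_ : Splittings D) : Co R F →ₗ[R] Ex R F ⊗[R] Co R F :=
  TensorProduct.mk R (Ex R F) (Co R F) 1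

/-- `β ↦ ε ⊗ β` -/
def epsL (_ : Splittings D) : Co R F →ₗ[R] Co R F ⊗[R] Co R F :=
  TensorProduct.mk R (Co R F) (Co R F) D.eps

/-- `β ↦ β ⊗ ε` -/
def epsR (_ : Splittings D) : Co R F →ₗ[R] Co R F ⊗[R] Co R F :=
  (TensorProduct.mk R (Co R F) (Co R F)).flip D.eps

/-- `τ_r(1)` : `1 ⊗ β_{r+1} ↦ (-1)^{r+1} 1 ⊗ β_{r+1} ∈ 𝔽_{r+1}(2)^{(0)}` for `-1 ≤ r ≤ n-1`, and
`α_{r+1} ⊗ 1 ↦ (-1)^r 1 ⊗ α_{r+1} ∈ 𝔽_{r+1}(3)^{(0)}` for `0 ≤ r ≤ n-1`. -/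
def tau1 (r : ℤ) : Co R F ⊗[R] Co R F →ₗ[R] Tot R F :=
  (if -1 ≤ r ∧ r ≤ n - 1 then
      (r + 1).negOnePow • (in2 R F ∘ₗ S.oneT ∘ₗ dropL R F ∘ₗ ccProj R F 0 (r + 1)) else 0)
    + (if 0 ≤ r ∧ r ≤ n - 1 then
      r.negOnePow • (in3 R F ∘ₗ S.oneT ∘ₗ dropR R F ∘ₗ ccProj R F (r + 1) 0) else 0)

/-- `τ_r(2)` : `σ(β) ↦ ε ⊗ β + δ_{r,n-1} (-1)^n v(β) ⊗ ε ∈ 𝔽_{r+1}(1)^{(n)} + 𝔽_n(3)^{(0)}`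
for `n-1 ≤ r ≤ 2n-2`, and
`η ⊗ β ↦ (-1)^{r+1} ε ⊗ β + δ_{r,n} β ℓ(u(ε)) ∈ 𝔽_{r+1}(4)^{(n)} + [𝔽_{n+1}(3)^{(1)}]''`
for `n ≤ r ≤ 2n`. -/
def tau2 (r : ℤ) : Ex R F ⊗[R] Co R F →ₗ[R] Tot R F :=
  (if n - 1 ≤ r ∧ r ≤ 2 * n - 2 then
      in1 R F ∘ₗ S.epsL ∘ₗ S.unsigma r
        + (if r = n - 1 then
            (n : ℤ).negOnePow • ((aug R (Module.Dual R F) ∘ₗ D.vAct ∘ₗ S.unsigma r).smulRight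
              (in3 R F (1 ⊗ₜ[R] D.eps))) else 0)
      else 0)
    + (if n ≤ r ∧ r ≤ 2 * n then
      (r + 1).negOnePow • (in4 R F ∘ₗ S.epsL ∘ₗ S.untop r)
        + (if r = n then
            (aug R (Module.Dual R F) ∘ₗ S.untop r).smulRight
              (in3 R F (S.ell (D.uAct D.eps))) else 0)
      else 0)

/-- `τ_r(3)` : `σ(β) ↦ β ⊗ ε - δ_{r,n-1} u(β) ⊗ ε ∈ 𝔽_{r+1}(1)^{(r+2-n)} + 𝔽_n(2)^{(0)}`
for `n-1 ≤ r ≤ 2n-3`, and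
`η ⊗ β ↦ (-1)^{r+1} β ⊗ ε + δ_{r,n} (-1)^n β ℓ(v(ε)) ∈ 𝔽_{r+1}(4)^{(r-n)} + [𝔽_{n+1}(2)^{(1)}]''`
for `n ≤ r ≤ 2n-1`. -/
def tau3 (r : ℤ) : Ex R F ⊗[R] Co R F →ₗ[R] Tot R F :=
  (if n - 1 ≤ r ∧ r ≤ 2 * n - 3 then
      in1 R F ∘ₗ S.epsR ∘ₗ S.unsigma r
        - (if r = n - 1 then
            (aug R (Module.Dual R F) ∘ₗ D.uAct ∘ₗ S.unsigma r).smulRight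
              (in2 R F (1 ⊗ₜ[R] D.eps)) else 0)
      else 0)
    + (if n ≤ r ∧ r ≤ 2 * n - 1 then
      (r + 1).negOnePow • (in4 R F ∘ₗ S.epsR ∘ₗ S.untop r)
        + (if r = n then
            (n : ℤ).negOnePow • ((aug R (Module.Dual R F) ∘ₗ S.untop r).smulRight
              (in2 R F (S.ell (D.vAct D.eps)))) else 0)
      else 0)

/-- `τ_r(4)` : `1 ⊗ β_{r-1} ↦ ℓ(β_{r-1}) ∈ [𝔽_{r+1}(2)^{(1)}]''` for `1 ≤ r ≤ n`, and
`α_{r-1} ⊗ 1 ↦ -ℓ(α_{r-1}) ∈ [𝔽_{r+1}(3)^{(1)}]''` for `2 ≤ r ≤ n`. -/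
def tau4 (r : ℤ) : Co R F ⊗[R] Co R F →ₗ[R] Tot R F :=
  (if 1 ≤ r ∧ r ≤ n then in2 R F ∘ₗ S.ell ∘ₗ dropL R F ∘ₗ ccProj R F 0 (r - 1) else 0)
    - (if 2 ≤ r ∧ r ≤ n then in3 R F ∘ₗ S.ell ∘ₗ dropR R F ∘ₗ ccProj R F (r - 1) 0 else 0)

/-- `τ_r : 𝕃_r → ℕ̂_{r+1}` -/
def tau (r : ℤ) : Tot R F →ₗ[R] Tot R F :=
  S.tau1 r ∘ₗ pr1 R F + S.tau2 r ∘ₗ pr2 R F + S.tau3 r ∘ₗ pr3 R F + S.tau4 r ∘ₗ pr4 R F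

/-- `ψ_r : 𝔽_r → 𝕄_r`: the identity on `𝕄_r`, zero on `ℕ̂_r`, and `-π^𝕄_r ∘ f_{r+1} ∘ τ_r` on
`𝕃_r`. -/
def psi (r : ℤ) : Tot R F →ₗ[R] Tot R F :=
  S.piM r - S.piM r ∘ₗ D.f (r + 1) ∘ₗ S.tau r ∘ₗ S.piL r

/-- `m_r = ψ_{r-1} ∘ f_r : 𝕄_r → 𝕄_{r-1}` -/
def m (r : ℤ) : Tot R F →ₗ[R] Tot R F := S.psi (r - 1) ∘ₗ D.f r

/-- `ρ_r = incl - τ_{r-1} ∘ π^𝕃_{r-1} ∘ f_r : 𝕄_r → 𝔽_r` -/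
def rho (r : ℤ) : Tot R F →ₗ[R] Tot R F :=
  LinearMap.id - S.tau (r - 1) ∘ₗ S.piL (r - 1) ∘ₗ D.f r

/-- `𝔽_r = 𝕃_r ⊕ 𝕄_r ⊕ ℕ̂_r`, and `piL r`, `piM r` are the corresponding projections. -/
def Decomposes (r : ℤ) : Prop :=
  FF R F r = S.LL r ⊔ S.MM r ⊔ S.Nhat r ∧
    (∀ x ∈ S.LL r, S.piL r x = x ∧ S.piM r x = 0) ∧
    (∀ x ∈ S.MM r, S.piL r x = 0 ∧ S.piM r x = x) ∧
    (∀ x ∈ S.Nhat r, S.piL r x = 0 ∧ S.piM r x = 0)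

end Splittings
end
end SeqMat

namespace SeqMat

noncomputable section

universe u v

/-! ### Complexes of submodules and the elimination of a contractible part. -/

section AbstractComplexes

variable {R : Type u} [CommRing R] {V : Type v} [AddCommGroup V] [Module R V]

/-! The result is Gaussian elimination in a complex. Suppose that `C r = L r ⊕ M r ⊕ N r` and that
the `L r`-component of `d` on `N (r + 1)` is bijective with inverse `τ r`. Then `N + dN` is a
subcomplex contracted by `τ πL`. Every element has a unique representative in `M` modulo this
subcomplex, and `ψ` computes it. The map `ρ` is the projection onto the kernel of `πL d` along `N`,
and it splits `ψ` compatibly with the differentials. This is `exists_splitting_complexes`, which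
knows nothing of exterior algebras. Three facts about 𝔽 feed it.

The first is that `f` squares to zero (`f_f`). In a basis `comulOne` is a sum over dual bases
(`comulOne_eq_sum`), so `gather`, `scatter` and `sigma` become sums of contractions in both tensor
factors. The relations involving `u` and `v` follow because contractions anticommute and are
intertwined by `⋀Z` and by the cofactor map `cof Z`. The remaining relations compare two routes
through different summands of 𝔽. They rest on three facts about a map `Z : F → F*`: `cof Z` after
`⋀` of the transpose is multiplication by a determinant (`cof_map`); Jacobi's identity on
complementary minors (`map_actD_cof`); and the cofactors of the transpose form the transposed matrix
(`sum_cof_tmul`). The last two combine into `sum_map_actD_cof_tmul`, which is needed in degrees one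
and two.

The second is the decomposition (`decomposes`). Exterior powers vanish outside the degrees from 0 to
`n`, so only a square of bidegrees matters. The border of the square, where a factor is a multiple
of 1, `η` or `ε`, together with the images of `σ` and `ℓ`, is shared between 𝕃 and ℕ̂. The interior
and the kernels of `λ` and `μ` form 𝕄. The idempotents `σλ` and `ℓμ` do the splitting.

The third is that `τ` inverts the 𝕃-component of `f` on ℕ̂ (`piL_f_tau`, `Nhat_le_map_tau`). The
leading terms of `f` send `1 ⊗ β` to `±1 ⊗ β` or `±β ⊗ 1`, send `ℓ(β)` to `1 ⊗ β` or `-β ⊗ 1`, and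
send `ε ⊗ β` or `β ⊗ ε` to `σ(β)` or `±η ⊗ β`, because `cof Z ε = η`. A contraction by `u` or `v`
reaches a second generator of 𝕃 only for `r = n - 1` and `r = n`, and the Kronecker delta terms of
`τ` remove it. The four exceptional pieces of 𝕄 arise since `1 ⊗ 1` and `ε ⊗ ε`, in 𝔽(1) and in
𝔽(4), each have a possible partner both in 𝔽(2) and in 𝔽(3). Only one can be cancelled, and the
partner in 𝔽(3) stays in 𝕄. -/

theorem IsComplex.toChainComplex_d {C : ℤ → Submodule R V} {d : ℤ → V →ₗ[R] V}
    (h : IsComplex C d) (i j : ℤ) (hij : j + 1 = i) (x : C i) :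
    ((h.toChainComplex.d i j).hom x : C j).1 = d i x.1 := by
  dsimp only [IsComplex.toChainComplex]
  rw [dif_pos hij]
  rfl

/-- The component `C i → C j` of a map of degree one, and zero unless `j = i + 1`. -/
def IsComplex.raise {C : ℤ → Submodule R V} {d : ℤ → V →ₗ[R] V} (h : IsComplex C d)
    (s : ℤ → V →ₗ[R] V) (hs : ∀ r, ∀ x ∈ C r, s r x ∈ C (r + 1)) (i j : ℤ) :
    h.toChainComplex.X i ⟶ h.toChainComplex.X j :=
  if hij : i + 1 = j then
    ModuleCat.ofHom ((s i).restrict (p := C i) (q := C j) (fun x hx => by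
      subst hij
      exact hs i x hx))
  else 0

theorem IsComplex.raise_apply {C : ℤ → Submodule R V} {d : ℤ → V →ₗ[R] V} (h : IsComplex C d)
    (s : ℤ → V →ₗ[R] V) (hs : ∀ r, ∀ x ∈ C r, s r x ∈ C (r + 1)) (i j : ℤ) (hij : i + 1 = j)
    (x : C i) : ((h.raise s hs i j).hom x : C j).1 = s i x.1 := by
  exact congrArg (fun g : h.toChainComplex.X i ⟶ h.toChainComplex.X j => (g.hom x : C j).1)
    (dif_pos hij)

/-- A family of maps `s r : C r → C (r + 1)` with `d s + s d = 1` contracts the complex. -/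
theorem IsComplex.nonempty_homotopy {C : ℤ → Submodule R V} {d : ℤ → V →ₗ[R] V}
    (h : IsComplex C d) (s : ℤ → V →ₗ[R] V) (hs : ∀ r, ∀ x ∈ C r, s r x ∈ C (r + 1))
    (hds : ∀ r, ∀ x ∈ C r, d (r + 1) (s r x) + s (r - 1) (d r x) = x) :
    Nonempty (Homotopy (𝟙 h.toChainComplex) 0) := by
  refine ⟨{ hom := h.raise s hs
            zero := fun i j hij => dif_neg fun e => hij e
            comm := fun i => ?_ }⟩
  have h1 : (ComplexShape.down ℤ).Rel i (i - 1) := by simp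
  have h2 : (ComplexShape.down ℤ).Rel (i + 1) i := by simp
  rw [dNext_eq _ h1, prevD_eq _ h2]
  ext x
  have e1 := h.toChainComplex_d i (i - 1) (by omega) x
  have e2 := h.toChainComplex_d (i + 1) i rfl ((h.raise s hs i (i + 1)).hom x)
  have e3 := hds i x.1 x.2
  have e4 := h.raise_apply s hs i (i + 1) rfl x
  have e5 := h.raise_apply s hs (i - 1) i (by omega) ((h.toChainComplex.d i (i - 1)).hom x)
  apply Subtype.ext
  change x.1 = ((h.raise s hs (i - 1) i).hom ((h.toChainComplex.d i (i - 1)).hom x) : C i).1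
    + ((h.toChainComplex.d (i + 1) i).hom ((h.raise s hs i (i + 1)).hom x) : C i).1 + 0
  rw [e5, e2, e4, e1, add_zero, add_comm]
  exact e3.symm

theorem shortExact_of_degreewise {C C' C'' : ℤ → Submodule R V}
    {d d' d'' φ φ' : ℤ → V →ₗ[R] V} (hC : IsComplex C d) (hC' : IsComplex C' d')
    (hC'' : IsComplex C'' d'') (h : IsChainMap C d C' d' φ) (h' : IsChainMap C' d' C'' d'' φ')
    (hzero : h.toHom hC hC' ≫ h'.toHom hC' hC'' = 0)
    (hinj : ∀ r, ∀ x ∈ C r, φ r x = 0 → x = 0)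
    (hsurj : ∀ r, ∀ z ∈ C'' r, ∃ y ∈ C' r, φ' r y = z)
    (hexact : ∀ r, ∀ y ∈ C' r, φ' r y = 0 → ∃ x ∈ C r, φ r x = y) :
    (ShortComplex.mk (h.toHom hC hC') (h'.toHom hC' hC'') hzero).ShortExact := by
  apply HomologicalComplex.shortExact_of_degreewise_shortExact
  intro r
  refine ShortComplex.ShortExact.mk' ?_ ?_ ?_
  · rw [ShortComplex.moduleCat_exact_iff]
    intro y hy
    obtain ⟨x, hx, hxy⟩ := hexact r y.1 y.2 (congrArg Subtype.val hy)
    exact ⟨⟨x, hx⟩, Subtype.ext hxy⟩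
  · rw [ModuleCat.mono_iff_injective]
    change Function.Injective ((φ r).restrict (h.map_mem r))
    rw [injective_iff_map_eq_zero]
    intro x hx
    exact Subtype.ext (hinj r x.1 x.2 (congrArg Subtype.val hx))
  · rw [ModuleCat.epi_iff_surjective]
    intro z
    obtain ⟨y, hy, hyz⟩ := hsurj r z.1 z.2
    exact ⟨⟨y, hy⟩, Subtype.ext hyz⟩

/-- Splitting off the contractible part of a complex: if `C r = L r ⊕ M r ⊕ N r` and
the `L r`-component of `d (r + 1)` restricted to `N (r + 1)` is an isomorphism with inverse `τ r`,
then `N + d N` is a contractible subcomplex, with quotient carried by `M`. -/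
theorem exists_splitting_complexes (C L M N : ℤ → Submodule R V) (d πL πM τ ψ m ρ : ℤ → V →ₗ[R] V)
    (NN : ℤ → Submodule R V) (hNN : ∀ r, NN r = N r ⊔ (N (r + 1)).map (d (r + 1)))
    (hψ : ∀ r x, ψ r x = πM r x - πM r (d (r + 1) (τ r (πL r x))))
    (hm : ∀ r x, m r x = ψ (r - 1) (d r x))
    (hρ : ∀ r x, ρ r x = x - τ (r - 1) (πL (r - 1) (d r x)))
    (hCd : ∀ r, ∀ x ∈ C r, d r x ∈ C (r - 1))
    (hdd : ∀ r, ∀ x ∈ C r, d (r - 1) (d r x) = 0)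
    (hdec : ∀ r, C r = L r ⊔ M r ⊔ N r)
    (hL : ∀ r, ∀ x ∈ L r, πL r x = x ∧ πM r x = 0)
    (hM : ∀ r, ∀ x ∈ M r, πL r x = 0 ∧ πM r x = x)
    (hN : ∀ r, ∀ x ∈ N r, πL r x = 0 ∧ πM r x = 0)
    (hτ : ∀ r, ∀ x ∈ L r, τ r x ∈ N (r + 1))
    (hLτ : ∀ r, ∀ x ∈ L r, πL r (d (r + 1) (τ r x)) = x)
    (hNτ : ∀ r, N (r + 1) ≤ (L r).map (τ r)) :
    ∃ (hF : IsComplex C d) (hN : IsComplex NN d) (hM : IsComplex M m)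
      (hincl : IsChainMap NN d C d (fun _ => LinearMap.id))
      (hpsi : IsChainMap C d M m ψ)
      (hrho : IsChainMap M m C d ρ)
      (hzero : hincl.toHom hN hF ≫ hpsi.toHom hF hM = 0),
      Nonempty (Homotopy (𝟙 hN.toChainComplex) 0) ∧
      (ShortComplex.mk (hincl.toHom hN hF) (hpsi.toHom hF hM) hzero).ShortExact ∧
      hrho.toHom hM hF ≫ hpsi.toHom hF hM = 𝟙 hM.toChainComplex := by
  have LC : ∀ r, L r ≤ C r := fun r => by
    rw [hdec]; exact le_sup_left.trans le_sup_left
  have MC : ∀ r, M r ≤ C r := fun r => by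
    rw [hdec]; exact le_sup_right.trans le_sup_left
  have NC : ∀ r, N r ≤ C r := fun r => by
    rw [hdec]; exact le_sup_right
  have split : ∀ r, ∀ x ∈ C r, πL r x ∈ L r ∧ πM r x ∈ M r ∧ x - πL r x - πM r x ∈ N r := by
    intro r x hx
    rw [hdec] at hx
    obtain ⟨y, hy, z, hz, rfl⟩ := Submodule.mem_sup.1 hx
    obtain ⟨l, hl, p, hp, rfl⟩ := Submodule.mem_sup.1 hy
    have e1 : πL r (l + p + z) = l := by
      rw [map_add, map_add, (hL r l hl).1, (hM r p hp).1, (hN r z hz).1, add_zero, add_zero]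
    have e2 : πM r (l + p + z) = p := by
      rw [map_add, map_add, (hL r l hl).2, (hM r p hp).2, (hN r z hz).2, add_zero, zero_add]
    rw [e1, e2]
    refine ⟨hl, hp, ?_⟩
    have : l + p + z - l - p = z := by abel
    rwa [this]
  -- `d` at `r + 1`
  have dmem : ∀ r, ∀ x ∈ C (r + 1), d (r + 1) x ∈ C r := by
    intro r x hx
    have := hCd (r + 1) x hx
    rwa [add_sub_cancel_right] at this
  have dd : ∀ r, ∀ x ∈ C (r + 1), d r (d (r + 1) x) = 0 := by
    intro r x hx
    have := hdd (r + 1) x hx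
    rwa [add_sub_cancel_right] at this
  have hNτ' : ∀ r, ∀ y ∈ N (r + 1), τ r (πL r (d (r + 1) y)) = y := by
    intro r y hy
    obtain ⟨x, hx, rfl⟩ := hNτ r hy
    rw [hLτ r x hx]
  have NNC : ∀ r, NN r ≤ C r := by
    intro r
    rw [hNN]
    refine sup_le (NC r) ?_
    rintro _ ⟨y, hy, rfl⟩
    exact dmem r y (NC _ hy)
  have ψNN : ∀ r, ∀ x ∈ NN r, ψ r x = 0 := by
    intro r x hx
    rw [hNN] at hx
    obtain ⟨y, hy, z, ⟨w, hw, rfl⟩, rfl⟩ := Submodule.mem_sup.1 hx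
    -- For `w ∈ N` the map `τ πL` recovers `w` from `d w`, so the correction term in `ψ (d w)`
    -- equals `πM (d w)`.
    rw [map_add, hψ, hψ, (hN r y hy).1, (hN r y hy).2, hNτ' r w hw]
    simp
  have ψM : ∀ r, ∀ x ∈ M r, ψ r x = x := by
    intro r x hx
    rw [hψ, (hM r x hx).1, (hM r x hx).2]
    simp
  have ψmem : ∀ r, ∀ x ∈ C r, ψ r x ∈ M r := by
    intro r x hx
    rw [hψ]
    refine sub_mem (split r x hx).2.1 (split r _ (dmem r _ (NC _ (hτ r _ (split r x hx).1)))).2.1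
  have ψsub : ∀ r, ∀ x ∈ C r, x - ψ r x ∈ NN r := by
    intro r x hx
    have hl := (split r x hx).1
    have hy := hτ r _ hl
    have hdy := (split r _ (dmem r _ (NC _ hy))).2.2
    rw [hLτ r _ hl] at hdy
    -- The boundary `d τ πL x` has the same `L`-component as `x`. Hence removing that component from
    -- `x` costs an element of `d N`, a change in `M` recorded by `ψ`, and an element of `N`.
    have e : x - ψ r x = (x - πL r x - πM r x)
        - (d (r + 1) (τ r (πL r x)) - πL r x - πM r (d (r + 1) (τ r (πL r x))))
        + d (r + 1) (τ r (πL r x)) := by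
      rw [hψ]; abel
    rw [e, hNN]
    exact Submodule.add_mem_sup (sub_mem (split r x hx).2.2 hdy) ⟨_, hy, rfl⟩
  have NNd : ∀ r, ∀ x ∈ NN r, d r x ∈ NN (r - 1) := by
    intro r x hx
    rw [hNN] at hx
    obtain ⟨y, hy, z, ⟨w, hw, rfl⟩, rfl⟩ := Submodule.mem_sup.1 hx
    rw [map_add, dd r w (NC _ hw), add_zero, hNN, sub_add_cancel]
    exact Submodule.mem_sup_right ⟨y, hy, rfl⟩
  have ψd : ∀ r, ∀ x ∈ C r, ψ (r - 1) (d r (ψ r x)) = ψ (r - 1) (d r x) := by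
    intro r x hx
    have := ψNN _ _ (NNd r _ (ψsub r x hx))
    rw [map_sub, map_sub, sub_eq_zero] at this
    exact this.symm
  have hF : IsComplex C d := ⟨hCd, hdd⟩
  have hNc : IsComplex NN d := ⟨NNd, fun r x hx => hdd r x (NNC r hx)⟩
  have hMc : IsComplex M m := by
    refine ⟨fun r x hx => ?_, fun r x hx => ?_⟩
    · rw [hm]; exact ψmem _ _ (hCd r x (MC r hx))
    · rw [hm, hm, ψd _ _ (hCd r x (MC r hx)), hdd r x (MC r hx), map_zero]
  have hincl : IsChainMap NN d C d (fun _ => LinearMap.id) :=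
    ⟨fun r x hx => NNC r hx, fun r x hx => rfl⟩
  have hpsi : IsChainMap C d M m ψ := by
    refine ⟨ψmem, fun r x hx => ?_⟩
    rw [hm, ψd r x hx]
  have τmem : ∀ r, ∀ x ∈ C r, τ (r - 1) (πL (r - 1) (d r x)) ∈ N r := by
    intro r x hx
    have := hτ (r - 1) _ (split _ _ (hCd r x hx)).1
    rwa [sub_add_cancel] at this
  have ρC : ∀ r, ∀ x ∈ C r, ρ r x ∈ C r := by
    intro r x hx
    rw [hρ]
    exact sub_mem hx (NC r (τmem r x hx))
  have ψρ : ∀ r, ∀ x ∈ M r, ψ r (ρ r x) = x := by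
    intro r x hx
    have : ψ r (τ (r - 1) (πL (r - 1) (d r x))) = 0 := ψNN r _ (by
      rw [hNN]; exact Submodule.mem_sup_left (τmem r x (MC r hx)))
    rw [hρ, map_sub, this, sub_zero, ψM r x hx]
  have hNτr : ∀ r, ∀ y ∈ N r, τ (r - 1) (πL (r - 1) (d r y)) = y := by
    intro r y hy
    have := hNτ' (r - 1) y (by rwa [sub_add_cancel])
    rwa [sub_add_cancel] at this
  -- This and the next two facts identify `ρ` as the projection onto the kernel of `πL d` along `N`.
  have ρN : ∀ r, ∀ x ∈ N r, ρ r x = 0 := by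
    intro r x hx
    rw [hρ, hNτr r x hx, sub_self]
  have πρ : ∀ r, ∀ x ∈ C r, πL (r - 1) (d r (ρ r x)) = 0 := by
    intro r x hx
    have := hLτ (r - 1) _ (split _ _ (hCd r x hx)).1
    rw [sub_add_cancel] at this
    rw [hρ, map_sub, map_sub, this, sub_self]
  have ρker : ∀ r, ∀ x ∈ C r, πL (r - 1) (d r x) = 0 → ρ r x = x := by
    intro r x hx h
    rw [hρ, h, map_zero, sub_zero]
  have hrho : IsChainMap M m C d ρ := by
    refine ⟨fun r x hx => ρC r x (MC r hx), fun r x hx => ?_⟩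
    have hx' := MC r hx
    have hy := ρC r x hx'
    have h1 : m r x = ψ (r - 1) (d r (ρ r x)) := by
      have := ψd r _ hy
      rw [ψρ r x hx] at this
      rw [hm, this]
    -- The element `d ρ x` has no `L`-component, so it is its `M`-component `m x` plus an element of
    -- `N`. Now `ρ` kills the latter and fixes the cycle `d ρ x`, which gives `d ρ x = ρ (m x)`.
    have hz := hCd r _ hy
    have h0 := πρ r x hx'
    have h2 : ψ (r - 1) (d r (ρ r x)) = πM (r - 1) (d r (ρ r x)) := by
      rw [hψ, h0]; simp
    have h3 := (split _ _ hz).2.2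
    rw [h0, sub_zero] at h3
    have h4 := ρN _ _ h3
    have h5 := ρker _ _ hz (by rw [hdd r _ hy, map_zero])
    rw [map_sub, h5, sub_eq_zero] at h4
    rw [h1, h2]
    exact h4
  have hzero : hincl.toHom hNc hF ≫ hpsi.toHom hF hMc = 0 := by
    apply HomologicalComplex.hom_ext
    intro r
    ext x
    exact Subtype.ext (ψNN r x.1 x.2)
  refine ⟨hF, hNc, hMc, hincl, hpsi, hrho, hzero, ?_, ?_, ?_⟩
  -- The contraction is `τ πL`: on `y ∈ N` it vanishes and recovers `y` from `d y`, while on `d w`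
  -- it returns `w`.
  · refine hNc.nonempty_homotopy (fun r => τ r ∘ₗ πL r) (fun r x hx => ?_) (fun r x hx => ?_)
    · rw [hNN]
      exact Submodule.mem_sup_left (hτ r _ (split r x (NNC r hx)).1)
    · rw [hNN] at hx
      obtain ⟨y, hy, z, ⟨w, hw, rfl⟩, rfl⟩ := Submodule.mem_sup.1 hx
      simp only [LinearMap.comp_apply, map_add]
      rw [hNτ' r w hw, (hN r y hy).1, hNτr r y hy, dd r w (NC _ hw)]
      simp [add_comm]
  · refine shortExact_of_degreewise _ _ _ _ _ _ (fun r x _ h => h)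
      (fun r z hz => ⟨z, MC r hz, ψM r z hz⟩) (fun r y hy h => ⟨y, ?_, rfl⟩)
    have := ψsub r y hy
    rwa [h, sub_zero] at this
  · apply HomologicalComplex.hom_ext
    intro r
    ext x
    exact Subtype.ext (ψρ r x.1 x.2)

end AbstractComplexes

/-! ### The grading of the exterior algebra by the integers. -/

section ExteriorGrading

variable {R : Type u} [CommRing R] {M : Type v} [AddCommGroup M] [Module R M]

theorem ext_induction {P : ExteriorAlgebra R M → Prop} (halg : ∀ r, P (algebraMap R _ r))
    (hadd : ∀ x y, P x → P y → P (x + y)) (hmul : ∀ m x, P x → P (ExteriorAlgebra.ι R m * x))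
    (x : ExteriorAlgebra R M) : P x :=
  CliffordAlgebra.left_induction (0 : QuadraticForm R M) halg hadd (fun x m h => hmul m x h) x

theorem extPow_natCast (k : ℕ) : extPow R M (k : ℤ) = ⋀[R]^k M := rfl

theorem extPow_of_neg {t : ℤ} (ht : t < 0) : extPow R M t = ⊥ := by
  obtain ⟨k, rfl⟩ := Int.eq_negSucc_of_lt_zero ht
  rfl

/-- Membership in a power of the range of `ι` is generated by left multiplication with vectors. The
hypothesis `hzero` in all degrees covers the negative ones, where the exterior power is zero. -/
theorem extPow_induction {P : ℤ → ExteriorAlgebra R M → Prop}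
    (halg : ∀ r, P 0 (algebraMap R _ r))
    (hzero : ∀ t, P t 0)
    (hadd : ∀ t x y, P t x → P t y → P t (x + y))
    (hmul : ∀ t m x, x ∈ extPow R M t → P t x → P (t + 1) (ExteriorAlgebra.ι R m * x))
    {t : ℤ} {x : ExteriorAlgebra R M} (hx : x ∈ extPow R M t) : P t x := by
  rcases lt_or_ge t 0 with ht | ht
  · rw [extPow_of_neg ht, Submodule.mem_bot] at hx
    rw [hx]; exact hzero t
  · obtain ⟨k, rfl⟩ := Int.eq_ofNat_of_zero_le ht
    rw [extPow_natCast] at hx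
    clear ht
    induction hx using Submodule.pow_induction_on_left' with
    | algebraMap r => exact halg r
    | add x y i _ _ hx hy => exact hadd _ _ _ hx hy
    | mem_mul m hm i x hx ih =>
      obtain ⟨m, rfl⟩ := hm
      have := hmul i m x hx ih
      simpa using this

theorem extPow_ι_mem (m : M) : ExteriorAlgebra.ι R m ∈ extPow R M 1 := by
  change _ ∈ ⋀[R]^1 M
  simp [ExteriorAlgebra.exteriorPower]

theorem extPow_algebraMap_mem (r : R) : algebraMap R (ExteriorAlgebra R M) r ∈ extPow R M 0 := by
  change _ ∈ ⋀[R]^0 M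
  simp [ExteriorAlgebra.exteriorPower]

theorem extPow_one_mem : (1 : ExteriorAlgebra R M) ∈ extPow R M 0 := by
  simpa using extPow_algebraMap_mem (M := M) (1 : R)

theorem mem_extPow_zero {x : ExteriorAlgebra R M} (hx : x ∈ extPow R M 0) :
    ∃ r : R, x = algebraMap R _ r := by
  have hx : x ∈ ⋀[R]^0 M := hx
  rw [ExteriorAlgebra.exteriorPower, pow_zero, Submodule.mem_one] at hx
  obtain ⟨r, rfl⟩ := hx
  exact ⟨r, rfl⟩

theorem aug_algebraMap (r : R) : aug R M (algebraMap R _ r) = r := by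
  simp [aug, ExteriorAlgebra.algebraMapInv]

theorem algebraMap_aug {x : ExteriorAlgebra R M} (hx : x ∈ extPow R M 0) :
    algebraMap R _ (aug R M x) = x := by
  obtain ⟨r, rfl⟩ := mem_extPow_zero hx
  rw [aug_algebraMap]

theorem extPow_mul_mem {s t : ℤ} {x y : ExteriorAlgebra R M} (hx : x ∈ extPow R M s)
    (hy : y ∈ extPow R M t) : x * y ∈ extPow R M (s + t) := by
  rcases lt_or_ge s 0 with hs | hs
  · rw [extPow_of_neg hs, Submodule.mem_bot] at hx
    rw [hx, zero_mul]; exact zero_mem _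
  rcases lt_or_ge t 0 with ht | ht
  · rw [extPow_of_neg ht, Submodule.mem_bot] at hy
    rw [hy, mul_zero]; exact zero_mem _
  obtain ⟨k, rfl⟩ := Int.eq_ofNat_of_zero_le hs
  obtain ⟨l, rfl⟩ := Int.eq_ofNat_of_zero_le ht
  exact SetLike.GradedMul.mul_mem (A := fun i : ℕ => ⋀[R]^i M) hx hy

theorem extPow_map_mem {N : Type*} [AddCommGroup N] [Module R N] (X : M →ₗ[R] N) {t : ℤ}
    {x : ExteriorAlgebra R M} (hx : x ∈ extPow R M t) :
    ExteriorAlgebra.map X x ∈ extPow R N t := by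
  refine extPow_induction (P := fun t x => ExteriorAlgebra.map X x ∈ extPow R N t)
    ?_ ?_ ?_ ?_ hx
  · intro r; rw [AlgHom.commutes]; exact extPow_algebraMap_mem r
  · intro t; rw [map_zero]; exact zero_mem _
  · intro t x y hx hy; rw [map_add]; exact add_mem hx hy
  · intro t m x _ h
    rw [map_mul, ExteriorAlgebra.map_apply_ι, add_comm]
    exact extPow_mul_mem (extPow_ι_mem _) h

theorem extProj_of_mem {t : ℤ} {x : ExteriorAlgebra R M} (hx : x ∈ extPow R M t) :
    extProj R M t x = x := by
  rcases lt_or_ge t 0 with ht | ht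
  · rw [extPow_of_neg ht, Submodule.mem_bot] at hx
    rw [hx, map_zero]
  · obtain ⟨k, rfl⟩ := Int.eq_ofNat_of_zero_le ht
    change GradedAlgebra.proj (fun i : ℕ => ⋀[R]^i M) k x = x
    rw [GradedAlgebra.proj_apply]
    exact DirectSum.decompose_of_mem_same (fun i : ℕ => ⋀[R]^i M) hx

theorem extProj_of_mem_ne {s t : ℤ} {x : ExteriorAlgebra R M} (hx : x ∈ extPow R M s)
    (hst : s ≠ t) : extProj R M t x = 0 := by
  rcases lt_or_ge t 0 with ht | ht
  · obtain ⟨k, rfl⟩ := Int.eq_negSucc_of_lt_zero ht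
    rfl
  rcases lt_or_ge s 0 with hs | hs
  · rw [extPow_of_neg hs, Submodule.mem_bot] at hx
    rw [hx, map_zero]
  · obtain ⟨k, rfl⟩ := Int.eq_ofNat_of_zero_le ht
    obtain ⟨l, rfl⟩ := Int.eq_ofNat_of_zero_le hs
    change GradedAlgebra.proj (fun i : ℕ => ⋀[R]^i M) k x = 0
    rw [GradedAlgebra.proj_apply]
    exact DirectSum.decompose_of_mem_ne (fun i : ℕ => ⋀[R]^i M) hx (by simpa using hst)

/-- An element of the exterior algebra is a sum of homogeneous elements. -/
theorem homogeneous_induction {P : ExteriorAlgebra R M → Prop} (hzero : P 0)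
    (hadd : ∀ x y, P x → P y → P (x + y)) (hmem : ∀ (k : ℕ), ∀ x ∈ ⋀[R]^k M, P x)
    (x : ExteriorAlgebra R M) : P x := by
  induction x using DirectSum.Decomposition.inductionOn fun i : ℕ => ⋀[R]^i M with
  | zero => exact hzero
  | homogeneous x => exact hmem _ _ x.2
  | add x y hx hy => exact hadd x y hx hy

/-- The `k`-th exterior power is spanned by a family indexed by the `k`-element subsets of `Fin n`,
and there are none for `k > n`. -/
theorem extPow_of_gt {n : ℕ} (b : Module.Basis (Fin n) R M) {t : ℤ} (ht : (n : ℤ) < t) :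
    extPow R M t = ⊥ := by
  obtain ⟨k, rfl⟩ := Int.eq_ofNat_of_zero_le (by omega : 0 ≤ t)
  rw [extPow_natCast, ← exteriorPower.ιMulti_family_span_fixedDegree_of_span (v := b) R b.span_eq]
  have : IsEmpty (Set.powersetCard (Fin n) k) := by
    rw [Set.isEmpty_coe_sort, Set.powersetCard.eq_empty_iff]
    simp; omega
  rw [Set.range_eq_empty, Submodule.span_empty]

end ExteriorGrading

/-! ### Contraction, and its behaviour on elements of top degree. -/

section Contraction

variable {R : Type u} [CommRing R] {M : Type*} [AddCommGroup M] [Module R M]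
  {N : Type*} [AddCommGroup N] [Module R N]

theorem contr_ι (e : N →ₗ[R] Module.Dual R M) (a : N) :
    contr e (ExteriorAlgebra.ι R a) =
      CliffordAlgebra.contractLeft (Q := (0 : QuadraticForm R M)) (e a) := by
  rw [contr, ExteriorAlgebra.lift_ι_apply]
  rfl

theorem contr_mul (e : N →ₗ[R] Module.Dual R M) (a b : ExteriorAlgebra R N)
    (x : ExteriorAlgebra R M) : contr e (a * b) x = contr e a (contr e b x) := by
  rw [map_mul]; rfl

theorem contr_algebraMap (e : N →ₗ[R] Module.Dual R M) (r : R) (x : ExteriorAlgebra R M) :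
    contr e (algebraMap R _ r) x = r • x := by
  rw [AlgHom.commutes]; rfl

theorem contr_one (e : N →ₗ[R] Module.Dual R M) (x : ExteriorAlgebra R M) :
    contr e 1 x = x := by
  rw [map_one]; rfl

theorem contr_ι_ι_mul (e : N →ₗ[R] Module.Dual R M) (a : N) (m : M) (x : ExteriorAlgebra R M) :
    contr e (ExteriorAlgebra.ι R a) (ExteriorAlgebra.ι R m * x) =
      e a m • x - ExteriorAlgebra.ι R m * contr e (ExteriorAlgebra.ι R a) x := by
  rw [contr_ι]
  exact CliffordAlgebra.contractLeft_ι_mul _ _ _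

theorem contr_ι_algebraMap (e : N →ₗ[R] Module.Dual R M) (a : N) (r : R) :
    contr e (ExteriorAlgebra.ι R a) (algebraMap R _ r) = 0 := by
  rw [contr_ι]
  exact CliffordAlgebra.contractLeft_algebraMap (Q := (0 : QuadraticForm R M)) _ _

theorem contr_ι_one (e : N →ₗ[R] Module.Dual R M) (a : N) :
    contr e (ExteriorAlgebra.ι R a) 1 = 0 := by
  rw [← map_one (algebraMap R _), contr_ι_algebraMap]

theorem contr_ι_ι (e : N →ₗ[R] Module.Dual R M) (a : N) (m : M) :
    contr e (ExteriorAlgebra.ι R a) (ExteriorAlgebra.ι R m) = algebraMap R _ (e a m) := by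
  rw [contr_ι]
  exact CliffordAlgebra.contractLeft_ι (Q := (0 : QuadraticForm R M)) _ _

theorem contr_ι_sq (e : N →ₗ[R] Module.Dual R M) (a : N) (x : ExteriorAlgebra R M) :
    contr e (ExteriorAlgebra.ι R a) (contr e (ExteriorAlgebra.ι R a) x) = 0 := by
  rw [← contr_mul, ExteriorAlgebra.ι_sq_zero, map_zero]; rfl

theorem contr_ι_anticomm (e : N →ₗ[R] Module.Dual R M) (a b : N) (x : ExteriorAlgebra R M) :
    contr e (ExteriorAlgebra.ι R a) (contr e (ExteriorAlgebra.ι R b) x) =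
      -contr e (ExteriorAlgebra.ι R b) (contr e (ExteriorAlgebra.ι R a) x) := by
  rw [contr_ι, contr_ι]
  exact CliffordAlgebra.contractLeft_comm (Q := (0 : QuadraticForm R M)) _ _ _

theorem contr_ι_mem (e : N →ₗ[R] Module.Dual R M) (a : N) {t : ℤ} {x : ExteriorAlgebra R M}
    (hx : x ∈ extPow R M t) : contr e (ExteriorAlgebra.ι R a) x ∈ extPow R M (t - 1) := by
  refine extPow_induction
    (P := fun t x => contr e (ExteriorAlgebra.ι R a) x ∈ extPow R M (t - 1)) ?_ ?_ ?_ ?_ hx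
  · intro r; rw [contr_ι_algebraMap]; exact zero_mem _
  · intro t; rw [map_zero]; exact zero_mem _
  · intro t x y hx hy; rw [map_add]; exact add_mem hx hy
  · intro t m x hx h
    rw [contr_ι_ι_mul]
    have := extPow_mul_mem (extPow_ι_mem m) h
    rw [add_sub_cancel] at this
    rw [add_sub_cancel_right]
    exact sub_mem (Submodule.smul_mem _ _ hx) this

theorem contr_mem (e : N →ₗ[R] Module.Dual R M) {s t : ℤ} {a : ExteriorAlgebra R N}
    (ha : a ∈ extPow R N s) {x : ExteriorAlgebra R M} (hx : x ∈ extPow R M t) :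
    contr e a x ∈ extPow R M (t - s) := by
  refine extPow_induction
    (P := fun s a => contr e a x ∈ extPow R M (t - s)) ?_ ?_ ?_ ?_ ha
  · intro r; rw [contr_algebraMap, sub_zero]; exact Submodule.smul_mem _ _ hx
  · intro t; rw [map_zero]; exact zero_mem _
  · intro t a b ha hb; rw [map_add]; exact add_mem ha hb
  · intro s m a _ h
    rw [contr_mul]
    have := contr_ι_mem e m h
    rwa [sub_sub] at this

/-- Contracting a top degree element with `a ⌟ α` multiplies the contraction with `α` by `a`. -/
theorem contr_contr_ι (e : N →ₗ[R] Module.Dual R M) (e' : M →ₗ[R] Module.Dual R N)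
    (he : ∀ a m, e a m = e' m a) {η : ExteriorAlgebra R M}
    (hη : ∀ m, ExteriorAlgebra.ι R m * η = 0) (m : M) (α : ExteriorAlgebra R N) :
    contr e (contr e' (ExteriorAlgebra.ι R m) α) η = ExteriorAlgebra.ι R m * contr e α η := by
  induction α using ext_induction with
  | halg r => rw [contr_ι_algebraMap, contr_algebraMap, map_zero, mul_smul_comm, hη, smul_zero]; rfl
  | hadd x y hx hy =>
    rw [map_add, map_add, map_add, LinearMap.add_apply, LinearMap.add_apply, hx, hy, mul_add]
  -- The derivation rule is used on both sides. It produces the scalar term `⟨a, m⟩ α(η)` twice with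
  -- opposite signs, by `he`, and the surviving term is the right-hand side.
  | hmul a α ih =>
    rw [contr_ι_ι_mul, map_sub, LinearMap.sub_apply, contr_mul, contr_mul, ih, contr_ι_ι_mul,
      map_smul, he]
    simp

/-- Peeling vectors off `a` reduces this to `contr_contr_ι`. It makes `α ↦ α(η)` linear over `⋀M`:
contraction before evaluating at `η` becomes multiplication afterwards. -/
theorem contr_contr (e : N →ₗ[R] Module.Dual R M) (e' : M →ₗ[R] Module.Dual R N)
    (he : ∀ a m, e a m = e' m a) {η : ExteriorAlgebra R M}
    (hη : ∀ m, ExteriorAlgebra.ι R m * η = 0) (a : ExteriorAlgebra R M)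
    (α : ExteriorAlgebra R N) : contr e (contr e' a α) η = a * contr e α η := by
  induction a using ext_induction with
  | halg r => rw [contr_algebraMap, map_smul, LinearMap.smul_apply, Algebra.smul_def]
  | hadd x y hx hy => rw [map_add, LinearMap.add_apply, map_add, LinearMap.add_apply, hx, hy, add_mul]
  | hmul m a ih => rw [contr_mul, contr_contr_ι e e' he hη, ih, mul_assoc]

theorem contractLeft_map (X : M →ₗ[R] N) (d : Module.Dual R N) (x : ExteriorAlgebra R M) :
    CliffordAlgebra.contractLeft (Q := (0 : QuadraticForm R N)) d (ExteriorAlgebra.map X x) =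
      ExteriorAlgebra.map X
        (CliffordAlgebra.contractLeft (Q := (0 : QuadraticForm R M)) (d ∘ₗ X) x) := by
  induction x using ext_induction with
  | halg r =>
    rw [AlgHom.commutes]
    erw [CliffordAlgebra.contractLeft_algebraMap, CliffordAlgebra.contractLeft_algebraMap]
    rw [map_zero]
  | hadd x y hx hy => rw [map_add, map_add, hx, hy, map_add, map_add]
  | hmul m x ih =>
    rw [map_mul, ExteriorAlgebra.map_apply_ι]
    erw [CliffordAlgebra.contractLeft_ι_mul, CliffordAlgebra.contractLeft_ι_mul]
    erw [ih]
    rw [map_sub, map_smul, map_mul, ExteriorAlgebra.map_apply_ι]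
    rfl

end Contraction

/-! ### The component of the comultiplication with left degree one. -/

section Comultiplication

variable {R : Type u} [CommRing R] {M : Type v} [AddCommGroup M] [Module R M]

/-- The component `⋀ ⊗ ⋀ → ⋀ᵏ ⊗ ⋀` of the graded tensor product. -/
def leftPart (k : ℤ) : (fun i : ℕ => ⋀[R]^i M) ᵍ⊗[R] (fun i : ℕ => ⋀[R]^i M) →ₗ[R]
    ExteriorAlgebra R M ⊗[R] ExteriorAlgebra R M :=
  LinearMap.rTensor (ExteriorAlgebra R M) (extProj R M k) ∘ₗ
    (GradedTensorProduct.of R (fun i : ℕ => ⋀[R]^i M)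
      (fun i : ℕ => ⋀[R]^i M)).symm.toLinearMap

theorem leftPart_tmul (k : ℤ) (x y : ExteriorAlgebra R M) :
    leftPart k (GradedTensorProduct.tmul R (𝒜 := fun i : ℕ => ⋀[R]^i M)
      (ℬ := fun i : ℕ => ⋀[R]^i M) x y) = extProj R M k x ⊗ₜ[R] y := rfl

/-- Products in the graded tensor product carry a sign that depends on the degree of the left
factor, so the generators here have a homogeneous left factor. -/
theorem leftPart_induction
    {P : (fun i : ℕ => ⋀[R]^i M) ᵍ⊗[R] (fun i : ℕ => ⋀[R]^i M) → Prop} (hzero : P 0)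
    (hadd : ∀ x y, P x → P y → P (x + y))
    (hmem : ∀ (k : ℕ), ∀ x ∈ ⋀[R]^k M, ∀ y, P (GradedTensorProduct.tmul R
      (𝒜 := fun i : ℕ => ⋀[R]^i M) (ℬ := fun i : ℕ => ⋀[R]^i M) x y))
    (z : (fun i : ℕ => ⋀[R]^i M) ᵍ⊗[R] (fun i : ℕ => ⋀[R]^i M)) : P z := by
  have key : ∀ w : ExteriorAlgebra R M ⊗[R] ExteriorAlgebra R M,
      P (GradedTensorProduct.of R (fun i : ℕ => ⋀[R]^i M) (fun i : ℕ => ⋀[R]^i M) w) := by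
    intro w
    induction w using TensorProduct.induction_on with
    | zero => rw [map_zero]; exact hzero
    | add x y hx hy => rw [map_add]; exact hadd _ _ hx hy
    | tmul x y =>
      induction x using homogeneous_induction with
      | hzero => rw [TensorProduct.zero_tmul, map_zero]; exact hzero
      | hadd x x' hx hx' => rw [TensorProduct.add_tmul, map_add]; exact hadd _ _ hx hx'
      | hmem k x hx => exact hmem k x hx y
  exact key ((GradedTensorProduct.of R (fun i : ℕ => ⋀[R]^i M) (fun i : ℕ => ⋀[R]^i M)).symm z)

theorem extProj_one_ι_mul (m : M) {k : ℕ} {x : ExteriorAlgebra R M} (hx : x ∈ ⋀[R]^k M) (t : ℤ) :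
    extProj R M (t + 1) (ExteriorAlgebra.ι R m * x) =
      ExteriorAlgebra.ι R m * extProj R M t x := by
  have hx' : x ∈ extPow R M (k : ℤ) := hx
  have hm := extPow_mul_mem (extPow_ι_mem m) hx'
  by_cases h : (k : ℤ) = t
  · subst h
    rw [extProj_of_mem hx', extProj_of_mem (by rwa [add_comm])]
  · rw [extProj_of_mem_ne hx' h, extProj_of_mem_ne hm (by omega), mul_zero]

theorem leftPart_includeLeft_mul (t : ℤ) (m : M)
    (z : (fun i : ℕ => ⋀[R]^i M) ᵍ⊗[R] (fun i : ℕ => ⋀[R]^i M)) :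
    leftPart (t + 1) (GradedTensorProduct.includeLeft (fun i : ℕ => ⋀[R]^i M)
      (fun i : ℕ => ⋀[R]^i M) (ExteriorAlgebra.ι R m) * z) =
      LinearMap.rTensor _ (LinearMap.mulLeft R (ExteriorAlgebra.ι R m)) (leftPart t z) := by
  induction z using leftPart_induction with
  | hzero => simp
  | hadd x y hx hy => rw [mul_add, map_add, hx, hy, map_add, map_add]
  | hmem k x hx y =>
    have := GradedTensorProduct.tmul_one_mul_coe_tmul (R := R) (fun i : ℕ => ⋀[R]^i M)
      (fun i : ℕ => ⋀[R]^i M) (ExteriorAlgebra.ι R m) (⟨x, hx⟩ : ⋀[R]^k M) y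
    rw [GradedTensorProduct.includeLeft_apply, this, leftPart_tmul, leftPart_tmul,
      LinearMap.rTensor_tmul, extProj_one_ι_mul m hx]
    rfl

theorem leftPart_zero_includeLeft_mul (m : M)
    (z : (fun i : ℕ => ⋀[R]^i M) ᵍ⊗[R] (fun i : ℕ => ⋀[R]^i M)) :
    leftPart 0 (GradedTensorProduct.includeLeft (fun i : ℕ => ⋀[R]^i M)
      (fun i : ℕ => ⋀[R]^i M) (ExteriorAlgebra.ι R m) * z) = 0 := by
  -- Left multiplication by a vector raises the left degree by one, so degree zero could only come
  -- from degree `-1`, where the component map is zero.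
  have := leftPart_includeLeft_mul (-1) m z
  rw [neg_add_cancel] at this
  rw [this]
  have h : leftPart (R := R) (M := M) (-1) = 0 := by
    change LinearMap.rTensor _ (0 : ExteriorAlgebra R M →ₗ[R] ExteriorAlgebra R M) ∘ₗ _ = 0
    rw [LinearMap.rTensor_zero, LinearMap.zero_comp]
  rw [h, LinearMap.zero_apply, map_zero]

/-- The sign comes from moving `m` past a left factor of degree `t`. -/
theorem leftPart_includeRight_mul (t : ℕ) (m : M)
    (z : (fun i : ℕ => ⋀[R]^i M) ᵍ⊗[R] (fun i : ℕ => ⋀[R]^i M)) :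
    leftPart t (GradedTensorProduct.includeRight (fun i : ℕ => ⋀[R]^i M)
      (fun i : ℕ => ⋀[R]^i M) (ExteriorAlgebra.ι R m) * z) =
      (-1 : ℤˣ) ^ t • LinearMap.lTensor _ (LinearMap.mulLeft R (ExteriorAlgebra.ι R m))
        (leftPart t z) := by
  induction z using leftPart_induction with
  | hzero => simp
  | hadd x y hx hy => rw [mul_add, map_add, hx, hy, map_add, map_add, smul_add]
  | hmem k x hx y =>
    have hm : ExteriorAlgebra.ι R m ∈ ⋀[R]^1 M := extPow_ι_mem m
    have := GradedTensorProduct.tmul_coe_mul_coe_tmul (R := R) (fun i : ℕ => ⋀[R]^i M)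
      (fun i : ℕ => ⋀[R]^i M) (1 : ExteriorAlgebra R M) (⟨ExteriorAlgebra.ι R m, hm⟩ : ⋀[R]^1 M)
      (⟨x, hx⟩ : ⋀[R]^k M) y
    have h2 : GradedTensorProduct.includeRight (R := R) (fun i : ℕ => ⋀[R]^i M)
      (fun i : ℕ => ⋀[R]^i M) (ExteriorAlgebra.ι R m) * GradedTensorProduct.tmul R
      (𝒜 := fun i : ℕ => ⋀[R]^i M) (ℬ := fun i : ℕ => ⋀[R]^i M) x y =
      (-1 : ℤˣ) ^ k • GradedTensorProduct.tmul R
      (𝒜 := fun i : ℕ => ⋀[R]^i M) (ℬ := fun i : ℕ => ⋀[R]^i M) x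
        (ExteriorAlgebra.ι R m * y) := by
      simpa using this
    have h3 : ∀ (s : ℤˣ) w, leftPart (R := R) (M := M) t (s • w) = s • leftPart t w := by
      intro s w
      rcases Int.units_eq_one_or s with rfl | rfl <;> simp [Units.smul_def]
    rw [h2, h3, leftPart_tmul, leftPart_tmul]
    have hx' : x ∈ extPow R M (k : ℤ) := hx
    by_cases h : k = t
    · subst h
      rw [extProj_of_mem hx', LinearMap.lTensor_tmul]
      rfl
    · rw [extProj_of_mem_ne hx' (by exact_mod_cast h)]
      simp

theorem leftPart_one (t : ℤ) (r : R) :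
    leftPart t (comul R M (algebraMap R _ r)) = extProj R M t (algebraMap R _ r) ⊗ₜ[R] 1 := by
  rw [AlgHom.commutes, GradedTensorProduct.algebraMap_def]
  exact leftPart_tmul _ _ _

theorem comul_ι_mul (m : M) (x : ExteriorAlgebra R M) :
    comul R M (ExteriorAlgebra.ι R m * x) =
      GradedTensorProduct.includeLeft (fun i : ℕ => ⋀[R]^i M)
        (fun i : ℕ => ⋀[R]^i M) (ExteriorAlgebra.ι R m) * comul R M x +
      GradedTensorProduct.includeRight (fun i : ℕ => ⋀[R]^i M)
        (fun i : ℕ => ⋀[R]^i M) (ExteriorAlgebra.ι R m) * comul R M x := by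
  rw [map_mul, ← add_mul]
  congr 1
  rw [comul, ExteriorAlgebra.lift_ι_apply]
  rfl

theorem leftPart_zero_comul (x : ExteriorAlgebra R M) : leftPart 0 (comul R M x) = 1 ⊗ₜ[R] x := by
  induction x using ext_induction with
  | halg r =>
    rw [leftPart_one, extProj_of_mem (extPow_algebraMap_mem r), Algebra.algebraMap_eq_smul_one,
      TensorProduct.smul_tmul]
  | hadd x y hx hy => rw [map_add, map_add, hx, hy, TensorProduct.tmul_add]
  | hmul m x ih =>
    have := leftPart_includeRight_mul (R := R) (M := M) 0 m (comul R M x)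
    rw [Nat.cast_zero] at this
    rw [comul_ι_mul, map_add, leftPart_zero_includeLeft_mul, this, ih, pow_zero, one_smul, zero_add,
      LinearMap.lTensor_tmul]
    rfl

/-- The `⋀¹ ⊗ ⋀`-component of the comultiplication in terms of dual families. -/
theorem comulOne_eq_sum {ι : Type*} [Fintype ι] (x : ExteriorAlgebra R M) (b : ι → M)
    (d : ι → Module.Dual R M) (hb : ∀ m, ∑ i, d i m • b i = m) :
    comulOne R M x = ∑ i, ExteriorAlgebra.ι R (b i) ⊗ₜ[R]
      CliffordAlgebra.contractLeft (Q := (0 : QuadraticForm R M)) (d i) x := by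
  change leftPart 1 (comul R M x) = _
  induction x using ext_induction with
  | halg r =>
    rw [leftPart_one, extProj_of_mem_ne (extPow_algebraMap_mem r) (by decide),
      TensorProduct.zero_tmul]
    symm
    apply Finset.sum_eq_zero
    intro i _
    erw [CliffordAlgebra.contractLeft_algebraMap]
    rw [TensorProduct.tmul_zero]
  | hadd x y hx hy =>
    rw [map_add, map_add, hx, hy, ← Finset.sum_add_distrib]
    refine Finset.sum_congr rfl fun i _ => ?_
    rw [map_add, TensorProduct.tmul_add]
  | hmul m x ih =>
    -- By `Δ(m) = m ⊗ 1 + 1 ⊗ m`, the wanted component of `Δ(m x)` is `m ⊗ x` minus the component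
    -- for `x` with its right factor multiplied by `m`. These are the two terms of the derivation
    -- rule for contraction.
    have h1 := leftPart_includeRight_mul (R := R) (M := M) 1 m (comul R M x)
    rw [Nat.cast_one] at h1
    have h2 := leftPart_includeLeft_mul (R := R) (M := M) 0 m (comul R M x)
    rw [zero_add] at h2
    have h3 : ∀ i, CliffordAlgebra.contractLeft (Q := (0 : QuadraticForm R M)) (d i)
        (ExteriorAlgebra.ι R m * x) = d i m • x - ExteriorAlgebra.ι R m *
        CliffordAlgebra.contractLeft (Q := (0 : QuadraticForm R M)) (d i) x := fun i =>
      CliffordAlgebra.contractLeft_ι_mul _ _ _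
    have h4 : ∑ i, ExteriorAlgebra.ι R (d i m • b i) = ExteriorAlgebra.ι R m := by
      rw [← map_sum, hb]
    rw [comul_ι_mul, map_add, h1, h2, ih, leftPart_zero_comul, pow_one, LinearMap.rTensor_tmul]
    simp_rw [h3, TensorProduct.tmul_sub, ← TensorProduct.smul_tmul]
    rw [Finset.sum_sub_distrib, ← TensorProduct.sum_tmul]
    simp_rw [← map_smul]
    rw [h4, Units.neg_smul, one_smul, sub_eq_add_neg]
    simp

/-- The functionals on `M` may come from another module through `e`. For `M = F*` this lets vectors
of `F` take the place of elements of the double dual. -/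
theorem comulOne_eq_sum_comp {ι : Type*} [Fintype ι] {N : Type*} [AddCommGroup N] [Module R N]
    (e : N →ₗ[R] Module.Dual R M) (b : ι → M) (d : ι → N) (hb : ∀ m, ∑ i, e (d i) m • b i = m) :
    comulOne R M = ∑ i, TensorProduct.mk R (ExteriorAlgebra R M) (ExteriorAlgebra R M)
      (ExteriorAlgebra.ι R (b i)) ∘ₗ contr e (ExteriorAlgebra.ι R (d i)) := by
  refine LinearMap.ext fun x => ?_
  rw [comulOne_eq_sum x b (fun i => e (d i)) hb, LinearMap.sum_apply]
  refine Finset.sum_congr rfl fun i _ => ?_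
  rw [contr_ι]
  rfl

end Comultiplication

/-! ### The mutual actions of `⋀F` and `⋀F*`. -/

section Dual

variable {R : Type u} [CommRing R] {F : Type v} [AddCommGroup F] [Module R F] {n : ℕ}

theorem extPow_mul_ι {t : ℤ} {x : ExteriorAlgebra R F} (hx : x ∈ extPow R F t) (m : F) :
    x * ExteriorAlgebra.ι R m = t.negOnePow • (ExteriorAlgebra.ι R m * x) := by
  refine extPow_induction (P := fun t x => x * ExteriorAlgebra.ι R m =
    t.negOnePow • (ExteriorAlgebra.ι R m * x)) ?_ ?_ ?_ ?_ hx
  · intro r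
    rw [Int.negOnePow_zero, one_smul, Algebra.commutes]
  · intro t; rw [zero_mul, mul_zero, smul_zero]
  · intro t x y hx hy; rw [add_mul, hx, hy, mul_add, smul_add]
  · intro t a x _ ih
    have h := ExteriorAlgebra.ι_add_mul_swap (R := R) a m
    rw [mul_assoc, ih, mul_smul_comm, ← mul_assoc, eq_neg_of_add_eq_zero_left h,
      Int.negOnePow_succ, Units.neg_smul, neg_mul, smul_neg, mul_assoc]

theorem actD_mul (a b : Co R F) (x : Ex R F) : actD (a * b) x = actD a (actD b x) :=
  contr_mul _ _ _ _

theorem actF_mul (a b : Ex R F) (x : Co R F) : actF (a * b) x = actF a (actF b x) :=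
  contr_mul _ _ _ _

/-- Contraction is natural: evaluation at `a` pulls back along `Z` to the functional `Z.flip a`. -/
theorem actF_map (Z : F →ₗ[R] Module.Dual R F) (a : F) (x : Ex R F) :
    actF (ExteriorAlgebra.ι R a) (ExteriorAlgebra.map Z x) =
      ExteriorAlgebra.map Z (actD (ExteriorAlgebra.ι R (Z.flip a)) x) := by
  rw [actF, actD, contr_ι, contr_ι, contractLeft_map, LinearMap.id_apply]
  congr 2

theorem comulOne_basis (b : Module.Basis (Fin n) R F) (a : Ex R F) :
    comulOne R F a = ∑ i, ExteriorAlgebra.ι R (b i) ⊗ₜ[R]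
      actD (ExteriorAlgebra.ι R (b.coord i)) a := by
  rw [comulOne_eq_sum a b b.coord (fun m => b.sum_repr m)]
  simp_rw [actD, contr_ι, LinearMap.id_apply]

variable (R F) in
/-- The component `⋀F* → ⋀¹F* ⊗ ⋀F*` of the comultiplication. -/
def coComulOne : Co R F →ₗ[R] Co R F ⊗[R] Co R F := comulOne R (Module.Dual R F)

theorem coComulOne_basis (b : Module.Basis (Fin n) R F) (α : Co R F) :
    coComulOne R F α = ∑ i, ExteriorAlgebra.ι R (b.coord i) ⊗ₜ[R]
      actF (ExteriorAlgebra.ι R (b i)) α := by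
  have hb : ∀ w : Module.Dual R F, ∑ i, Module.Dual.eval R F (b i) w • b.coord i = w := by
    intro w
    simp_rw [Module.Dual.eval_apply]
    exact b.sum_dual_apply_smul_coord w
  have h : coComulOne R F = ∑ i, TensorProduct.mk R (Co R F) (Co R F)
      (ExteriorAlgebra.ι R (b.coord i)) ∘ₗ actF (ExteriorAlgebra.ι R (b i)) :=
    comulOne_eq_sum_comp (Module.Dual.eval R F) b.coord b hb
  rw [h, LinearMap.sum_apply]
  rfl

theorem extPow_dual_of_gt (b : Module.Basis (Fin n) R F) {t : ℤ} (ht : (n : ℤ) < t) :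
    extPow R (Module.Dual R F) t = ⊥ :=
  extPow_of_gt b.dualBasis ht

end Dual

/-! ### Duality through `η` and `ε`, cofactor maps and Jacobi's identity. -/

namespace Data

variable {R : Type u} [CommRing R] {F : Type v} [AddCommGroup F] [Module R F] {n : ℕ}
  (D : Data R F n)

/-- `a ↦ a[ε]` -/
def onEps : Ex R F →ₗ[R] Co R F := (actF (R := R) (F := F)).toLinearMap.flip D.eps

/-- For `Z : F → F*`, the map `α ↦ [(⋀Z)(α[η])](η)`. -/
def cof (Z : F →ₗ[R] Module.Dual R F) : Co R F →ₗ[R] Ex R F :=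
  D.onEta ∘ₗ (ExteriorAlgebra.map Z).toLinearMap ∘ₗ D.onEta

theorem cof_apply (Z : F →ₗ[R] Module.Dual R F) (α : Co R F) :
    D.cof Z α = D.onEta (ExteriorAlgebra.map Z (D.onEta α)) := rfl

theorem onEta_apply (α : Co R F) : D.onEta α = actD α D.eta := rfl

theorem onEps_apply (a : Ex R F) : D.onEps a = actF a D.eps := rfl

theorem onEta_mul (α β : Co R F) : D.onEta (α * β) = actD α (D.onEta β) := contr_mul _ _ _ _

theorem onEps_mul (a b : Ex R F) : D.onEps (a * b) = actF a (D.onEps b) := contr_mul _ _ _ _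

theorem onEta_one : D.onEta 1 = D.eta := contr_one _ _

theorem onEps_one : D.onEps 1 = D.eps := contr_one _ _

theorem onEps_eta : D.onEps D.eta = 1 := D.compat

theorem ι_mul_eta (b : Module.Basis (Fin n) R F) (m : F) : ExteriorAlgebra.ι R m * D.eta = 0 := by
  have := extPow_mul_mem (extPow_ι_mem m) D.eta_mem
  rwa [extPow_of_gt b (by omega), Submodule.mem_bot] at this

theorem ι_mul_eps (b : Module.Basis (Fin n) R F) (w : Module.Dual R F) :
    ExteriorAlgebra.ι R w * D.eps = 0 := by
  have := extPow_mul_mem (extPow_ι_mem w) D.eps_mem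
  rwa [extPow_dual_of_gt b (by omega), Submodule.mem_bot] at this

/-- Since `η` has top degree, every vector annihilates it, so `contr_contr` applies. With
`onEta_mul`, this says that `onEta` exchanges contraction and multiplication. -/
theorem onEta_actF (b : Module.Basis (Fin n) R F) (a : Ex R F) (α : Co R F) :
    D.onEta (actF a α) = a * D.onEta α := by
  have h := contr_contr (R := R) (M := F) (N := Module.Dual R F) LinearMap.id
    (Module.Dual.eval R F) (fun w m => (Module.Dual.eval_apply R F m w).symm) (D.ι_mul_eta b) a α
  rw [onEta_apply, onEta_apply, actD, actF, h]

theorem onEps_actD (b : Module.Basis (Fin n) R F) (α : Co R F) (a : Ex R F) :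
    D.onEps (actD α a) = α * D.onEps a := by
  have h := contr_contr (R := R) (M := Module.Dual R F) (N := F) (Module.Dual.eval R F)
    LinearMap.id (fun m w => Module.Dual.eval_apply R F m w) (D.ι_mul_eps b) α a
  rw [onEps_apply, onEps_apply, actD, actF, h]

theorem onEps_onEta (b : Module.Basis (Fin n) R F) (α : Co R F) : D.onEps (D.onEta α) = α := by
  rw [onEta_apply, D.onEps_actD b, D.onEps_eta, mul_one]

theorem onEta_mem {t : ℤ} {α : Co R F} (hα : α ∈ extPow R (Module.Dual R F) t) :
    D.onEta α ∈ extPow R F (n - t) :=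
  contr_mem _ hα D.eta_mem

theorem onEps_mem {t : ℤ} {a : Ex R F} (ha : a ∈ extPow R F t) :
    D.onEps a ∈ extPow R (Module.Dual R F) (n - t) :=
  contr_mem _ ha D.eps_mem

/-- The value is a scalar `r` for degree reasons. Applying `onEps` gives `ε = r ε`, and acting with
`η` turns this into `1 = r`. Thus the normalization `η(ε) = 1` also gives `ε(η) = 1`, with no sign.
-/
theorem onEta_eps (b : Module.Basis (Fin n) R F) : D.onEta D.eps = 1 := by
  have h0 := D.onEta_mem D.eps_mem
  rw [sub_self] at h0
  obtain ⟨r, hr⟩ := mem_extPow_zero h0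
  have h1 := congrArg D.onEps hr
  rw [D.onEps_onEta b, Algebra.algebraMap_eq_smul_one, map_smul, D.onEps_one] at h1
  have h2 := congrArg (actF D.eta) h1
  rw [map_smul, D.compat, ← Algebra.algebraMap_eq_smul_one, ← map_one (algebraMap R (Co R F)),
    (ExteriorAlgebra.algebraMap_leftInverse (Module.Dual R F)).injective.eq_iff] at h2
  rw [hr, ← h2, map_one]

theorem onEta_onEps (b : Module.Basis (Fin n) R F) (a : Ex R F) : D.onEta (D.onEps a) = a := by
  rw [onEps_apply, D.onEta_actF b, D.onEta_eps b, mul_one]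

theorem cof_mem (Z : F →ₗ[R] Module.Dual R F) {t : ℤ} {α : Co R F}
    (hα : α ∈ extPow R (Module.Dual R F) t) : D.cof Z α ∈ extPow R F t := by
  have := D.onEta_mem (extPow_map_mem Z (D.onEta_mem hα))
  rwa [sub_sub_cancel] at this

theorem cof_eps (b : Module.Basis (Fin n) R F) (Z : F →ₗ[R] Module.Dual R F) :
    D.cof Z D.eps = D.eta := by
  rw [cof_apply, D.onEta_eps b, map_one, D.onEta_one]

/-- The inner `onEta` turns contraction by `a` into multiplication by `a`, then `⋀Z` turns it into
multiplication by `Z a`, and the outer `onEta` back into contraction. `cof_ι_mul` runs the same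
argument in the opposite direction. -/
theorem cof_actF (b : Module.Basis (Fin n) R F) (Z : F →ₗ[R] Module.Dual R F) (a : F)
    (α : Co R F) : D.cof Z (actF (ExteriorAlgebra.ι R a) α) =
      actD (ExteriorAlgebra.ι R (Z a)) (D.cof Z α) := by
  rw [cof_apply, D.onEta_actF b, map_mul, ExteriorAlgebra.map_apply_ι, onEta_mul, cof_apply]

theorem cof_ι_mul (b : Module.Basis (Fin n) R F) (Z : F →ₗ[R] Module.Dual R F) (a : F)
    (α : Co R F) : D.cof Z (ExteriorAlgebra.ι R (Z.flip a) * α) =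
      ExteriorAlgebra.ι R a * D.cof Z α := by
  rw [cof_apply, onEta_mul, ← actF_map, D.onEta_actF b, cof_apply]

/-- The scalar by which `⋀Zᵗ` followed by `cof Z` acts: the determinant of `Z`. -/
def coDet (Z : F →ₗ[R] Module.Dual R F) : R := aug R F (D.cof Z 1)

theorem cof_one (Z : F →ₗ[R] Module.Dual R F) : D.cof Z 1 = algebraMap R _ (D.coDet Z) :=
  (algebraMap_aug (D.cof_mem Z extPow_one_mem)).symm

/-- This is the adjugate formula in all degrees. On 1 it defines the determinant, and `cof_ι_mul`
moves each further vector outside. -/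
theorem cof_map (b : Module.Basis (Fin n) R F) (Z : F →ₗ[R] Module.Dual R F) (a : Ex R F) :
    D.cof Z (ExteriorAlgebra.map Z.flip a) = D.coDet Z • a := by
  induction a using ext_induction with
  | halg r =>
    rw [AlgHom.commutes, Algebra.algebraMap_eq_smul_one, map_smul, cof_one,
      Algebra.algebraMap_eq_smul_one, Algebra.algebraMap_eq_smul_one, smul_comm]
  | hadd x y hx hy => rw [map_add, map_add, hx, hy, smul_add]
  | hmul m x ih => rw [map_mul, ExteriorAlgebra.map_apply_ι, D.cof_ι_mul b, ih, mul_smul_comm]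

/-- Jacobi's identity on complementary minors. -/
theorem map_actD_cof (b : Module.Basis (Fin n) R F) (Z : F →ₗ[R] Module.Dual R F) {t : ℤ}
    {γ : Co R F} (hγ : γ ∈ extPow R (Module.Dual R F) t) (α : Co R F) :
    ExteriorAlgebra.map Z (actD γ (D.cof Z.flip α)) = actF (D.cof Z γ) α := by
  -- Writing `α = a(ε)` lets the induction run over `a`. For scalar `a` both sides reduce to a
  -- contraction by `onEta` of `⋀Z(γ(η))`; a new vector becomes the same contraction on both sides,
  -- past `γ` on one and past `cof Z γ` on the other, with the same sign `(-1)^t`.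
  rw [← D.onEps_onEta b α]
  generalize D.onEta α = a
  induction a using ext_induction with
  | halg r =>
    rw [Algebra.algebraMap_eq_smul_one, map_smul, map_smul, map_smul, map_smul, map_smul,
      D.onEps_one, D.cof_eps b, ← onEta_apply, cof_apply, ← onEps_apply, D.onEps_onEta b]
  | hadd x y hx hy => simp only [map_add, hx, hy]
  | hmul m a ih =>
    rw [onEps_mul, D.cof_actF b, ← actD_mul, extPow_mul_ι hγ, ← actF_mul,
      extPow_mul_ι (D.cof_mem Z hγ)]
    obtain h | h := Int.units_eq_one_or t.negOnePow
    · rw [h, one_smul, one_smul, actD_mul, ← actF_map, ih, actF_mul]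
    · rw [h, Units.neg_smul, Units.neg_smul, one_smul, one_smul, map_neg, map_neg,
        LinearMap.neg_apply, LinearMap.neg_apply, map_neg, actD_mul, ← actF_map, ih, actF_mul]

theorem map_cof (b : Module.Basis (Fin n) R F) (Z : F →ₗ[R] Module.Dual R F) (α : Co R F) :
    ExteriorAlgebra.map Z (D.cof Z.flip α) = D.coDet Z • α := by
  have := D.map_actD_cof b Z extPow_one_mem α
  rw [cof_one, AlgHom.commutes, map_one] at this
  exact this

theorem coDet_flip (b : Module.Basis (Fin n) R F) (Z : F →ₗ[R] Module.Dual R F) :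
    D.coDet Z.flip = D.coDet Z := by
  have := D.map_cof b Z 1
  rw [cof_one, AlgHom.commutes, ← Algebra.algebraMap_eq_smul_one,
    (ExteriorAlgebra.algebraMap_leftInverse (Module.Dual R F)).injective.eq_iff] at this
  exact this

/-- When the degrees agree, both sides of Jacobi's identity are scalars and `⋀Z` acts on them as the
identity. This is the transposition rule for matrix entries of cofactor maps. -/
theorem aug_cof_flip (b : Module.Basis (Fin n) R F) (Z : F →ₗ[R] Module.Dual R F) {t : ℤ}
    {γ β : Co R F} (hγ : γ ∈ extPow R (Module.Dual R F) t)
    (hβ : β ∈ extPow R (Module.Dual R F) t) :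
    aug R F (actD γ (D.cof Z.flip β)) = aug R (Module.Dual R F) (actF (D.cof Z γ) β) := by
  have h := contr_mem LinearMap.id hγ (D.cof_mem Z.flip hβ)
  rw [sub_self] at h
  rw [← D.map_actD_cof b Z hγ β]
  have h : actD γ (D.cof Z.flip β) ∈ extPow R F 0 := h
  obtain ⟨r, hr⟩ := mem_extPow_zero h
  rw [hr, AlgHom.commutes, aug_algebraMap, aug_algebraMap]

/-- The cofactor maps of `Z` and of its transpose are transposes of each other. -/
theorem sum_cof_tmul (b : Module.Basis (Fin n) R F) (Z : F →ₗ[R] Module.Dual R F) {t : ℤ}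
    {J : Type*} (s : Finset J) (p : J → Ex R F) (q : J → Co R F)
    (hq : ∀ j, q j ∈ extPow R (Module.Dual R F) t)
    (h1 : ∀ c ∈ extPow R F t, ∑ j ∈ s, aug R F (actD (q j) c) • p j = c)
    (h2 : ∀ c ∈ extPow R F t, ∑ j ∈ s, aug R (Module.Dual R F) (actF c (q j)) • p j = c) :
    ∑ j ∈ s, D.cof Z (q j) ⊗ₜ[R] p j = ∑ j ∈ s, p j ⊗ₜ[R] D.cof Z.flip (q j) := by
  calc ∑ j ∈ s, D.cof Z (q j) ⊗ₜ[R] p j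
      = ∑ j ∈ s, ∑ i ∈ s, aug R (Module.Dual R F) (actF (D.cof Z (q j)) (q i)) •
          (p i ⊗ₜ[R] p j) := by
        refine Finset.sum_congr rfl fun j _ => ?_
        -- The second duality relation expands `cof Z (q j)` in the family `p`. The coefficients are
        -- then transposed by `aug_cof_flip` and resummed with the first relation.
        conv_lhs => rw [← h2 _ (D.cof_mem Z (hq j))]
        rw [TensorProduct.sum_tmul]
        simp_rw [TensorProduct.smul_tmul']
    _ = ∑ i ∈ s, ∑ j ∈ s, aug R F (actD (q j) (D.cof Z.flip (q i))) • (p i ⊗ₜ[R] p j) := by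
        rw [Finset.sum_comm]
        refine Finset.sum_congr rfl fun i _ => Finset.sum_congr rfl fun j _ => ?_
        rw [D.aug_cof_flip b Z (hq j) (hq i)]
    _ = _ := by
        refine Finset.sum_congr rfl fun j _ => ?_
        conv_rhs => rw [← h1 _ (D.cof_mem Z.flip (hq j))]
        rw [TensorProduct.tmul_sum]
        simp_rw [TensorProduct.tmul_smul]

end Data

/-! ### Dual-basis expansions in degrees one and two. -/

section Bases

variable {R : Type u} [CommRing R] {F : Type v} [AddCommGroup F] [Module R F] {n : ℕ}

/-- Contraction of `⋀F*` with a basis vector. -/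
def conF (b : Module.Basis (Fin n) R F) (i : Fin n) : Co R F →ₗ[R] Co R F :=
  actF (ExteriorAlgebra.ι R (b i))

/-- Contraction of `⋀F` with a vector of the dual basis. -/
def conD (b : Module.Basis (Fin n) R F) (i : Fin n) : Ex R F →ₗ[R] Ex R F :=
  actD (ExteriorAlgebra.ι R (b.coord i))

theorem coord_expansion (b : Module.Basis (Fin n) R F) (w : Module.Dual R F) :
    ∑ i, w (b i) • b.coord i = w :=
  b.sum_dual_apply_smul_coord w

theorem basis_expansion (b : Module.Basis (Fin n) R F) (m : F) : ∑ i, b.coord i m • b i = m :=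
  b.sum_repr m

/-- Both sides are `Z` viewed as a bilinear form in `F* ⊗ F*`, expanded along its columns or along
its rows. -/
theorem sum_flip_tmul (b : Module.Basis (Fin n) R F) (Z : F →ₗ[R] Module.Dual R F) :
    ∑ i, ExteriorAlgebra.ι R (b.coord i) ⊗ₜ[R] ExteriorAlgebra.ι R (Z.flip (b i)) =
      ∑ i, ExteriorAlgebra.ι R (Z (b i)) ⊗ₜ[R] ExteriorAlgebra.ι R (b.coord i) := by
  have h1 : ∀ i, ExteriorAlgebra.ι R (Z (b i)) =
      ∑ j, Z (b i) (b j) • ExteriorAlgebra.ι R (b.coord j) := fun i => by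
    conv_lhs => rw [← coord_expansion b (Z (b i))]
    rw [map_sum]
    simp_rw [map_smul]
  have h2 : ∀ i, ExteriorAlgebra.ι R (Z.flip (b i)) =
      ∑ j, Z (b j) (b i) • ExteriorAlgebra.ι R (b.coord j) := fun i => by
    conv_lhs => rw [← coord_expansion b (Z.flip (b i))]
    rw [map_sum]
    simp_rw [map_smul, LinearMap.flip_apply]
  simp_rw [h1, h2, TensorProduct.tmul_sum, TensorProduct.sum_tmul, TensorProduct.tmul_smul,
    ← TensorProduct.smul_tmul']
  exact Finset.sum_comm

/-- Ordered pairs are grouped without dividing by two, so the degree-two argument works over every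
commutative ring. -/
theorem sum_sum_eq_sum_lt {A : Type*} [AddCommMonoid A] (f : Fin n → Fin n → A)
    (hf : ∀ i, f i i = 0) :
    ∑ i, ∑ j, f i j = ∑ p : Fin n × Fin n with p.1 < p.2, (f p.1 p.2 + f p.2 p.1) := by
  have h1 : ∑ i, ∑ j, f i j = ∑ p : Fin n × Fin n, f p.1 p.2 :=
    (Fintype.sum_prod_type' f).symm
  have h2 : ∑ p : Fin n × Fin n with p.1 < p.2, f p.2 p.1 =
      ∑ p : Fin n × Fin n with p.2 < p.1, f p.1 p.2 := by
    refine Finset.sum_nbij' Prod.swap Prod.swap ?_ ?_ ?_ ?_ ?_ <;> simp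
  have h3 : ∑ p : Fin n × Fin n with ¬ p.1 < p.2, f p.1 p.2 =
      ∑ p : Fin n × Fin n with p.2 < p.1, f p.1 p.2 := by
    symm
    refine Finset.sum_subset ?_ ?_
    · intro p hp
      simp only [Finset.mem_filter_univ] at hp ⊢
      exact hp.not_gt
    · intro p hp hp'
      simp only [Finset.mem_filter_univ] at hp hp'
      have : p.1 = p.2 := le_antisymm (not_lt.1 hp') (not_lt.1 hp)
      rw [this, hf]
  rw [h1, Finset.sum_add_distrib, h2, ← h3, Finset.sum_filter_add_sum_filter_not]

theorem extPow_two_induction {M : Type*} [AddCommGroup M] [Module R M]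
    {P : ExteriorAlgebra R M → Prop}
    (hadd : ∀ x y, P x → P y → P (x + y))
    (hmul : ∀ x y, P (ExteriorAlgebra.ι R x * ExteriorAlgebra.ι R y))
    {c : ExteriorAlgebra R M} (hc : c ∈ extPow R M 2) : P c := by
  have hc : c ∈ ⋀[R]^2 M := hc
  rw [ExteriorAlgebra.exteriorPower, pow_two] at hc
  refine Submodule.mul_induction_on hc ?_ hadd
  rintro _ ⟨x, rfl⟩ _ ⟨y, rfl⟩
  exact hmul x y

theorem ι_mul_ι_expansion (b : Module.Basis (Fin n) R F) (x y : F) :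
    ∑ p : Fin n × Fin n with p.1 < p.2,
      (b.coord p.1 x * b.coord p.2 y - b.coord p.2 x * b.coord p.1 y) •
        (ExteriorAlgebra.ι R (b p.1) * ExteriorAlgebra.ι R (b p.2)) =
      ExteriorAlgebra.ι R x * ExteriorAlgebra.ι R y := by
  have h : ExteriorAlgebra.ι R x * ExteriorAlgebra.ι R y = ∑ i, ∑ j,
      (b.coord i x * b.coord j y) •
        (ExteriorAlgebra.ι R (b i) * ExteriorAlgebra.ι R (b j)) := by
    conv_lhs => rw [← basis_expansion b x, ← basis_expansion b y]
    simp_rw [map_sum, map_smul, Finset.sum_mul, Finset.mul_sum, smul_mul_smul_comm]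
  rw [h, sum_sum_eq_sum_lt]
  · refine Finset.sum_congr rfl fun p _ => ?_
    have := eq_neg_of_add_eq_zero_left (ExteriorAlgebra.ι_add_mul_swap (R := R) (b p.2) (b p.1))
    rw [this, smul_neg, sub_smul, sub_eq_add_neg]
  · intro i
    rw [ExteriorAlgebra.ι_sq_zero, smul_zero]

theorem extPow_one_expansion_actD (b : Module.Basis (Fin n) R F) (c : Ex R F)
    (hc : c ∈ extPow R F 1) :
    ∑ i, aug R F (actD (ExteriorAlgebra.ι R (b.coord i)) c) • ExteriorAlgebra.ι R (b i) = c := by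
  have hc : c ∈ ⋀[R]^1 F := hc
  rw [ExteriorAlgebra.exteriorPower, pow_one] at hc
  obtain ⟨m, rfl⟩ := hc
  simp_rw [actD, contr_ι_ι, aug_algebraMap, LinearMap.id_apply, ← map_smul]
  rw [← map_sum, basis_expansion]

theorem extPow_one_expansion_actF (b : Module.Basis (Fin n) R F) (c : Ex R F)
    (hc : c ∈ extPow R F 1) :
    ∑ i, aug R (Module.Dual R F) (actF c (ExteriorAlgebra.ι R (b.coord i))) •
      ExteriorAlgebra.ι R (b i) = c := by
  have hc : c ∈ ⋀[R]^1 F := hc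
  rw [ExteriorAlgebra.exteriorPower, pow_one] at hc
  obtain ⟨m, rfl⟩ := hc
  simp_rw [actF, contr_ι_ι, aug_algebraMap, Module.Dual.eval_apply, ← map_smul]
  rw [← map_sum, basis_expansion]

/-- The dual of `b i ∧ b j` for `i < j` is the product of coordinates in reversed order. The rule
`(α ∧ β)(a) = α(β(a))` makes the right factor act first, so this order pairs to `+1`. -/
theorem extPow_two_expansion_actD (b : Module.Basis (Fin n) R F) (c : Ex R F)
    (hc : c ∈ extPow R F 2) :
    ∑ p : Fin n × Fin n with p.1 < p.2, aug R F (actD (ExteriorAlgebra.ι R (b.coord p.2) *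
      ExteriorAlgebra.ι R (b.coord p.1)) c) •
        (ExteriorAlgebra.ι R (b p.1) * ExteriorAlgebra.ι R (b p.2)) = c := by
  refine extPow_two_induction (P := fun c => ∑ p : Fin n × Fin n with p.1 < p.2, aug R F
    (actD (ExteriorAlgebra.ι R (b.coord p.2) * ExteriorAlgebra.ι R (b.coord p.1)) c) •
      (ExteriorAlgebra.ι R (b p.1) * ExteriorAlgebra.ι R (b p.2)) = c)
    (fun x y hx hy => ?_) (fun x y => ?_) hc
  · beta_reduce at hx hy ⊢
    conv_rhs => rw [← hx, ← hy]
    simp_rw [map_add, add_smul]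
    rw [Finset.sum_add_distrib]
  · conv_rhs => rw [← ι_mul_ι_expansion b]
    refine Finset.sum_congr rfl fun p _ => ?_
    rw [actD_mul]
    simp_rw [actD, contr_ι_ι_mul, map_sub, map_smul, contr_ι_ι, LinearMap.id_apply]
    rw [← Algebra.commutes, ← Algebra.smul_def, map_smul, contr_ι_ι]
    simp only [map_smul, aug_algebraMap, smul_eq_mul, LinearMap.id_apply]
    rw [mul_comm (b.coord p.1 y)]

theorem extPow_two_expansion_actF (b : Module.Basis (Fin n) R F) (c : Ex R F)
    (hc : c ∈ extPow R F 2) :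
    ∑ p : Fin n × Fin n with p.1 < p.2, aug R (Module.Dual R F) (actF c
      (ExteriorAlgebra.ι R (b.coord p.2) * ExteriorAlgebra.ι R (b.coord p.1))) •
        (ExteriorAlgebra.ι R (b p.1) * ExteriorAlgebra.ι R (b p.2)) = c := by
  refine extPow_two_induction (P := fun c => ∑ p : Fin n × Fin n with p.1 < p.2,
    aug R (Module.Dual R F) (actF c (ExteriorAlgebra.ι R (b.coord p.2) *
      ExteriorAlgebra.ι R (b.coord p.1))) •
      (ExteriorAlgebra.ι R (b p.1) * ExteriorAlgebra.ι R (b p.2)) = c)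
    (fun x y hx hy => ?_) (fun x y => ?_) hc
  · beta_reduce at hx hy ⊢
    conv_rhs => rw [← hx, ← hy]
    simp_rw [map_add, LinearMap.add_apply, map_add, add_smul]
    rw [Finset.sum_add_distrib]
  · conv_rhs => rw [← ι_mul_ι_expansion b]
    refine Finset.sum_congr rfl fun p _ => ?_
    rw [actF_mul]
    simp_rw [actF, contr_ι_ι_mul, map_sub, map_smul, contr_ι_ι, Module.Dual.eval_apply]
    rw [← Algebra.commutes, ← Algebra.smul_def, map_smul, contr_ι_ι]
    simp only [map_smul, aug_algebraMap, smul_eq_mul, Module.Dual.eval_apply]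
    congr 1
    ring

end Bases

/-! ### Coordinate forms of `sigma`, `gather` and `scatter`, and the quadratic relations. -/

namespace Data

variable {R : Type u} [CommRing R] {F : Type v} [AddCommGroup F] [Module R F] {n : ℕ}
  (D : Data R F n)

theorem sigma_apply (b : Module.Basis (Fin n) R F) (α : Co R F) :
    D.sigma α = ∑ i, conD b i D.eta ⊗ₜ[R]
      conF b i α := by
  have h : D.sigma = LinearMap.rTensor (Co R F) D.onEta ∘ₗ coComulOne R F := rfl
  rw [h, LinearMap.comp_apply, coComulOne_basis b, map_sum]
  rfl

theorem gather_tmul (b : Module.Basis (Fin n) R F) (Z : F →ₗ[R] Module.Dual R F) (α β : Co R F) :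
    D.gather (ExteriorAlgebra.map Z) (α ⊗ₜ[R] β) =
      ∑ i, conD b i (D.cof Z α) ⊗ₜ[R]
        conF b i β := by
  have h : D.gather (ExteriorAlgebra.map Z) (α ⊗ₜ[R] β) = LinearMap.rTensor (Co R F)
    (D.insertion (ExteriorAlgebra.map Z) α) (coComulOne R F β) := rfl
  rw [h, coComulOne_basis b, map_sum]
  refine Finset.sum_congr rfl fun i _ => ?_
  rw [LinearMap.rTensor_tmul]
  have h2 : ∀ γ, D.insertion (ExteriorAlgebra.map Z) α γ =
    D.onEta (γ * ExteriorAlgebra.map Z (D.onEta α)) := fun _ => rfl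
  rw [h2, onEta_mul, cof_apply]
  rfl

theorem scatter_tmul (b : Module.Basis (Fin n) R F) (Y : Ex R F →ₐ[R] Co R F) (a : Ex R F)
    (β : Co R F) : scatter Y (a ⊗ₜ[R] β) =
      ∑ i, Y (conD b i a) ⊗ₜ[R]
        conF b i β := by
  rw [scatter, LinearMap.comp_apply, LinearMap.comp_apply, LinearMap.rTensor_tmul,
    LinearMap.comp_apply, comulOne_basis b, map_sum, TensorProduct.sum_tmul, map_sum, map_sum]
  rfl
end Data

namespace Data

variable {R : Type u} [CommRing R] {F : Type v} [AddCommGroup F] [Module R F] {n : ℕ}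
  (D : Data R F n)

/-- The cofactor maps commute with contraction in the sense of Jacobi's identity. -/
theorem sum_map_actD_cof_tmul (b : Module.Basis (Fin n) R F) (Z : F →ₗ[R] Module.Dual R F) {t : ℤ}
    {J : Type*} (s : Finset J) (p : J → Ex R F) (q : J → Co R F)
    (hq : ∀ j, q j ∈ extPow R (Module.Dual R F) t)
    (h1 : ∀ c ∈ extPow R F t, ∑ j ∈ s, aug R F (actD (q j) c) • p j = c)
    (h2 : ∀ c ∈ extPow R F t, ∑ j ∈ s, aug R (Module.Dual R F) (actF c (q j)) • p j = c)
    (α β : Co R F) :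
    ∑ j ∈ s, ExteriorAlgebra.map Z (actD (q j) (D.cof Z.flip α)) ⊗ₜ[R] actF (p j) β =
      ∑ j ∈ s, actF (p j) α ⊗ₜ[R] ExteriorAlgebra.map Z.flip (actD (q j) (D.cof Z β)) := by
  -- Letting the two factors of the transposition identity contract `α` and `β` respectively turns
  -- it into the middle equality. Jacobi's identity, for `Z` and for its transpose, rewrites the
  -- outer terms.
  have h := congrArg (TensorProduct.map ((actF (R := R) (F := F)).toLinearMap.flip α)
    ((actF (R := R) (F := F)).toLinearMap.flip β)) (D.sum_cof_tmul b Z s p q hq h1 h2)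
  simp only [map_sum, TensorProduct.map_tmul, LinearMap.flip_apply, AlgHom.toLinearMap_apply] at h
  calc _ = ∑ j ∈ s, actF (D.cof Z (q j)) α ⊗ₜ[R] actF (p j) β :=
        Finset.sum_congr rfl fun j _ => by rw [D.map_actD_cof b Z (hq j)]
    _ = _ := h
    _ = _ := Finset.sum_congr rfl fun j _ => by
        rw [← D.map_actD_cof b Z.flip (hq j), LinearMap.flip_flip]

theorem sum_map_conD_cof_tmul (b : Module.Basis (Fin n) R F) (Z : F →ₗ[R] Module.Dual R F)
    (α β : Co R F) :
    ∑ i, ExteriorAlgebra.map Z (conD b i (D.cof Z.flip α)) ⊗ₜ[R] conF b i β =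
      ∑ i, conF b i α ⊗ₜ[R] ExteriorAlgebra.map Z.flip (conD b i (D.cof Z β)) :=
  D.sum_map_actD_cof_tmul b Z Finset.univ (fun i => ExteriorAlgebra.ι R (b i))
    (fun i => ExteriorAlgebra.ι R (b.coord i)) (fun _ => extPow_ι_mem _)
    (extPow_one_expansion_actD b) (extPow_one_expansion_actF b) α β

theorem conF_conF (b : Module.Basis (Fin n) R F) (i j : Fin n) (α : Co R F) :
    conF b i (conF b j α) = -conF b j (conF b i α) :=
  contr_ι_anticomm _ _ _ _

theorem conD_conD (b : Module.Basis (Fin n) R F) (i j : Fin n) (a : Ex R F) :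
    conD b i (conD b j a) = -conD b j (conD b i a) :=
  contr_ι_anticomm _ _ _ _

theorem sum_sum_map_conD_cof_tmul (b : Module.Basis (Fin n) R F) (Z : F →ₗ[R] Module.Dual R F)
    (α β : Co R F) :
    ∑ i, ∑ j, ExteriorAlgebra.map Z (conD b j (conD b i (D.cof Z.flip α))) ⊗ₜ[R]
        conF b j (conF b i β) =
      ∑ i, ∑ j, conF b j (conF b i α) ⊗ₜ[R]
        ExteriorAlgebra.map Z.flip (conD b j (conD b i (D.cof Z β))) := by
  have h := D.sum_map_actD_cof_tmul b Z (Finset.univ.filter fun p : Fin n × Fin n => p.1 < p.2)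
    (fun p => ExteriorAlgebra.ι R (b p.1) * ExteriorAlgebra.ι R (b p.2))
    (fun p => ExteriorAlgebra.ι R (b.coord p.2) * ExteriorAlgebra.ι R (b.coord p.1))
    (fun p => extPow_mul_mem (extPow_ι_mem _) (extPow_ι_mem _))
    (extPow_two_expansion_actD b) (extPow_two_expansion_actF b) α β
  simp only [actD_mul, actF_mul] at h
  rw [sum_sum_eq_sum_lt, sum_sum_eq_sum_lt]
  -- The terms for `(i, j)` and `(j, i)` agree since contractions anticommute in both factors. The
  -- factor is `-2` rather than `2` because the dual bases in degree two contract the two sides in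
  -- opposite orders.
  · have e1 : ∀ p : Fin n × Fin n,
        ExteriorAlgebra.map Z (conD b p.2 (conD b p.1 (D.cof Z.flip α))) ⊗ₜ[R]
          conF b p.2 (conF b p.1 β) +
        ExteriorAlgebra.map Z (conD b p.1 (conD b p.2 (D.cof Z.flip α))) ⊗ₜ[R]
          conF b p.1 (conF b p.2 β) =
        (-2 : R) • (ExteriorAlgebra.map Z (conD b p.2 (conD b p.1 (D.cof Z.flip α))) ⊗ₜ[R]
          conF b p.1 (conF b p.2 β)) := fun p => by
      rw [conD_conD b p.1 p.2, conF_conF b p.2 p.1, map_neg, TensorProduct.neg_tmul,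
        TensorProduct.tmul_neg, neg_smul, two_smul, neg_add]
    have e2 : ∀ p : Fin n × Fin n,
        conF b p.2 (conF b p.1 α) ⊗ₜ[R]
          ExteriorAlgebra.map Z.flip (conD b p.2 (conD b p.1 (D.cof Z β))) +
        conF b p.1 (conF b p.2 α) ⊗ₜ[R]
          ExteriorAlgebra.map Z.flip (conD b p.1 (conD b p.2 (D.cof Z β))) =
        (-2 : R) • (conF b p.1 (conF b p.2 α) ⊗ₜ[R]
          ExteriorAlgebra.map Z.flip (conD b p.2 (conD b p.1 (D.cof Z β)))) := fun p => by
      rw [conD_conD b p.1 p.2, conF_conF b p.2 p.1, map_neg, TensorProduct.neg_tmul,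
        TensorProduct.tmul_neg, neg_smul, two_smul, neg_add]
    simp_rw [e1, e2, ← Finset.smul_sum]
    exact congrArg _ h
  · intro i
    have : conF b i (conF b i α) = 0 := contr_ι_sq _ _ _
    rw [this, TensorProduct.zero_tmul]
  · intro i
    have : conF b i (conF b i β) = 0 := contr_ι_sq _ _ _
    rw [this, TensorProduct.tmul_zero]

/-! ### Relations between the operators making up the differential -/

section Operators

variable (b : Module.Basis (Fin n) R F) (Z : F →ₗ[R] Module.Dual R F) (w : F)

include b

/-- The transposition identity in degree one. It makes the routes from 𝔽(1) to itself through 𝔽(2)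
and through 𝔽(3) cancel; `scatter_cof` does the same for 𝔽(4). -/
theorem map_gather (z : Co R F ⊗[R] Co R F) :
    LinearMap.rTensor (Co R F) (ExteriorAlgebra.map Z).toLinearMap
        (D.gather (ExteriorAlgebra.map Z.flip) z) =
      swap (LinearMap.rTensor (Co R F) (ExteriorAlgebra.map Z.flip).toLinearMap
        (D.gather (ExteriorAlgebra.map Z) (swap z))) := by
  induction z with
  | zero => simp only [map_zero]
  | add x y hx hy => simp only [map_add, hx, hy]
  | tmul α β =>
    have h1 : swap (α ⊗ₜ[R] β) = β ⊗ₜ[R] α := rfl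
    rw [h1, D.gather_tmul b, D.gather_tmul b, map_sum, map_sum, map_sum]
    exact D.sum_map_conD_cof_tmul b Z α β

theorem scatter_cof (z : Co R F ⊗[R] Co R F) :
    scatter (ExteriorAlgebra.map Z) (LinearMap.rTensor (Co R F) (D.cof Z.flip) z) =
      swap (scatter (ExteriorAlgebra.map Z.flip)
        (LinearMap.rTensor (Co R F) (D.cof Z) (swap z))) := by
  induction z with
  | zero => simp only [map_zero]
  | add x y hx hy => simp only [map_add, hx, hy]
  | tmul α β =>
    have h1 : swap (α ⊗ₜ[R] β) = β ⊗ₜ[R] α := rfl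
    rw [h1, LinearMap.rTensor_tmul, LinearMap.rTensor_tmul, scatter_tmul b, scatter_tmul b,
      map_sum]
    exact D.sum_map_conD_cof_tmul b Z α β

/-- Each of `gather` and `scatter` contracts both factors once, so comparing the routes from 𝔽(1) to
𝔽(4) needs the transposition identity in degree two. -/
theorem scatter_gather (z : Co R F ⊗[R] Co R F) :
    scatter (ExteriorAlgebra.map Z) (D.gather (ExteriorAlgebra.map Z.flip) z) =
      swap (scatter (ExteriorAlgebra.map Z.flip) (D.gather (ExteriorAlgebra.map Z) (swap z))) := by
  induction z with
  | zero => simp only [map_zero]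
  | add x y hx hy => simp only [map_add, hx, hy]
  | tmul α β =>
    have h1 : swap (α ⊗ₜ[R] β) = β ⊗ₜ[R] α := rfl
    rw [h1, D.gather_tmul b, D.gather_tmul b, map_sum, map_sum, map_sum]
    simp_rw [scatter_tmul b, map_sum]
    exact D.sum_sum_map_conD_cof_tmul b Z α β

/-- Both routes from 𝔽(4) to 𝔽(1) multiply by the determinant, which `coDet_flip` shows to be the
same for `Z` and its transpose. -/
theorem map_cof_rTensor (z : Co R F ⊗[R] Co R F) :
    LinearMap.rTensor (Co R F) (ExteriorAlgebra.map Z).toLinearMap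
        (LinearMap.rTensor (Co R F) (D.cof Z.flip) z) =
      swap (LinearMap.rTensor (Co R F) (ExteriorAlgebra.map Z.flip).toLinearMap
        (LinearMap.rTensor (Co R F) (D.cof Z) (swap z))) := by
  induction z with
  | zero => simp only [map_zero]
  | add x y hx hy => simp only [map_add, hx, hy]
  | tmul α β =>
    have h1 : ∀ α β : Co R F, swap (α ⊗ₜ[R] β) = β ⊗ₜ[R] α := fun _ _ => rfl
    have h2 := D.map_cof b Z.flip β
    rw [LinearMap.flip_flip, D.coDet_flip b] at h2
    simp only [h1, LinearMap.rTensor_tmul, AlgHom.toLinearMap_apply, D.map_cof b Z α, h2]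
    rw [TensorProduct.smul_tmul]

/-- Both composites equal the determinant times a sum of contractions of both factors. This cancels
the routes from 𝔽(2), or 𝔽(3), to itself through 𝔽(1) and through 𝔽(4). -/
theorem gather_map (z : Ex R F ⊗[R] Co R F) :
    D.gather (ExteriorAlgebra.map Z)
        (LinearMap.rTensor (Co R F) (ExteriorAlgebra.map Z.flip).toLinearMap z) =
      LinearMap.rTensor (Co R F) (D.cof Z) (scatter (ExteriorAlgebra.map Z.flip) z) := by
  induction z with
  | zero => simp only [map_zero]
  | add x y hx hy => simp only [map_add, hx, hy]
  | tmul a β =>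
    rw [LinearMap.rTensor_tmul, AlgHom.toLinearMap_apply, D.gather_tmul b, scatter_tmul b,
      map_sum]
    refine Finset.sum_congr rfl fun i _ => ?_
    rw [LinearMap.rTensor_tmul, D.cof_map b, D.cof_map b, map_smul]

/-- Contraction is moved inside `⋀Z` on one side and out of `cof Z` on the other. What remains is
the symmetry `sum_flip_tmul`. It handles the routes between 𝔽(2) and 𝔽(3). -/
theorem gather_swap_map (z : Ex R F ⊗[R] Co R F) :
    D.gather (ExteriorAlgebra.map Z)
        (swap (LinearMap.rTensor (Co R F) (ExteriorAlgebra.map Z).toLinearMap z)) =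
      LinearMap.rTensor (Co R F) (D.cof Z) (swap (scatter (ExteriorAlgebra.map Z) z)) := by
  induction z with
  | zero => simp only [map_zero]
  | add x y hx hy => simp only [map_add, hx, hy]
  | tmul a β =>
    have h1 : ∀ α β : Co R F, swap (α ⊗ₜ[R] β) = β ⊗ₜ[R] α := fun _ _ => rfl
    rw [LinearMap.rTensor_tmul, AlgHom.toLinearMap_apply, h1, D.gather_tmul b, scatter_tmul b,
      map_sum, map_sum]
    simp_rw [h1, LinearMap.rTensor_tmul]
    have h2 := congrArg (TensorProduct.map
      ((actD (R := R) (F := F)).toLinearMap.flip (D.cof Z β))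
      ((ExteriorAlgebra.map Z).toLinearMap ∘ₗ (actD (R := R) (F := F)).toLinearMap.flip a))
      (sum_flip_tmul b Z)
    simp only [map_sum, TensorProduct.map_tmul, LinearMap.flip_apply, AlgHom.toLinearMap_apply,
      LinearMap.comp_apply] at h2
    refine Eq.trans (Finset.sum_congr rfl fun i _ => ?_)
      (h2.trans (Finset.sum_congr rfl fun i _ => ?_))
    · rw [← actF_map]; rfl
    · rw [← D.cof_actF b]; rfl

theorem gather_lTensor (Y : Co R F ⊗[R] Co R F) :
    D.gather (ExteriorAlgebra.map Z)
        (LinearMap.lTensor (Co R F) (actF (ExteriorAlgebra.ι R w)) Y) =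
      -LinearMap.lTensor (Ex R F) (actF (ExteriorAlgebra.ι R w))
        (D.gather (ExteriorAlgebra.map Z) Y) := by
  induction Y with
  | zero => simp only [map_zero, neg_zero]
  | add x y hx hy => simp only [map_add, hx, hy, neg_add]
  | tmul α β =>
    rw [LinearMap.lTensor_tmul, D.gather_tmul b, D.gather_tmul b, map_sum, ← Finset.sum_neg_distrib]
    refine Finset.sum_congr rfl fun i _ => ?_
    rw [LinearMap.lTensor_tmul, ← TensorProduct.tmul_neg]
    congr 1
    exact contr_ι_anticomm _ _ _ _

theorem gather_rTensor (Y : Co R F ⊗[R] Co R F) :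
    D.gather (ExteriorAlgebra.map Z)
        (LinearMap.rTensor (Co R F) (actF (ExteriorAlgebra.ι R w)) Y) =
      -LinearMap.rTensor (Co R F) (actD (ExteriorAlgebra.ι R (Z w)))
        (D.gather (ExteriorAlgebra.map Z) Y) := by
  induction Y with
  | zero => simp only [map_zero, neg_zero]
  | add x y hx hy => simp only [map_add, hx, hy, neg_add]
  | tmul α β =>
    rw [LinearMap.rTensor_tmul, D.gather_tmul b, D.gather_tmul b, map_sum, ← Finset.sum_neg_distrib]
    refine Finset.sum_congr rfl fun i _ => ?_
    rw [LinearMap.rTensor_tmul, ← TensorProduct.neg_tmul, D.cof_actF b]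
    congr 1
    exact contr_ι_anticomm _ _ _ _

theorem scatter_lTensor (Y : Ex R F ⊗[R] Co R F) :
    scatter (ExteriorAlgebra.map Z)
        (LinearMap.lTensor (Ex R F) (actF (ExteriorAlgebra.ι R w)) Y) =
      -LinearMap.lTensor (Co R F) (actF (ExteriorAlgebra.ι R w))
        (scatter (ExteriorAlgebra.map Z) Y) := by
  induction Y with
  | zero => simp only [map_zero, neg_zero]
  | add x y hx hy => simp only [map_add, hx, hy, neg_add]
  | tmul α β =>
    rw [LinearMap.lTensor_tmul, scatter_tmul b, scatter_tmul b, map_sum, ← Finset.sum_neg_distrib]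
    refine Finset.sum_congr rfl fun i _ => ?_
    rw [LinearMap.lTensor_tmul, ← TensorProduct.tmul_neg]
    congr 1
    exact contr_ι_anticomm _ _ _ _

theorem scatter_rTensor (Y : Ex R F ⊗[R] Co R F) :
    scatter (ExteriorAlgebra.map Z)
        (LinearMap.rTensor (Co R F) (actD (ExteriorAlgebra.ι R (Z.flip w))) Y) =
      -LinearMap.rTensor (Co R F) (actF (ExteriorAlgebra.ι R w))
        (scatter (ExteriorAlgebra.map Z) Y) := by
  induction Y with
  | zero => simp only [map_zero, neg_zero]
  | add x y hx hy => simp only [map_add, hx, hy, neg_add]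
  | tmul α β =>
    rw [LinearMap.rTensor_tmul, scatter_tmul b, scatter_tmul b, map_sum, ← Finset.sum_neg_distrib]
    refine Finset.sum_congr rfl fun i _ => ?_
    rw [LinearMap.rTensor_tmul, ← TensorProduct.neg_tmul, actF_map, ← map_neg]
    congr 2
    exact contr_ι_anticomm _ _ _ _

end Operators

end Data

/-! ### The differential in operator form, and its square. -/

namespace Data

variable {R : Type u} [CommRing R] {F : Type v} [AddCommGroup F] [Module R F] {n : ℕ}
  (D : Data R F n)

/-- Contraction of the left factor of `⋀F* ⊗ ⋀F*`. -/
def contL (w : F) : Co R F ⊗[R] Co R F →ₗ[R] Co R F ⊗[R] Co R F :=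
  LinearMap.rTensor (Co R F) (actF (ExteriorAlgebra.ι R w))

/-- Contraction of the right factor of `⋀F* ⊗ ⋀F*`. -/
def contR (w : F) : Co R F ⊗[R] Co R F →ₗ[R] Co R F ⊗[R] Co R F :=
  LinearMap.lTensor (Co R F) (actF (ExteriorAlgebra.ι R w))

/-- Contraction of the left factor of `⋀F ⊗ ⋀F*`. -/
def conEL (w : Module.Dual R F) : Ex R F ⊗[R] Co R F →ₗ[R] Ex R F ⊗[R] Co R F :=
  LinearMap.rTensor (Co R F) (actD (ExteriorAlgebra.ι R w))

/-- Contraction of the right factor of `⋀F ⊗ ⋀F*`. -/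
def conER (w : F) : Ex R F ⊗[R] Co R F →ₗ[R] Ex R F ⊗[R] Co R F :=
  LinearMap.lTensor (Ex R F) (actF (ExteriorAlgebra.ι R w))

/-- `⋀Z` on the left factor. -/
def mapL (Z : F →ₗ[R] Module.Dual R F) : Ex R F ⊗[R] Co R F →ₗ[R] Co R F ⊗[R] Co R F :=
  LinearMap.rTensor (Co R F) (ExteriorAlgebra.map Z).toLinearMap

/-- `cof Z` on the left factor. -/
def cofL (Z : F →ₗ[R] Module.Dual R F) : Co R F ⊗[R] Co R F →ₗ[R] Ex R F ⊗[R] Co R F :=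
  LinearMap.rTensor (Co R F) (D.cof Z)

/-- `gather` for the map induced by `Z`. -/
def gat (Z : F →ₗ[R] Module.Dual R F) : Co R F ⊗[R] Co R F →ₗ[R] Ex R F ⊗[R] Co R F :=
  D.gather (ExteriorAlgebra.map Z)

/-- `scatter` for the map induced by `Z`. -/
def sca (Z : F →ₗ[R] Module.Dual R F) : Ex R F ⊗[R] Co R F →ₗ[R] Co R F ⊗[R] Co R F :=
  scatter (ExteriorAlgebra.map Z)

theorem swap_swap (z : Co R F ⊗[R] Co R F) : swap (swap z) = z :=
  (TensorProduct.comm R (Co R F) (Co R F)).symm_apply_apply z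

theorem swap_contL (w : F) (z : Co R F ⊗[R] Co R F) : swap (contL w z) = contR w (swap z) := by
  induction z with
  | zero => simp only [map_zero]
  | add x y hx hy => simp only [map_add, hx, hy]
  | tmul α β => rfl

theorem swap_contR (w : F) (z : Co R F ⊗[R] Co R F) : swap (contR w z) = contL w (swap z) := by
  induction z with
  | zero => simp only [map_zero]
  | add x y hx hy => simp only [map_add, hx, hy]
  | tmul α β => rfl

theorem contL_contR (w w' : F) (z : Co R F ⊗[R] Co R F) :
    contL w (contR w' z) = contR w' (contL w z) := by
  induction z with
  | zero => simp only [map_zero]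
  | add x y hx hy => simp only [map_add, hx, hy]
  | tmul α β => rfl

theorem contL_contL (w : F) (z : Co R F ⊗[R] Co R F) : contL w (contL w z) = 0 := by
  induction z with
  | zero => simp only [map_zero]
  | add x y hx hy => simp only [map_add, hx, hy, add_zero]
  | tmul α β =>
    rw [contL, LinearMap.rTensor_tmul, LinearMap.rTensor_tmul, actF, contr_ι_sq,
      TensorProduct.zero_tmul]

theorem contR_contR (w : F) (z : Co R F ⊗[R] Co R F) : contR w (contR w z) = 0 := by
  induction z with
  | zero => simp only [map_zero]
  | add x y hx hy => simp only [map_add, hx, hy, add_zero]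
  | tmul α β =>
    rw [contR, LinearMap.lTensor_tmul, LinearMap.lTensor_tmul, actF, contr_ι_sq,
      TensorProduct.tmul_zero]

theorem conEL_conER (w : Module.Dual R F) (w' : F) (z : Ex R F ⊗[R] Co R F) :
    conEL w (conER w' z) = conER w' (conEL w z) := by
  induction z with
  | zero => simp only [map_zero]
  | add x y hx hy => simp only [map_add, hx, hy]
  | tmul α β => rfl

theorem conEL_conEL (w : Module.Dual R F) (z : Ex R F ⊗[R] Co R F) : conEL w (conEL w z) = 0 := by
  induction z with
  | zero => simp only [map_zero]
  | add x y hx hy => simp only [map_add, hx, hy, add_zero]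
  | tmul α β =>
    rw [conEL, LinearMap.rTensor_tmul, LinearMap.rTensor_tmul, actD, contr_ι_sq,
      TensorProduct.zero_tmul]

theorem conER_conER (w : F) (z : Ex R F ⊗[R] Co R F) : conER w (conER w z) = 0 := by
  induction z with
  | zero => simp only [map_zero]
  | add x y hx hy => simp only [map_add, hx, hy, add_zero]
  | tmul α β =>
    rw [conER, LinearMap.lTensor_tmul, LinearMap.lTensor_tmul, actF, contr_ι_sq,
      TensorProduct.tmul_zero]

theorem contR_mapL (Z : F →ₗ[R] Module.Dual R F) (w : F) (z : Ex R F ⊗[R] Co R F) :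
    contR w (mapL Z z) = mapL Z (conER w z) := by
  induction z with
  | zero => simp only [map_zero]
  | add x y hx hy => simp only [map_add, hx, hy]
  | tmul α β => rfl

theorem contL_mapL (Z : F →ₗ[R] Module.Dual R F) (w : F) (z : Ex R F ⊗[R] Co R F) :
    contL w (mapL Z z) = mapL Z (conEL (Z.flip w) z) := by
  induction z with
  | zero => simp only [map_zero]
  | add x y hx hy => simp only [map_add, hx, hy]
  | tmul α β =>
    rw [contL, mapL, conEL, LinearMap.rTensor_tmul, LinearMap.rTensor_tmul, LinearMap.rTensor_tmul,
      LinearMap.rTensor_tmul, AlgHom.toLinearMap_apply, AlgHom.toLinearMap_apply, actF_map]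

theorem conER_cofL (Z : F →ₗ[R] Module.Dual R F) (w : F) (z : Co R F ⊗[R] Co R F) :
    conER w (D.cofL Z z) = D.cofL Z (contR w z) := by
  induction z with
  | zero => simp only [map_zero]
  | add x y hx hy => simp only [map_add, hx, hy]
  | tmul α β => rfl

theorem conEL_cofL (b : Module.Basis (Fin n) R F) (Z : F →ₗ[R] Module.Dual R F) (w : F)
    (z : Co R F ⊗[R] Co R F) :
    conEL (Z w) (D.cofL Z z) = D.cofL Z (contL w z) := by
  induction z with
  | zero => simp only [map_zero]
  | add x y hx hy => simp only [map_add, hx, hy]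
  | tmul α β =>
    rw [contL, cofL, conEL, LinearMap.rTensor_tmul, LinearMap.rTensor_tmul, LinearMap.rTensor_tmul,
      LinearMap.rTensor_tmul, D.cof_actF b]

/-! ### The components of the differential -/

theorem pr1_f (r : ℤ) (z : Tot R F) : pr1 R F (D.f r z) =
    contR D.v (pr1 R F z) + r.negOnePow • contL D.u (pr1 R F z)
      + r.negOnePow • mapL D.X (pr2 R F z) - r.negOnePow • swap (mapL D.X.flip (pr3 R F z)) := by
  have h : pr1 R F (D.f r z) =
    contR D.v (pr1 R F z) + r.negOnePow • contL D.u (pr1 R F z) + 0 + 0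
      + (r.negOnePow • mapL D.X (pr2 R F z) + 0 + 0)
      + ((r + 1).negOnePow • swap (mapL D.X.flip (pr3 R F z)) + 0 - 0) + (0 + 0 + 0) := rfl
  rw [h, Int.negOnePow_succ, Units.neg_smul]
  abel

theorem pr2_f (r : ℤ) (z : Tot R F) : pr2 R F (D.f r z) =
    D.gat D.X.flip (pr1 R F z) + conER D.v (pr2 R F z)
      - r.negOnePow • conEL (D.X.flip D.u) (pr2 R F z)
      + r.negOnePow • D.cofL D.X.flip (pr4 R F z) := by
  have h : pr2 R F (D.f r z) =
    0 + D.gat D.X.flip (pr1 R F z) + 0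
      + (0 + (conER D.v (pr2 R F z) + (r + 1).negOnePow • conEL (D.X.flip D.u) (pr2 R F z)) + 0)
      + (0 + 0 - 0) + (r.negOnePow • D.cofL D.X.flip (pr4 R F z) + 0 + 0) := rfl
  rw [h, Int.negOnePow_succ, Units.neg_smul]
  abel

theorem pr3_f (r : ℤ) (z : Tot R F) : pr3 R F (D.f r z) =
    D.gat D.X (swap (pr1 R F z)) - r.negOnePow • conER D.u (pr3 R F z)
      + conEL (D.X D.v) (pr3 R F z)
      + r.negOnePow • D.cofL D.X (swap (pr4 R F z)) := by
  have h : pr3 R F (D.f r z) =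
    0 + 0 + D.gat D.X (swap (pr1 R F z)) + (0 + 0 + 0)
      + (0 + ((r + 1).negOnePow • conER D.u (pr3 R F z) + conEL (D.X D.v) (pr3 R F z)) - 0)
      + (0 + r.negOnePow • D.cofL D.X (swap (pr4 R F z)) + 0) := rfl
  rw [h, Int.negOnePow_succ, Units.neg_smul]
  abel

theorem pr4_f (r : ℤ) (z : Tot R F) : pr4 R F (D.f r z) =
    sca D.X (pr2 R F z) - swap (sca D.X.flip (pr3 R F z))
      + contR D.v (pr4 R F z) + r.negOnePow • contL D.u (pr4 R F z) := by
  have h : pr4 R F (D.f r z) =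
    0 + 0 + 0 + (0 + 0 + sca D.X (pr2 R F z)) + (0 + 0 - swap (sca D.X.flip (pr3 R F z)))
      + (0 + 0 + (contR D.v (pr4 R F z) + r.negOnePow • contL D.u (pr4 R F z))) := rfl
  rw [h]
  abel

theorem tot_ext {z z' : Tot R F} (h1 : pr1 R F z = pr1 R F z') (h2 : pr2 R F z = pr2 R F z')
    (h3 : pr3 R F z = pr3 R F z') (h4 : pr4 R F z = pr4 R F z') : z = z' :=
  Prod.ext h1 (Prod.ext h2 (Prod.ext h3 h4))

theorem f_f (b : Module.Basis (Fin n) R F) (r : ℤ) (z : Tot R F) : D.f (r - 1) (D.f r z) = 0 := by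
  have hs : (r - 1).negOnePow = -r.negOnePow := by
    rw [Int.negOnePow_sub, Int.negOnePow_one, mul_neg, mul_one]
  have e1 : ∀ z, mapL D.X (D.gat D.X.flip z) = swap (mapL D.X.flip (D.gat D.X (swap z))) :=
    D.map_gather b D.X
  have e2 : ∀ z, sca D.X (D.cofL D.X.flip z) = swap (sca D.X.flip (D.cofL D.X (swap z))) :=
    D.scatter_cof b D.X
  have e3 : ∀ z, sca D.X (D.gat D.X.flip z) = swap (sca D.X.flip (D.gat D.X (swap z))) :=
    D.scatter_gather b D.X
  have e4 : ∀ z, mapL D.X (D.cofL D.X.flip z) = swap (mapL D.X.flip (D.cofL D.X (swap z))) :=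
    D.map_cof_rTensor b D.X
  have e5 : ∀ z, D.gat D.X (mapL D.X.flip z) = D.cofL D.X (sca D.X.flip z) := D.gather_map b D.X
  have e6 : ∀ z, D.gat D.X.flip (mapL D.X z) = D.cofL D.X.flip (sca D.X z) :=
    D.gather_map b D.X.flip
  have e7 : ∀ z, D.gat D.X (swap (mapL D.X z)) = D.cofL D.X (swap (sca D.X z)) :=
    D.gather_swap_map b D.X
  have e8 : ∀ z, D.gat D.X.flip (swap (mapL D.X.flip z)) =
      D.cofL D.X.flip (swap (sca D.X.flip z)) := D.gather_swap_map b D.X.flip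
  have e9 : ∀ Z w z, D.gat Z (contR w z) = -conER w (D.gat Z z) :=
    fun Z w z => D.gather_lTensor b Z w z
  have e10 : ∀ Z w z, D.gat Z (contL w z) = -conEL (Z w) (D.gat Z z) :=
    fun Z w z => D.gather_rTensor b Z w z
  have e11 : ∀ Z w z, sca Z (conER w z) = -contR w (sca Z z) :=
    fun Z w z => scatter_lTensor b Z w z
  have e12 : ∀ Z w z, sca Z (conEL (Z.flip w) z) = -contL w (sca Z z) :=
    fun Z w z => scatter_rTensor b Z w z
  -- The previous relation for the transpose of `X`, with the double transpose written as `X`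
  -- itself.
  have e13 : ∀ z, sca D.X.flip (conEL (D.X D.v) z) = -contL D.v (sca D.X.flip z) :=
    e12 D.X.flip D.v
  have e14 : ∀ z, contR D.v (swap (mapL D.X.flip z)) =
      swap (mapL D.X.flip (conEL (D.X D.v) z)) := fun z => by
    rw [← swap_contL]
    exact congrArg swap (contL_mapL D.X.flip D.v z)
  have e16 : ∀ z, contL D.u (swap (mapL D.X.flip z)) =
      swap (mapL D.X.flip (conER D.u z)) := fun z => by
    rw [← swap_contR, contR_mapL]
  have e15 := D.conEL_cofL b
  -- Only the parity of `r` matters, and the sign at `r - 1` is the opposite one. In each of the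
  -- four components the relations bring all terms to a normal form in which they cancel in pairs.
  obtain h | h := Int.units_eq_one_or r.negOnePow <;>
  refine tot_ext ?_ ?_ ?_ ?_ <;>
  rw [map_zero] <;>
  simp only [pr1_f, pr2_f, pr3_f, pr4_f, hs, h, one_smul, Units.neg_smul, neg_neg, map_add, map_sub,
    map_neg, swap_swap, swap_contL, swap_contR, contL_contR, contL_contL, contR_contR, conEL_conER,
    conEL_conEL, conER_conER, contR_mapL, contL_mapL, e1, e2, e3, e4, e5, e6, e7, e8, e9, e10, e11,
    e12, e13, e14, conER_cofL, e15, e16] <;>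
  abel

end Data

/-! ### Homogeneous tensors, and the degree of the differential. -/

section Tens

variable {R : Type u} [CommRing R] {P Q : Type*} [AddCommGroup P] [AddCommGroup Q] [Module R P]
  [Module R Q]

theorem tmul_mem_tens {P' : Submodule R P} {Q' : Submodule R Q} {p : P} {q : Q} (hp : p ∈ P')
    (hq : q ∈ Q') : p ⊗ₜ[R] q ∈ tens P' Q' :=
  ⟨(⟨p, hp⟩ : P') ⊗ₜ[R] (⟨q, hq⟩ : Q'), rfl⟩

theorem tens_le {P' : Submodule R P} {Q' : Submodule R Q} {T : Submodule R (P ⊗[R] Q)}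
    (h : ∀ p ∈ P', ∀ q ∈ Q', p ⊗ₜ[R] q ∈ T) : tens P' Q' ≤ T := by
  rintro _ ⟨z, rfl⟩
  induction z with
  | zero => rw [map_zero]; exact zero_mem _
  | add x y hx hy => rw [map_add]; exact add_mem hx hy
  | tmul p q => exact h p p.2 q q.2

end Tens

section Degrees

variable {R : Type u} [CommRing R] {F : Type v} [AddCommGroup F] [Module R F] {n : ℕ}

variable (R F) in
/-- The part of `⋀F* ⊗ ⋀F*` of total degree `m`. -/
def totCC (m : ℤ) : Submodule R (Co R F ⊗[R] Co R F) := ⨆ t, cc R F t (m - t)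

variable (R F) in
/-- The part of `⋀F ⊗ ⋀F*` of total degree `m`. -/
def totEC (m : ℤ) : Submodule R (Ex R F ⊗[R] Co R F) := ⨆ t, ec R F t (m - t)

theorem tmul_mem_totCC {s t m : ℤ} {α β : Co R F} (hα : α ∈ extPow R (Module.Dual R F) s)
    (hβ : β ∈ extPow R (Module.Dual R F) t) (h : s + t = m) : α ⊗ₜ[R] β ∈ totCC R F m := by
  obtain rfl : t = m - s := by omega
  exact Submodule.mem_iSup_of_mem s (tmul_mem_tens hα hβ)

theorem tmul_mem_totEC {s t m : ℤ} {a : Ex R F} {β : Co R F} (ha : a ∈ extPow R F s)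
    (hβ : β ∈ extPow R (Module.Dual R F) t) (h : s + t = m) : a ⊗ₜ[R] β ∈ totEC R F m := by
  obtain rfl : t = m - s := by omega
  exact Submodule.mem_iSup_of_mem s (tmul_mem_tens ha hβ)

theorem totCC_le {m : ℤ} {T : Submodule R (Co R F ⊗[R] Co R F)}
    (h : ∀ s t, s + t = m → ∀ α ∈ extPow R (Module.Dual R F) s,
      ∀ β ∈ extPow R (Module.Dual R F) t, α ⊗ₜ[R] β ∈ T) : totCC R F m ≤ T :=
  iSup_le fun s => tens_le (h s (m - s) (by omega))

theorem totEC_le {m : ℤ} {T : Submodule R (Ex R F ⊗[R] Co R F)}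
    (h : ∀ s t, s + t = m → ∀ a ∈ extPow R F s,
      ∀ β ∈ extPow R (Module.Dual R F) t, a ⊗ₜ[R] β ∈ T) : totEC R F m ≤ T :=
  iSup_le fun s => tens_le (h s (m - s) (by omega))

theorem FF_eq (r : ℤ) : FF R F r = (totCC R F (r + 1)).map (in1 R F) ⊔
    (totEC R F r).map (in2 R F) ⊔ (totEC R F r).map (in3 R F) ⊔
      (totCC R F (r - 1)).map (in4 R F) := by
  simp only [FF, totCC, totEC, Submodule.map_iSup]
  rfl

theorem eq_sum_in (z : Tot R F) : z = in1 R F (pr1 R F z) + in2 R F (pr2 R F z) +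
    in3 R F (pr3 R F z) + in4 R F (pr4 R F z) := by
  have h : in1 R F (pr1 R F z) + in2 R F (pr2 R F z) + in3 R F (pr3 R F z) + in4 R F (pr4 R F z) =
    (pr1 R F z + 0 + 0 + 0, 0 + pr2 R F z + 0 + 0, 0 + 0 + pr3 R F z + 0,
      0 + 0 + 0 + pr4 R F z) := rfl
  rw [h]
  simp only [add_zero, zero_add]
  rfl

theorem mem_FF_iff {r : ℤ} {z : Tot R F} : z ∈ FF R F r ↔ pr1 R F z ∈ totCC R F (r + 1) ∧
    pr2 R F z ∈ totEC R F r ∧ pr3 R F z ∈ totEC R F r ∧ pr4 R F z ∈ totCC R F (r - 1) := by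
  rw [FF_eq]
  constructor
  · intro h
    refine (sup_le (sup_le (sup_le ?_ ?_) ?_) ?_ : _ ≤ (totCC R F (r + 1)).comap (pr1 R F) ⊓
      ((totEC R F r).comap (pr2 R F) ⊓ ((totEC R F r).comap (pr3 R F) ⊓
        (totCC R F (r - 1)).comap (pr4 R F)))) h
    · rintro _ ⟨x, hx, rfl⟩
      exact ⟨hx, (totEC R F r).zero_mem, (totEC R F r).zero_mem, (totCC R F (r - 1)).zero_mem⟩
    · rintro _ ⟨x, hx, rfl⟩
      exact ⟨(totCC R F (r + 1)).zero_mem, hx, (totEC R F r).zero_mem, (totCC R F (r - 1)).zero_mem⟩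
    · rintro _ ⟨x, hx, rfl⟩
      exact ⟨(totCC R F (r + 1)).zero_mem, (totEC R F r).zero_mem, hx, (totCC R F (r - 1)).zero_mem⟩
    · rintro _ ⟨x, hx, rfl⟩
      exact ⟨(totCC R F (r + 1)).zero_mem, (totEC R F r).zero_mem, (totEC R F r).zero_mem, hx⟩
  · rintro ⟨h1, h2, h3, h4⟩
    rw [eq_sum_in z]
    exact Submodule.add_mem_sup (Submodule.add_mem_sup (Submodule.add_mem_sup
      (Submodule.mem_map_of_mem h1) (Submodule.mem_map_of_mem h2)) (Submodule.mem_map_of_mem h3))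
      (Submodule.mem_map_of_mem h4)

/-- A submodule that contains the homogeneous elements of the four summands contains `𝔽_r`. -/
theorem FF_le {r : ℤ} {T : Submodule R (Tot R F)}
    (h1 : ∀ s t, s + t = r + 1 → (cc R F s t).map (in1 R F) ≤ T)
    (h2 : ∀ s t, s + t = r → (ec R F s t).map (in2 R F) ≤ T)
    (h3 : ∀ s t, s + t = r → (ec R F s t).map (in3 R F) ≤ T)
    (h4 : ∀ s t, s + t = r - 1 → (cc R F s t).map (in4 R F) ≤ T) : FF R F r ≤ T :=
  sup_le (sup_le (sup_le (iSup_le fun s => h1 s _ (by omega)) (iSup_le fun s => h2 s _ (by omega)))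
    (iSup_le fun s => h3 s _ (by omega))) (iSup_le fun s => h4 s _ (by omega))

namespace Data

variable (D : Data R F n)

theorem swap_mem_totCC {m : ℤ} {z : Co R F ⊗[R] Co R F} (hz : z ∈ totCC R F m) :
    swap z ∈ totCC R F m :=
  (totCC_le (T := (totCC R F m).comap swap) fun s t h α hα β hβ =>
    tmul_mem_totCC hβ hα (by omega)) hz

theorem contL_mem_totCC (w : F) {m : ℤ} {z : Co R F ⊗[R] Co R F} (hz : z ∈ totCC R F m) :
    contL w z ∈ totCC R F (m - 1) :=
  (totCC_le (T := (totCC R F (m - 1)).comap (contL w)) fun s t h α hα β hβ =>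
    tmul_mem_totCC (s := s - 1) (contr_ι_mem _ _ hα) hβ (by omega)) hz

theorem contR_mem_totCC (w : F) {m : ℤ} {z : Co R F ⊗[R] Co R F} (hz : z ∈ totCC R F m) :
    contR w z ∈ totCC R F (m - 1) :=
  (totCC_le (T := (totCC R F (m - 1)).comap (contR w)) fun s t h α hα β hβ =>
    tmul_mem_totCC (t := t - 1) hα (contr_ι_mem _ _ hβ) (by omega)) hz

theorem conEL_mem_totEC (w : Module.Dual R F) {m : ℤ} {z : Ex R F ⊗[R] Co R F}
    (hz : z ∈ totEC R F m) : conEL w z ∈ totEC R F (m - 1) :=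
  (totEC_le (T := (totEC R F (m - 1)).comap (conEL w)) fun s t h α hα β hβ =>
    tmul_mem_totEC (s := s - 1) (contr_ι_mem _ _ hα) hβ (by omega)) hz

theorem conER_mem_totEC (w : F) {m : ℤ} {z : Ex R F ⊗[R] Co R F} (hz : z ∈ totEC R F m) :
    conER w z ∈ totEC R F (m - 1) :=
  (totEC_le (T := (totEC R F (m - 1)).comap (conER w)) fun s t h α hα β hβ =>
    tmul_mem_totEC (t := t - 1) hα (contr_ι_mem _ _ hβ) (by omega)) hz

theorem mapL_mem_totCC (Z : F →ₗ[R] Module.Dual R F) {m : ℤ} {z : Ex R F ⊗[R] Co R F}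
    (hz : z ∈ totEC R F m) : mapL Z z ∈ totCC R F m :=
  (totEC_le (T := (totCC R F m).comap (mapL Z)) fun _ _ h _ hα _ hβ =>
    tmul_mem_totCC (extPow_map_mem Z hα) hβ h) hz

theorem cofL_mem_totEC (Z : F →ₗ[R] Module.Dual R F) {m : ℤ} {z : Co R F ⊗[R] Co R F}
    (hz : z ∈ totCC R F m) : D.cofL Z z ∈ totEC R F m :=
  (totCC_le (T := (totEC R F m).comap (D.cofL Z)) fun _ _ h _ hα _ hβ =>
    tmul_mem_totEC (D.cof_mem Z hα) hβ h) hz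

theorem gat_mem_totEC (b : Module.Basis (Fin n) R F) (Z : F →ₗ[R] Module.Dual R F) {m : ℤ}
    {z : Co R F ⊗[R] Co R F} (hz : z ∈ totCC R F m) : D.gat Z z ∈ totEC R F (m - 2) := by
  refine (totCC_le (T := (totEC R F (m - 2)).comap (D.gat Z)) fun s t h α hα β hβ => ?_) hz
  rw [Submodule.mem_comap, gat, D.gather_tmul b]
  exact sum_mem fun i _ => tmul_mem_totEC (s := s - 1) (t := t - 1)
    (contr_ι_mem _ _ (D.cof_mem Z hα)) (contr_ι_mem _ _ hβ) (by omega)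

theorem sca_mem_totCC (b : Module.Basis (Fin n) R F) (Z : F →ₗ[R] Module.Dual R F) {m : ℤ}
    {z : Ex R F ⊗[R] Co R F} (hz : z ∈ totEC R F m) : sca Z z ∈ totCC R F (m - 2) := by
  refine (totEC_le (T := (totCC R F (m - 2)).comap (sca Z)) fun s t h α hα β hβ => ?_) hz
  rw [Submodule.mem_comap, sca, scatter_tmul b]
  exact sum_mem fun i _ => tmul_mem_totCC (s := s - 1) (t := t - 1)
    (extPow_map_mem Z (contr_ι_mem _ _ hα)) (contr_ι_mem _ _ hβ) (by omega)

theorem negOnePow_smul_mem {V : Type*} [AddCommGroup V] [Module R V] {T : Submodule R V}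
    (r : ℤ) {x : V} (hx : x ∈ T) : r.negOnePow • x ∈ T := by
  obtain h | h := Int.units_eq_one_or r.negOnePow <;> rw [h]
  · rwa [one_smul]
  · rw [Units.neg_smul, one_smul]
    exact neg_mem hx

/-- The total degrees of the four summands are `r + 1`, `r`, `r` and `r - 1`. Contractions lower
total degree by one, `gather` and `scatter` by two, and `⋀Z` and `cof Z` preserve it. The shifts
between summands make every component of `f` drop `r` by one. -/
theorem f_mem_FF (b : Module.Basis (Fin n) R F) (r : ℤ) {z : Tot R F} (hz : z ∈ FF R F r) :
    D.f r z ∈ FF R F (r - 1) := by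
  rw [mem_FF_iff] at hz ⊢
  obtain ⟨h1, h2, h3, h4⟩ := hz
  have e1 : r + 1 - 1 = r - 1 + 1 := by omega
  have e2 : r = r - 1 + 1 := by omega
  have e3 : r + 1 - 2 = r - 1 := by omega
  have e4 : r - 2 = r - 1 - 1 := by omega
  refine ⟨?_, ?_, ?_, ?_⟩
  · rw [pr1_f]
    refine sub_mem (add_mem (add_mem ?_ ?_) ?_) ?_
    · exact e1 ▸ contR_mem_totCC D.v h1
    · exact negOnePow_smul_mem _ (e1 ▸ contL_mem_totCC D.u h1)
    · exact negOnePow_smul_mem _ (e2 ▸ mapL_mem_totCC D.X h2)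
    · exact negOnePow_smul_mem _ (e2 ▸ swap_mem_totCC (mapL_mem_totCC D.X.flip h3))
  · rw [pr2_f]
    refine add_mem (sub_mem (add_mem ?_ ?_) ?_) ?_
    · exact e3 ▸ D.gat_mem_totEC b _ h1
    · exact conER_mem_totEC _ h2
    · exact negOnePow_smul_mem _ (conEL_mem_totEC _ h2)
    · exact negOnePow_smul_mem _ (D.cofL_mem_totEC _ h4)
  · rw [pr3_f]
    refine add_mem (add_mem (sub_mem ?_ ?_) ?_) ?_
    · exact e3 ▸ D.gat_mem_totEC b _ (swap_mem_totCC h1)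
    · exact negOnePow_smul_mem _ (conER_mem_totEC _ h3)
    · exact conEL_mem_totEC _ h3
    · exact negOnePow_smul_mem _ (D.cofL_mem_totEC _ (swap_mem_totCC h4))
  · rw [pr4_f]
    refine add_mem (add_mem (sub_mem ?_ ?_) ?_) ?_
    · exact e4 ▸ sca_mem_totCC b _ h2
    · exact e4 ▸ swap_mem_totCC (sca_mem_totCC b _ h3)
    · exact contR_mem_totCC _ h4
    · exact negOnePow_smul_mem _ (contL_mem_totCC _ h4)

end Data

end Degrees

/-! ### Projections evaluated on homogeneous tensors. -/

section Projections

variable {R : Type u} [CommRing R] {F : Type v} [AddCommGroup F] [Module R F] {n : ℕ}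

theorem extProj_eq_ite {M : Type*} [AddCommGroup M] [Module R M] {s : ℤ} {x : ExteriorAlgebra R M}
    (hx : x ∈ extPow R M s) (t : ℤ) : extProj R M t x = if s = t then x else 0 := by
  split_ifs with h
  · exact extProj_of_mem (h ▸ hx)
  · exact extProj_of_mem_ne hx h

theorem map_extProj_eq_ite {M N : Type*} [AddCommGroup M] [Module R M] [AddCommGroup N] [Module R N]
    {s t : ℤ} {z : ExteriorAlgebra R M ⊗[R] ExteriorAlgebra R N}
    (hz : z ∈ tens (extPow R M s) (extPow R N t)) (s' t' : ℤ) :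
    TensorProduct.map (extProj R M s') (extProj R N t') z = if s = s' ∧ t = t' then z else 0 := by
  have h : tens (extPow R M s) (extPow R N t) ≤
      LinearMap.eqLocus (TensorProduct.map (extProj R M s') (extProj R N t'))
        (if s = s' ∧ t = t' then LinearMap.id else 0) := by
    refine tens_le fun p hp q hq => ?_
    rw [LinearMap.mem_eqLocus, TensorProduct.map_tmul, extProj_eq_ite hp, extProj_eq_ite hq]
    by_cases h1 : s = s' <;> by_cases h2 : t = t' <;> simp [h1, h2]
  have h' : TensorProduct.map (extProj R M s') (extProj R N t') z =
    (if s = s' ∧ t = t' then LinearMap.id else 0 : _ →ₗ[R] _) z := h hz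
  rw [h']
  split_ifs <;> rfl

theorem ccProj_eq_ite {s t : ℤ} {z : Co R F ⊗[R] Co R F} (hz : z ∈ cc R F s t) (s' t' : ℤ) :
    ccProj R F s' t' z = if s = s' ∧ t = t' then z else 0 :=
  map_extProj_eq_ite hz s' t'

theorem ecProj_eq_ite {s t : ℤ} {z : Ex R F ⊗[R] Co R F} (hz : z ∈ ec R F s t) (s' t' : ℤ) :
    ecProj R F s' t' z = if s = s' ∧ t = t' then z else 0 :=
  map_extProj_eq_ite hz s' t'

theorem eq_zero_of_mem_extPow {M : Type*} [AddCommGroup M] [Module R M]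
    (b : Module.Basis (Fin n) R M) {s : ℤ} (hs : ¬ (0 ≤ s ∧ s ≤ n)) {x : ExteriorAlgebra R M}
    (hx : x ∈ extPow R M s) : x = 0 := by
  rcases lt_or_ge s 0 with h | h
  · rwa [extPow_of_neg h, Submodule.mem_bot] at hx
  · rwa [extPow_of_gt b (by omega), Submodule.mem_bot] at hx

/-- This restricts attention to the square of bidegrees with both entries between 0 and `n`, so the
remaining case distinctions are linear arithmetic. -/
theorem eq_zero_of_mem_cc (b : Module.Basis (Fin n) R F) {s t : ℤ}
    (hs : ¬ (0 ≤ s ∧ s ≤ n ∧ 0 ≤ t ∧ t ≤ n)) {z : Co R F ⊗[R] Co R F} (hz : z ∈ cc R F s t) :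
    z = 0 := by
  refine (Submodule.mem_bot R).1 ((tens_le (T := ⊥) fun p hp q hq => ?_) hz)
  rw [Submodule.mem_bot]
  by_cases h : 0 ≤ s ∧ s ≤ n
  · rw [eq_zero_of_mem_extPow b.dualBasis (by omega) hq, TensorProduct.tmul_zero]
  · rw [eq_zero_of_mem_extPow b.dualBasis (by omega) hp, TensorProduct.zero_tmul]

theorem eq_zero_of_mem_ec (b : Module.Basis (Fin n) R F) {s t : ℤ}
    (hs : ¬ (0 ≤ s ∧ s ≤ n ∧ 0 ≤ t ∧ t ≤ n)) {z : Ex R F ⊗[R] Co R F} (hz : z ∈ ec R F s t) :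
    z = 0 := by
  refine (Submodule.mem_bot R).1 ((tens_le (T := ⊥) fun p hp q hq => ?_) hz)
  rw [Submodule.mem_bot]
  by_cases h : 0 ≤ s ∧ s ≤ n
  · rw [eq_zero_of_mem_extPow b.dualBasis (by omega) hq, TensorProduct.tmul_zero]
  · rw [eq_zero_of_mem_extPow b (by omega) hp, TensorProduct.zero_tmul]

theorem mu_mem {s t : ℤ} {z : Ex R F ⊗[R] Co R F} (hz : z ∈ ec R F s t) :
    mu R F z ∈ extPow R (Module.Dual R F) (t - s) :=
  (tens_le (T := (extPow R (Module.Dual R F) (t - s)).comap (mu R F))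
    fun _ hp _ hq => contr_mem _ hp hq) hz

theorem Data.sigma_mem (D : Data R F n) (b : Module.Basis (Fin n) R F) {s : ℤ} {α : Co R F}
    (hα : α ∈ extPow R (Module.Dual R F) s) : D.sigma α ∈ ec R F (n - 1) (s - 1) := by
  rw [D.sigma_apply b]
  exact sum_mem fun i _ => tmul_mem_tens (contr_ι_mem _ _ D.eta_mem) (contr_ι_mem _ _ hα)

theorem Data.sigma_eq_zero (D : Data R F n) (b : Module.Basis (Fin n) R F) {α : Co R F}
    (hα : α ∈ extPow R (Module.Dual R F) 0) : D.sigma α = 0 := by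
  have h := D.sigma_mem b hα
  exact eq_zero_of_mem_ec b (by omega) h

end Projections

namespace Splittings

variable {R : Type u} [CommRing R] {F : Type v} [AddCommGroup F] [Module R F] {n : ℕ}
  {D : Data R F n} (S : Splittings D)

/-- The splitting `λσ = id` is not available on scalars, but there `σ` is zero since its right
factor would have degree `-1`. In `ell_mu_ell` the convention `ℓ_n = 0` plays the same role. -/
theorem sigma_lam_sigma (b : Module.Basis (Fin n) R F) {s : ℤ} {α : Co R F}
    (hα : α ∈ extPow R (Module.Dual R F) s) : D.sigma (S.lam (D.sigma α)) = D.sigma α := by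
  rcases eq_or_ne s 0 with rfl | hs
  · rw [D.sigma_eq_zero b hα, map_zero, map_zero]
  · rw [S.lam_sigma (s - 1) (by omega) α (by rwa [sub_add_cancel])]

theorem ell_mu_ell {s : ℤ} {α : Co R F}
    (hα : α ∈ extPow R (Module.Dual R F) s) : S.ell (mu R F (S.ell α)) = S.ell α := by
  rcases eq_or_ne s n with rfl | hs
  · rw [S.ell_top α hα, map_zero, map_zero]
  · rw [S.mu_ell s hs α hα]

theorem sigma_lam_mem (b : Module.Basis (Fin n) R F) {t : ℤ} {z : Ex R F ⊗[R] Co R F}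
    (hz : z ∈ ec R F (n - 1) t) : D.sigma (S.lam z) ∈ ec R F (n - 1) t := by
  have := D.sigma_mem b (S.lam_mem t z hz)
  rwa [add_sub_cancel_right] at this

theorem ell_mu_mem {t : ℤ} {z : Ex R F ⊗[R] Co R F}
    (hz : z ∈ ec R F 1 t) : S.ell (mu R F z) ∈ ec R F 1 t := by
  have := S.ell_mem _ _ (mu_mem hz)
  rwa [sub_add_cancel] at this

/-- At the excluded index `t = -1` the source is zero. For `mu_ell_mu` the excluded case is right
degree `n + 1`, where the source is zero as well. -/
theorem lam_sigma_lam (b : Module.Basis (Fin n) R F) {t : ℤ} {z : Ex R F ⊗[R] Co R F}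
    (hz : z ∈ ec R F (n - 1) t) : S.lam (D.sigma (S.lam z)) = S.lam z := by
  rcases eq_or_ne t (-1) with rfl | hs
  · rw [eq_zero_of_mem_ec b (by omega) hz, map_zero, map_zero, map_zero]
  · rw [S.lam_sigma t hs _ (S.lam_mem t z hz)]

theorem mu_ell_mu (b : Module.Basis (Fin n) R F) {t : ℤ} {z : Ex R F ⊗[R] Co R F}
    (hz : z ∈ ec R F 1 t) : mu R F (S.ell (mu R F z)) = mu R F z := by
  rcases eq_or_ne (t - 1) n with hs | hs
  · rw [eq_zero_of_mem_ec b (by omega) hz, map_zero, map_zero, map_zero]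
  · rw [S.mu_ell (t - 1) hs _ (mu_mem hz)]

/-! ### The projections on homogeneous elements -/

theorem ite_linearMap_apply {V W : Type*} [AddCommGroup V] [Module R V] [AddCommGroup W]
    [Module R W] (c : Prop) [Decidable c] (g h : V →ₗ[R] W) (x : V) :
    (if c then g else h) x = if c then g x else h x := by
  split_ifs <;> rfl

theorem pr_in1 (z : Co R F ⊗[R] Co R F) : pr1 R F (in1 R F z) = z ∧ pr2 R F (in1 R F z) = 0 ∧
    pr3 R F (in1 R F z) = 0 ∧ pr4 R F (in1 R F z) = 0 := ⟨rfl, rfl, rfl, rfl⟩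

theorem pr_in2 (z : Ex R F ⊗[R] Co R F) : pr1 R F (in2 R F z) = 0 ∧ pr2 R F (in2 R F z) = z ∧
    pr3 R F (in2 R F z) = 0 ∧ pr4 R F (in2 R F z) = 0 := ⟨rfl, rfl, rfl, rfl⟩

theorem pr_in3 (z : Ex R F ⊗[R] Co R F) : pr1 R F (in3 R F z) = 0 ∧ pr2 R F (in3 R F z) = 0 ∧
    pr3 R F (in3 R F z) = z ∧ pr4 R F (in3 R F z) = 0 := ⟨rfl, rfl, rfl, rfl⟩

theorem pr_in4 (z : Co R F ⊗[R] Co R F) : pr1 R F (in4 R F z) = 0 ∧ pr2 R F (in4 R F z) = 0 ∧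
    pr3 R F (in4 R F z) = 0 ∧ pr4 R F (in4 R F z) = z := ⟨rfl, rfl, rfl, rfl⟩

section Values

variable (b : Module.Basis (Fin n) R F) {r s t : ℤ}

include b

theorem piL_in1 (h : s + t = r + 1) {z : Co R F ⊗[R] Co R F} (hz : z ∈ cc R F s t) :
    S.piL r (in1 R F z) = if s = 0 ∨ t = 0 then in1 R F z else 0 := by
  by_cases hd : 0 ≤ s ∧ s ≤ n ∧ 0 ≤ t ∧ t ≤ n
  swap
  · rw [eq_zero_of_mem_cc b hd hz, map_zero, map_zero, ite_self]
  simp only [piL, LinearMap.add_apply, ite_linearMap_apply, on1, on2, on3, on4,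
    LinearMap.comp_apply, pr_in1, map_zero, LinearMap.zero_apply, ccProj_eq_ite hz, ite_self,
    add_zero, apply_ite (in1 R F), ← ite_and]
  split_ifs <;> first | omega | rw [add_zero] | rw [zero_add]

/-- The corner bidegrees `(0, n)` and `(n, 0)` belong to ℕ̂ in 𝔽(4), whereas in 𝔽(1) they belong to
𝕃. This explains the additional conditions compared with `piL_in1`. -/
theorem piL_in4 (h : s + t = r - 1) {z : Co R F ⊗[R] Co R F} (hz : z ∈ cc R F s t) :
    S.piL r (in4 R F z) = if (s = 0 ∧ t ≠ n) ∨ (t = 0 ∧ s ≠ n) then in4 R F z else 0 := by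
  by_cases hd : 0 ≤ s ∧ s ≤ n ∧ 0 ≤ t ∧ t ≤ n
  swap
  · rw [eq_zero_of_mem_cc b hd hz, map_zero, map_zero, ite_self]
  simp only [piL, LinearMap.add_apply, ite_linearMap_apply, on1, on2, on3, on4,
    LinearMap.comp_apply, pr_in4, map_zero, LinearMap.zero_apply, ccProj_eq_ite hz, ite_self,
    add_zero, zero_add, apply_ite (in4 R F), ← ite_and]
  split_ifs <;> first | omega | rw [add_zero] | rw [zero_add]

theorem piL_in2 (h : s + t = r) {z : Ex R F ⊗[R] Co R F} (hz : z ∈ ec R F s t) :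
    S.piL r (in2 R F z) = if s = n - 1 then in2 R F (D.sigma (S.lam z)) else
      if s = n then in2 R F z else 0 := by
  by_cases hd : 0 ≤ s ∧ s ≤ n ∧ 0 ≤ t ∧ t ≤ n
  swap
  · rw [eq_zero_of_mem_ec b hd hz]; simp only [map_zero, ite_self]
  simp only [piL, LinearMap.add_apply, ite_linearMap_apply, on1, on2, on3, on4, topProj,
    LinearMap.comp_apply, pr_in2, map_zero, LinearMap.zero_apply, ecProj_eq_ite hz, ite_self,
    add_zero, zero_add, apply_ite (in2 R F), apply_ite S.lam, apply_ite D.sigma, ← ite_and]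
  by_cases h1 : s = n - 1
  · rw [if_pos h1]
    -- Here `r = 2n - 1` lies just beyond the range in the definition. The formula still holds,
    -- because `λ` takes values in degree `n + 1`, which is zero.
    by_cases h2 : t = n
    · subst h1
      have h3 := S.lam_mem t z hz
      rw [eq_zero_of_mem_extPow b.dualBasis (by omega) h3, map_zero, map_zero, ite_self,
        if_neg (by omega), add_zero]
    · rw [if_pos (by omega), if_neg (by omega), add_zero]
  · rw [if_neg h1, if_neg (by omega), zero_add]
    split_ifs <;> first | omega | rfl

/-- Unlike 𝔽(2), the third summand has its top pieces for `r = 2n - 2` and `r = 2n` assigned to 𝕄,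
and these two values are excepted. -/
theorem piL_in3 (hn : 3 ≤ n) (h : s + t = r) {z : Ex R F ⊗[R] Co R F} (hz : z ∈ ec R F s t) :
    S.piL r (in3 R F z) = if s = n - 1 ∧ r ≠ 2 * n - 2 then in3 R F (D.sigma (S.lam z)) else
      if s = n ∧ r ≠ 2 * n then in3 R F z else 0 := by
  by_cases hd : 0 ≤ s ∧ s ≤ n ∧ 0 ≤ t ∧ t ≤ n
  swap
  · rw [eq_zero_of_mem_ec b hd hz]; simp only [map_zero, ite_self]
  simp only [piL, LinearMap.add_apply, ite_linearMap_apply, on1, on2, on3, on4, topProj,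
    LinearMap.comp_apply, pr_in3, map_zero, LinearMap.zero_apply, ecProj_eq_ite hz, ite_self,
    add_zero, zero_add, apply_ite (in3 R F), apply_ite S.lam, apply_ite D.sigma, ← ite_and]
  by_cases h1 : s = n - 1
  · by_cases h2 : t = n
    · subst h1
      have h3 := S.lam_mem t z hz
      rw [eq_zero_of_mem_extPow b.dualBasis (by omega) h3, map_zero, map_zero, ite_self,
        if_neg (by omega), add_zero]
      split_ifs <;> first | omega | rfl
    · rw [if_neg (c := _ ∧ s = n ∧ _) (by omega), add_zero, if_neg (c := s = n ∧ _) (by omega)]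
      split_ifs <;> first | omega | rfl
  · rw [if_neg (by omega), zero_add, if_neg (c := s = n - 1 ∧ _) (by omega)]
    split_ifs <;> first | omega | rfl

theorem piM_in1 (h : s + t = r + 1) {z : Co R F ⊗[R] Co R F} (hz : z ∈ cc R F s t) :
    S.piM r (in1 R F z) = if s = 0 ∨ t = 0 ∨ s = n ∨ t = n then 0 else in1 R F z := by
  by_cases hd : 0 ≤ s ∧ s ≤ n ∧ 0 ≤ t ∧ t ≤ n
  swap
  · rw [eq_zero_of_mem_cc b hd hz, map_zero, map_zero, ite_self]
  have e : ∀ i, (if s = i ∧ t = r + 1 - i then z else 0) = if s = i then z else 0 := fun i => by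
    split_ifs <;> first | omega | rfl
  simp only [piM, LinearMap.add_apply, ite_linearMap_apply, on1, on2, on3, on4,
    LinearMap.comp_apply, LinearMap.sum_apply, pr_in1, map_zero, LinearMap.zero_apply,
    ccProj_eq_ite hz, ite_self, add_zero, Finset.sum_const_zero, e, apply_ite (in1 R F),
    Finset.sum_ite_eq, Finset.mem_sdiff, Finset.mem_Icc, Finset.mem_insert, Finset.mem_singleton]
  split_ifs <;> first | omega | rfl

theorem piM_in4 (h : s + t = r - 1) {z : Co R F ⊗[R] Co R F} (hz : z ∈ cc R F s t) :
    S.piM r (in4 R F z) = if s = 0 ∨ t = 0 ∨ s = n ∨ t = n then 0 else in4 R F z := by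
  by_cases hd : 0 ≤ s ∧ s ≤ n ∧ 0 ≤ t ∧ t ≤ n
  swap
  · rw [eq_zero_of_mem_cc b hd hz, map_zero, map_zero, ite_self]
  have e : ∀ i, (if s = i ∧ t = r - 1 - i then z else 0) = if s = i then z else 0 := fun i => by
    split_ifs <;> first | omega | rfl
  simp only [piM, LinearMap.add_apply, ite_linearMap_apply, on1, on2, on3, on4,
    LinearMap.comp_apply, LinearMap.sum_apply, pr_in4, map_zero, LinearMap.zero_apply,
    ccProj_eq_ite hz, ite_self, add_zero, zero_add, Finset.sum_const_zero, e, apply_ite (in4 R F),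
    Finset.sum_ite_eq, Finset.mem_sdiff, Finset.mem_Icc, Finset.mem_insert, Finset.mem_singleton]
  split_ifs <;> first | omega | rfl

theorem piM_in2 (hn : 3 ≤ n) (h : s + t = r) {z : Ex R F ⊗[R] Co R F} (hz : z ∈ ec R F s t) :
    S.piM r (in2 R F z) = if s = 0 ∨ s = n then 0 else
      if s = n - 1 then in2 R F (z - D.sigma (S.lam z)) else
      if s = 1 then in2 R F (z - S.ell (mu R F z)) else in2 R F z := by
  by_cases hd : 0 ≤ s ∧ s ≤ n ∧ 0 ≤ t ∧ t ≤ n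
  swap
  · rw [eq_zero_of_mem_ec b hd hz]; simp only [map_zero, sub_zero, ite_self]
  have e : ∀ i, (if s = i ∧ t = r - i then z else 0) = if s = i then z else 0 := fun i => by
    split_ifs <;> first | omega | rfl
  simp only [piM, LinearMap.add_apply, LinearMap.sub_apply, ite_linearMap_apply, on1, on2, on3, on4,
    LinearMap.comp_apply, LinearMap.sum_apply, pr_in2, map_zero, LinearMap.zero_apply, topProj,
    botProj, ecProj_eq_ite hz, ite_self, add_zero, zero_add, Finset.sum_const_zero, e,
    apply_ite (in2 R F), apply_ite S.lam, apply_ite D.sigma, apply_ite (mu R F), apply_ite S.ell,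
    Finset.sum_ite_eq, Finset.mem_Icc, map_sub]
  split_ifs <;> first | omega | simp only [sub_zero, add_zero, zero_add]

theorem piM_in3 (hn : 3 ≤ n) (h : s + t = r) {z : Ex R F ⊗[R] Co R F} (hz : z ∈ ec R F s t) :
    S.piM r (in3 R F z) = if (s = 0 ∧ r ≠ 0) ∨ (s = n ∧ r ≠ 2 * n) then 0 else
      if s = n - 1 ∧ r ≠ 2 * n - 2 then in3 R F (z - D.sigma (S.lam z)) else
      if s = 1 ∧ r ≠ 2 then in3 R F (z - S.ell (mu R F z)) else in3 R F z := by
  by_cases hd : 0 ≤ s ∧ s ≤ n ∧ 0 ≤ t ∧ t ≤ n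
  swap
  · rw [eq_zero_of_mem_ec b hd hz]; simp only [map_zero, sub_zero, ite_self]
  have e : ∀ i, (if s = i ∧ t = r - i then z else 0) = if s = i then z else 0 := fun i => by
    split_ifs <;> first | omega | rfl
  simp only [piM, LinearMap.add_apply, LinearMap.sub_apply, ite_linearMap_apply, on1, on2, on3, on4,
    LinearMap.comp_apply, LinearMap.sum_apply, pr_in3, map_zero, LinearMap.zero_apply, topProj,
    botProj, ecProj_eq_ite hz, add_zero, zero_add, Finset.sum_const_zero, e,
    apply_ite (in3 R F), apply_ite S.lam, apply_ite D.sigma, apply_ite (mu R F), apply_ite S.ell,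
    Finset.sum_ite_eq, Finset.mem_Icc, map_sub]
  -- The bound `3 ≤ n` makes the four special degrees 0, 1, `n - 1` and `n` distinct, so exactly one
  -- rule applies. For `n = 3` the last range is empty.
  have hs : s = 0 ∨ s = 1 ∨ s = n - 1 ∨ s = n ∨ (2 ≤ s ∧ s ≤ n - 2) := by omega
  rcases hs with h0 | h0 | h0 | h0 | h0
  · have a0 : ¬ s = 1 := by omega
    have a1 : ¬ s = n - 1 := by omega
    have a2 : ¬ s = n := by omega
    have a3 : ¬ (2 ≤ s ∧ s ≤ n - 2) := by omega
    simp only [a0, a1, a2, a3, false_and, if_false, sub_zero, add_zero, zero_add, ite_self, or_false]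
    split_ifs <;> first | omega | rfl
  · have a0 : ¬ s = 0 := by omega
    have a1 : ¬ s = n - 1 := by omega
    have a2 : ¬ s = n := by omega
    have a3 : ¬ (2 ≤ s ∧ s ≤ n - 2) := by omega
    simp only [a0, a1, a2, a3, false_and, if_false, sub_zero, add_zero, zero_add, ite_self, or_self]
    split_ifs <;> first | omega | simp only [add_zero, sub_add_cancel]
  · have a0 : ¬ s = 0 := by omega
    have a1 : ¬ s = 1 := by omega
    have a2 : ¬ s = n := by omega
    have a3 : ¬ (2 ≤ s ∧ s ≤ n - 2) := by omega
    simp only [a0, a1, a2, a3, false_and, if_false, sub_zero, add_zero, ite_self, or_self]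
    split_ifs <;> first | omega | simp only [add_zero, sub_add_cancel]
  · have a0 : ¬ s = 0 := by omega
    have a1 : ¬ s = 1 := by omega
    have a2 : ¬ s = n - 1 := by omega
    have a3 : ¬ (2 ≤ s ∧ s ≤ n - 2) := by omega
    simp only [a0, a1, a2, a3, false_and, if_false, sub_zero, add_zero, zero_add, ite_self, false_or]
    split_ifs <;> first | omega | rfl
  · have a0 : ¬ s = 0 := by omega
    have a1 : ¬ s = 1 := by omega
    have a2 : ¬ s = n - 1 := by omega
    have a3 : ¬ s = n := by omega
    simp only [a0, a1, a2, a3, if_pos h0, false_and, if_false, sub_zero, add_zero, zero_add, ite_self, or_self]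

end Values

end Splittings

/-! ### Inclusions among the summands of 𝔽, 𝕃, 𝕄 and ℕ̂. -/

section Summands

variable {R : Type u} [CommRing R] {F : Type v} [AddCommGroup F] [Module R F]

theorem le_ite_bot {V : Type*} [AddCommGroup V] [Module R V] {c : Prop} [Decidable c] (h : c)
    (A : Submodule R V) : A ≤ if c then A else ⊥ := by rw [if_pos h]

theorem ite_bot_le {V : Type*} [AddCommGroup V] [Module R V] {c : Prop} [Decidable c]
    {A B : Submodule R V} (h : c → A ≤ B) : (if c then A else ⊥) ≤ B := by
  split_ifs with hc
  · exact h hc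
  · exact bot_le

theorem map_cc_in1_eq {r s t : ℤ} (h : s + t = r + 1) : (cc R F s t).map (in1 R F) = F1 R F r s := by
  obtain rfl : t = r + 1 - s := by omega
  rfl

theorem map_ec_in2_eq {r s t : ℤ} (h : s + t = r) : (ec R F s t).map (in2 R F) = F2 R F r s := by
  obtain rfl : t = r - s := by omega
  rfl

theorem map_ec_in3_eq {r s t : ℤ} (h : s + t = r) : (ec R F s t).map (in3 R F) = F3 R F r s := by
  obtain rfl : t = r - s := by omega
  rfl

theorem map_cc_in4_eq {r s t : ℤ} (h : s + t = r - 1) :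
    (cc R F s t).map (in4 R F) = F4 R F r s := by
  obtain rfl : t = r - 1 - s := by omega
  rfl

theorem F1_le_FF (r t : ℤ) : F1 R F r t ≤ FF R F r :=
  le_sup_of_le_left (le_sup_of_le_left (le_sup_of_le_left (le_iSup (F1 R F r) t)))

theorem F2_le_FF (r t : ℤ) : F2 R F r t ≤ FF R F r :=
  le_sup_of_le_left (le_sup_of_le_left (le_sup_of_le_right (le_iSup (F2 R F r) t)))

theorem F3_le_FF (r t : ℤ) : F3 R F r t ≤ FF R F r :=
  le_sup_of_le_left (le_sup_of_le_right (le_iSup (F3 R F r) t))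

theorem F4_le_FF (r t : ℤ) : F4 R F r t ≤ FF R F r :=
  le_sup_of_le_right (le_iSup (F4 R F r) t)

end Summands

namespace Splittings

variable {R : Type u} [CommRing R] {F : Type v} [AddCommGroup F] [Module R F] {n : ℕ}
  {D : Data R F n} (S : Splittings D)

section Bounds

variable {S} {r : ℤ} {T : Submodule R (Tot R F)}

theorem LL_le
    (h1 : -1 ≤ r ∧ r ≤ n - 1 → F1 R F r 0 ≤ T)
    (h2 : 0 ≤ r ∧ r ≤ n - 1 → F1 R F r (r + 1) ≤ T)
    (h3 : n - 1 ≤ r ∧ r ≤ 2 * n - 2 → (S.topIm r).map (in2 R F) ≤ T)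
    (h4 : n ≤ r ∧ r ≤ 2 * n → F2 R F r n ≤ T)
    (h5 : n - 1 ≤ r ∧ r ≤ 2 * n - 3 → (S.topIm r).map (in3 R F) ≤ T)
    (h6 : n ≤ r ∧ r ≤ 2 * n - 1 → F3 R F r n ≤ T)
    (h7 : 1 ≤ r ∧ r ≤ n → F4 R F r 0 ≤ T)
    (h8 : 2 ≤ r ∧ r ≤ n → F4 R F r (r - 1) ≤ T) : S.LL r ≤ T :=
  sup_le (sup_le (sup_le (sup_le (sup_le (sup_le (sup_le (ite_bot_le h1) (ite_bot_le h2))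
    (ite_bot_le h3)) (ite_bot_le h4)) (ite_bot_le h5)) (ite_bot_le h6)) (ite_bot_le h7))
    (ite_bot_le h8)

theorem Nhat_le
    (h1 : n ≤ r ∧ r ≤ 2 * n - 1 → F1 R F r n ≤ T)
    (h2 : n ≤ r ∧ r ≤ 2 * n - 2 → F1 R F r (r + 1 - n) ≤ T)
    (h3 : 0 ≤ r ∧ r ≤ n → F2 R F r 0 ≤ T)
    (h4 : 2 ≤ r ∧ r ≤ n + 1 → (S.botIm r).map (in2 R F) ≤ T)
    (h5 : 1 ≤ r ∧ r ≤ n → F3 R F r 0 ≤ T)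
    (h6 : 3 ≤ r ∧ r ≤ n + 1 → (S.botIm r).map (in3 R F) ≤ T)
    (h7 : n + 1 ≤ r ∧ r ≤ 2 * n + 1 → F4 R F r n ≤ T)
    (h8 : n + 1 ≤ r ∧ r ≤ 2 * n → F4 R F r (r - 1 - n) ≤ T) : S.Nhat r ≤ T :=
  sup_le (sup_le (sup_le (sup_le (sup_le (sup_le (sup_le (ite_bot_le h1) (ite_bot_le h2))
    (ite_bot_le h3)) (ite_bot_le h4)) (ite_bot_le h5)) (ite_bot_le h6)) (ite_bot_le h7))
    (ite_bot_le h8)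

theorem Mhat_le
    (h1 : ∀ t : ℤ, t ≠ 0 → t ≠ n → t ≠ r + 1 → t ≠ r + 1 - n → F1 R F r t ≤ T)
    (h2 : (S.topKer r).map (in2 R F) ≤ T)
    (h3 : ∀ t : ℤ, 2 ≤ t ∧ t ≤ n - 2 → F2 R F r t ≤ T)
    (h4 : (S.botKer r).map (in2 R F) ≤ T)
    (h5 : (S.topKer r).map (in3 R F) ≤ T)
    (h6 : ∀ t : ℤ, 2 ≤ t ∧ t ≤ n - 2 → F3 R F r t ≤ T)
    (h7 : (S.botKer r).map (in3 R F) ≤ T)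
    (h8 : ∀ t : ℤ, t ≠ 0 → t ≠ n → t ≠ r - 1 → t ≠ r - 1 - n → F4 R F r t ≤ T) :
    S.Mhat r ≤ T := by
  refine sup_le (sup_le (sup_le (sup_le (sup_le (sup_le (sup_le (iSup₂_le fun t ht => ?_) h2)
    (iSup₂_le h3)) h4) h5) (iSup₂_le h6)) h7) (iSup₂_le fun t ht => ?_)
  · simp only [Set.mem_insert_iff, Set.mem_singleton_iff, not_or] at ht
    exact h1 t ht.1 ht.2.1 ht.2.2.1 ht.2.2.2
  · simp only [Set.mem_insert_iff, Set.mem_singleton_iff, not_or] at ht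
    exact h8 t ht.1 ht.2.1 ht.2.2.1 ht.2.2.2

theorem MM_le (h : S.Mhat r ≤ T) (h0 : r = 0 → F3 R F r 0 ≤ T)
    (h2 : r = 2 → (S.botIm r).map (in3 R F) ≤ T)
    (h3 : r = 2 * n - 2 → (S.topIm r).map (in3 R F) ≤ T)
    (h4 : r = 2 * n → F3 R F r n ≤ T) : S.MM r ≤ T := by
  rw [MM]
  split_ifs with c0 c2 c3 c4
  · subst c0; exact sup_le h (h0 rfl)
  · subst c2; exact sup_le h (h2 rfl)
  · subst c3; exact sup_le h (h3 rfl)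
  · subst c4; exact sup_le h (h4 rfl)
  · exact h

variable (S) (r)

theorem Mhat_le_MM : S.Mhat r ≤ S.MM r := by
  rw [MM]
  split_ifs with c0 c2 c3 c4
  · subst c0; exact le_sup_left
  · subst c2; exact le_sup_left
  · subst c3; exact le_sup_left
  · subst c4; exact le_sup_left
  · exact le_rfl

variable {r}

theorem F3_zero_le_MM (h : r = 0) : F3 R F r 0 ≤ S.MM r := by
  subst h
  rw [MM, if_pos rfl]
  exact le_sup_right

theorem botIm_le_MM (h : r = 2) : (S.botIm r).map (in3 R F) ≤ S.MM r := by
  subst h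
  rw [MM, if_neg (by omega), if_pos rfl]
  exact le_sup_right

theorem topIm_le_MM (hn : 3 ≤ n) (h : r = 2 * n - 2) :
    (S.topIm r).map (in3 R F) ≤ S.MM r := by
  subst h
  rw [MM, if_neg (by omega), if_neg (by omega), if_pos rfl]
  exact le_sup_right

theorem F3_top_le_MM (hn : 3 ≤ n) (h : r = 2 * n) : F3 R F r n ≤ S.MM r := by
  subst h
  rw [MM, if_neg (by omega), if_neg (by omega), if_neg (by omega), if_pos rfl]
  exact le_sup_right

theorem F1_le_MM {t : ℤ} (h1 : t ≠ 0) (h2 : t ≠ n) (h3 : t ≠ r + 1) (h4 : t ≠ r + 1 - n) :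
    F1 R F r t ≤ S.MM r := by
  refine le_trans ?_ (S.Mhat_le_MM r)
  refine le_sup_of_le_left (le_sup_of_le_left (le_sup_of_le_left (le_sup_of_le_left
    (le_sup_of_le_left (le_sup_of_le_left (le_sup_of_le_left ?_))))))
  refine le_iSup₂_of_le t ?_ le_rfl
  simp only [Set.mem_insert_iff, Set.mem_singleton_iff, not_or]
  exact ⟨h1, h2, h3, h4⟩

theorem topKer_in2_le_MM : (S.topKer r).map (in2 R F) ≤ S.MM r :=
  le_trans (le_sup_of_le_left (le_sup_of_le_left (le_sup_of_le_left (le_sup_of_le_left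
    (le_sup_of_le_left (le_sup_of_le_left le_sup_right)))))) (S.Mhat_le_MM r)

theorem F2_le_MM {t : ℤ} (h : 2 ≤ t ∧ t ≤ n - 2) : F2 R F r t ≤ S.MM r :=
  le_trans (le_sup_of_le_left (le_sup_of_le_left (le_sup_of_le_left (le_sup_of_le_left
    (le_sup_of_le_left (le_sup_of_le_right (le_iSup₂_of_le t h le_rfl))))))) (S.Mhat_le_MM r)

theorem botKer_in2_le_MM : (S.botKer r).map (in2 R F) ≤ S.MM r :=
  le_trans (le_sup_of_le_left (le_sup_of_le_left (le_sup_of_le_left (le_sup_of_le_left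
    le_sup_right)))) (S.Mhat_le_MM r)

theorem topKer_in3_le_MM : (S.topKer r).map (in3 R F) ≤ S.MM r :=
  le_trans (le_sup_of_le_left (le_sup_of_le_left (le_sup_of_le_left le_sup_right)))
    (S.Mhat_le_MM r)

theorem F3_le_MM {t : ℤ} (h : 2 ≤ t ∧ t ≤ n - 2) : F3 R F r t ≤ S.MM r :=
  le_trans (le_sup_of_le_left (le_sup_of_le_left (le_sup_of_le_right
    (le_iSup₂_of_le t h le_rfl)))) (S.Mhat_le_MM r)

theorem botKer_in3_le_MM : (S.botKer r).map (in3 R F) ≤ S.MM r :=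
  le_trans (le_sup_of_le_left le_sup_right) (S.Mhat_le_MM r)

theorem F4_le_MM {t : ℤ} (h1 : t ≠ 0) (h2 : t ≠ n) (h3 : t ≠ r - 1) (h4 : t ≠ r - 1 - n) :
    F4 R F r t ≤ S.MM r := by
  refine le_trans (le_sup_of_le_right ?_) (S.Mhat_le_MM r)
  refine le_iSup₂_of_le t ?_ le_rfl
  simp only [Set.mem_insert_iff, Set.mem_singleton_iff, not_or]
  exact ⟨h1, h2, h3, h4⟩

theorem F1_zero_le_LL (h : -1 ≤ r ∧ r ≤ n - 1) : F1 R F r 0 ≤ S.LL r :=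
  le_sup_of_le_left (le_sup_of_le_left (le_sup_of_le_left (le_sup_of_le_left (le_sup_of_le_left
    (le_sup_of_le_left (le_sup_of_le_left (le_ite_bot h _)))))))

theorem F1_succ_le_LL (h : 0 ≤ r ∧ r ≤ n - 1) : F1 R F r (r + 1) ≤ S.LL r :=
  le_sup_of_le_left (le_sup_of_le_left (le_sup_of_le_left (le_sup_of_le_left (le_sup_of_le_left
    (le_sup_of_le_left (le_sup_of_le_right (le_ite_bot h _)))))))

theorem topIm_in2_le_LL (h : n - 1 ≤ r ∧ r ≤ 2 * n - 2) : (S.topIm r).map (in2 R F) ≤ S.LL r :=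
  le_sup_of_le_left (le_sup_of_le_left (le_sup_of_le_left (le_sup_of_le_left (le_sup_of_le_left
    (le_sup_of_le_right (le_ite_bot h _))))))

theorem F2_top_le_LL (h : n ≤ r ∧ r ≤ 2 * n) : F2 R F r n ≤ S.LL r :=
  le_sup_of_le_left (le_sup_of_le_left (le_sup_of_le_left (le_sup_of_le_left
    (le_sup_of_le_right (le_ite_bot h _)))))

theorem topIm_in3_le_LL (h : n - 1 ≤ r ∧ r ≤ 2 * n - 3) : (S.topIm r).map (in3 R F) ≤ S.LL r :=
  le_sup_of_le_left (le_sup_of_le_left (le_sup_of_le_left (le_sup_of_le_right (le_ite_bot h _))))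

theorem F3_top_le_LL (h : n ≤ r ∧ r ≤ 2 * n - 1) : F3 R F r n ≤ S.LL r :=
  le_sup_of_le_left (le_sup_of_le_left (le_sup_of_le_right (le_ite_bot h _)))

theorem F4_zero_le_LL (h : 1 ≤ r ∧ r ≤ n) : F4 R F r 0 ≤ S.LL r :=
  le_sup_of_le_left (le_sup_of_le_right (le_ite_bot h _))

theorem F4_pred_le_LL (h : 2 ≤ r ∧ r ≤ n) : F4 R F r (r - 1) ≤ S.LL r :=
  le_sup_of_le_right (le_ite_bot h _)

theorem F1_top_le_Nhat (h : n ≤ r ∧ r ≤ 2 * n - 1) : F1 R F r n ≤ S.Nhat r :=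
  le_sup_of_le_left (le_sup_of_le_left (le_sup_of_le_left (le_sup_of_le_left (le_sup_of_le_left
    (le_sup_of_le_left (le_sup_of_le_left (le_ite_bot h _)))))))

theorem F1_sub_le_Nhat (h : n ≤ r ∧ r ≤ 2 * n - 2) : F1 R F r (r + 1 - n) ≤ S.Nhat r :=
  le_sup_of_le_left (le_sup_of_le_left (le_sup_of_le_left (le_sup_of_le_left (le_sup_of_le_left
    (le_sup_of_le_left (le_sup_of_le_right (le_ite_bot h _)))))))

theorem F2_zero_le_Nhat (h : 0 ≤ r ∧ r ≤ n) : F2 R F r 0 ≤ S.Nhat r :=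
  le_sup_of_le_left (le_sup_of_le_left (le_sup_of_le_left (le_sup_of_le_left (le_sup_of_le_left
    (le_sup_of_le_right (le_ite_bot h _))))))

theorem botIm_in2_le_Nhat (h : 2 ≤ r ∧ r ≤ n + 1) : (S.botIm r).map (in2 R F) ≤ S.Nhat r :=
  le_sup_of_le_left (le_sup_of_le_left (le_sup_of_le_left (le_sup_of_le_left
    (le_sup_of_le_right (le_ite_bot h _)))))

theorem F3_zero_le_Nhat (h : 1 ≤ r ∧ r ≤ n) : F3 R F r 0 ≤ S.Nhat r :=
  le_sup_of_le_left (le_sup_of_le_left (le_sup_of_le_left (le_sup_of_le_right (le_ite_bot h _))))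

theorem botIm_in3_le_Nhat (h : 3 ≤ r ∧ r ≤ n + 1) : (S.botIm r).map (in3 R F) ≤ S.Nhat r :=
  le_sup_of_le_left (le_sup_of_le_left (le_sup_of_le_right (le_ite_bot h _)))

theorem F4_top_le_Nhat (h : n + 1 ≤ r ∧ r ≤ 2 * n + 1) : F4 R F r n ≤ S.Nhat r :=
  le_sup_of_le_left (le_sup_of_le_right (le_ite_bot h _))

theorem F4_sub_le_Nhat (h : n + 1 ≤ r ∧ r ≤ 2 * n) : F4 R F r (r - 1 - n) ≤ S.Nhat r :=
  le_sup_of_le_right (le_ite_bot h _)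

end Bounds

/-! ### The projections on 𝕃, ℕ̂ and 𝕄. -/

section Decomposition

variable (b : Module.Basis (Fin n) R F) (hn : 3 ≤ n) (r : ℤ)

include b

theorem topIm_le : S.topIm r ≤ ec R F (n - 1) (r + 1 - n) := by
  rintro _ ⟨α, hα, rfl⟩
  have := D.sigma_mem b hα
  rwa [(by omega : r + 2 - (n : ℤ) - 1 = r + 1 - n)] at this

omit b in
theorem botIm_le : S.botIm r ≤ ec R F 1 (r - 1) := by
  rintro _ ⟨α, hα, rfl⟩
  have := S.ell_mem _ _ hα
  rwa [(by omega : r - 2 + 1 = r - 1)] at this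

theorem sigma_lam_of_mem {z : Ex R F ⊗[R] Co R F} (hz : z ∈ S.topIm r) :
    D.sigma (S.lam z) = z := by
  obtain ⟨α, hα, rfl⟩ := hz
  exact S.sigma_lam_sigma b hα

omit b in
theorem ell_mu_of_mem {z : Ex R F ⊗[R] Co R F} (hz : z ∈ S.botIm r) :
    S.ell (mu R F z) = z := by
  obtain ⟨α, hα, rfl⟩ := hz
  exact S.ell_mu_ell hα

include hn

set_option maxHeartbeats 1000000 in
theorem projections_on_LL : ∀ x ∈ S.LL r, S.piL r x = x ∧ S.piM r x = 0 := by
  intro x hx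
  refine (LL_le (T := LinearMap.eqLocus (S.piL r) LinearMap.id ⊓ LinearMap.ker (S.piM r))
    ?_ ?_ ?_ ?_ ?_ ?_ ?_ ?_) hx
  · rintro h _ ⟨z, hz, rfl⟩
    exact ⟨(S.piL_in1 b (by omega) hz).trans (if_pos (by omega)),
      (S.piM_in1 b (by omega) hz).trans (if_pos (by omega))⟩
  · rintro h _ ⟨z, hz, rfl⟩
    exact ⟨(S.piL_in1 b (by omega) hz).trans (if_pos (by omega)),
      (S.piM_in1 b (by omega) hz).trans (if_pos (by omega))⟩
  · rintro h _ ⟨z, hz, rfl⟩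
    have hz' := S.topIm_le b r hz
    refine ⟨(S.piL_in2 b (by omega) hz').trans ?_, (S.piM_in2 b hn (by omega) hz').trans ?_⟩
    · rw [if_pos rfl, S.sigma_lam_of_mem b r hz]
      rfl
    · rw [if_neg (by omega), if_pos rfl, S.sigma_lam_of_mem b r hz, sub_self, map_zero]
  · rintro h _ ⟨z, hz, rfl⟩
    refine ⟨(S.piL_in2 b (by omega) hz).trans ?_, (S.piM_in2 b hn (by omega) hz).trans ?_⟩
    · rw [if_neg (by omega), if_pos rfl]
      rfl
    · rw [if_pos (by omega)]
  · rintro h _ ⟨z, hz, rfl⟩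
    have hz' := S.topIm_le b r hz
    refine ⟨(S.piL_in3 b hn (by omega) hz').trans ?_, (S.piM_in3 b hn (by omega) hz').trans ?_⟩
    · rw [if_pos (by omega), S.sigma_lam_of_mem b r hz]
      rfl
    · rw [if_neg (by omega), if_pos (by omega), S.sigma_lam_of_mem b r hz, sub_self, map_zero]
  · rintro h _ ⟨z, hz, rfl⟩
    refine ⟨(S.piL_in3 b hn (by omega) hz).trans ?_, (S.piM_in3 b hn (by omega) hz).trans ?_⟩
    · rw [if_neg (by omega), if_pos (by omega)]
      rfl
    · rw [if_pos (by omega)]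
  · rintro h _ ⟨z, hz, rfl⟩
    exact ⟨(S.piL_in4 b (by omega) hz).trans (if_pos (by omega)),
      (S.piM_in4 b (by omega) hz).trans (if_pos (by omega))⟩
  · rintro h _ ⟨z, hz, rfl⟩
    exact ⟨(S.piL_in4 b (by omega) hz).trans (if_pos (by omega)),
      (S.piM_in4 b (by omega) hz).trans (if_pos (by omega))⟩

set_option maxHeartbeats 1000000 in
theorem projections_on_Nhat : ∀ x ∈ S.Nhat r, S.piL r x = 0 ∧ S.piM r x = 0 := by
  intro x hx
  refine (Nhat_le (T := LinearMap.ker (S.piL r) ⊓ LinearMap.ker (S.piM r))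
    ?_ ?_ ?_ ?_ ?_ ?_ ?_ ?_) hx
  · rintro h _ ⟨z, hz, rfl⟩
    exact ⟨(S.piL_in1 b (by omega) hz).trans (if_neg (by omega)),
      (S.piM_in1 b (by omega) hz).trans (if_pos (by omega))⟩
  · rintro h _ ⟨z, hz, rfl⟩
    exact ⟨(S.piL_in1 b (by omega) hz).trans (if_neg (by omega)),
      (S.piM_in1 b (by omega) hz).trans (if_pos (by omega))⟩
  · rintro h _ ⟨z, hz, rfl⟩
    refine ⟨(S.piL_in2 b (by omega) hz).trans ?_, (S.piM_in2 b hn (by omega) hz).trans ?_⟩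
    · rw [if_neg (by omega), if_neg (by omega)]
    · rw [if_pos (by omega)]
  · rintro h _ ⟨z, hz, rfl⟩
    have hz' := S.botIm_le r hz
    refine ⟨(S.piL_in2 b (by omega) hz').trans ?_, (S.piM_in2 b hn (by omega) hz').trans ?_⟩
    · rw [if_neg (by omega), if_neg (by omega)]
    · rw [if_neg (by omega), if_neg (by omega), if_pos rfl, S.ell_mu_of_mem r hz, sub_self,
        map_zero]
  · rintro h _ ⟨z, hz, rfl⟩
    refine ⟨(S.piL_in3 b hn (by omega) hz).trans ?_, (S.piM_in3 b hn (by omega) hz).trans ?_⟩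
    · rw [if_neg (by omega), if_neg (by omega)]
    · rw [if_pos (by omega)]
  · rintro h _ ⟨z, hz, rfl⟩
    have hz' := S.botIm_le r hz
    refine ⟨(S.piL_in3 b hn (by omega) hz').trans ?_, (S.piM_in3 b hn (by omega) hz').trans ?_⟩
    · rw [if_neg (by omega), if_neg (by omega)]
    · rw [if_neg (by omega), if_neg (by omega), if_pos (by omega), S.ell_mu_of_mem r hz, sub_self,
        map_zero]
  · rintro h _ ⟨z, hz, rfl⟩
    exact ⟨(S.piL_in4 b (by omega) hz).trans (if_neg (by omega)),
      (S.piM_in4 b (by omega) hz).trans (if_pos (by omega))⟩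
  · rintro h _ ⟨z, hz, rfl⟩
    exact ⟨(S.piL_in4 b (by omega) hz).trans (if_neg (by omega)),
      (S.piM_in4 b (by omega) hz).trans (if_pos (by omega))⟩

set_option maxHeartbeats 1000000 in
theorem projections_on_MM : ∀ x ∈ S.MM r, S.piL r x = 0 ∧ S.piM r x = x := by
  intro x hx
  refine (MM_le (T := LinearMap.ker (S.piL r) ⊓ LinearMap.eqLocus (S.piM r) LinearMap.id)
    (Mhat_le ?_ ?_ ?_ ?_ ?_ ?_ ?_ ?_) ?_ ?_ ?_ ?_) hx
  · rintro t h1 h2 h3 h4 _ ⟨z, hz, rfl⟩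
    exact ⟨(S.piL_in1 b (by omega) hz).trans (if_neg (by omega)),
      (S.piM_in1 b (by omega) hz).trans (if_neg (by omega))⟩
  · rintro _ ⟨z, ⟨hz, hz'⟩, rfl⟩
    refine ⟨(S.piL_in2 b (by omega) hz).trans ?_, (S.piM_in2 b hn (by omega) hz).trans ?_⟩
    · rw [if_pos rfl, LinearMap.mem_ker.1 hz', map_zero, map_zero]
    · rw [if_neg (by omega), if_pos rfl, LinearMap.mem_ker.1 hz', map_zero, sub_zero]
      rfl
  · rintro t h _ ⟨z, hz, rfl⟩
    refine ⟨(S.piL_in2 b (by omega) hz).trans ?_, (S.piM_in2 b hn (by omega) hz).trans ?_⟩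
    · rw [if_neg (by omega), if_neg (by omega)]
    · rw [if_neg (by omega), if_neg (by omega), if_neg (by omega)]
      rfl
  · rintro _ ⟨z, ⟨hz, hz'⟩, rfl⟩
    refine ⟨(S.piL_in2 b (by omega) hz).trans ?_, (S.piM_in2 b hn (by omega) hz).trans ?_⟩
    · rw [if_neg (by omega), if_neg (by omega)]
    · rw [if_neg (by omega), if_neg (by omega), if_pos rfl, LinearMap.mem_ker.1 hz', map_zero,
        sub_zero]
      rfl
  · rintro _ ⟨z, ⟨hz, hz'⟩, rfl⟩
    refine ⟨(S.piL_in3 b hn (by omega) hz).trans ?_, (S.piM_in3 b hn (by omega) hz).trans ?_⟩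
    · rw [LinearMap.mem_ker.1 hz', map_zero, map_zero]
      split_ifs <;> first | omega | rfl
    · rw [if_neg (by omega), LinearMap.mem_ker.1 hz', map_zero, sub_zero]
      split_ifs <;> first | omega | rfl
  · rintro t h _ ⟨z, hz, rfl⟩
    refine ⟨(S.piL_in3 b hn (by omega) hz).trans ?_, (S.piM_in3 b hn (by omega) hz).trans ?_⟩
    · rw [if_neg (by omega), if_neg (by omega)]
    · rw [if_neg (by omega), if_neg (by omega), if_neg (by omega)]
      rfl
  · rintro _ ⟨z, ⟨hz, hz'⟩, rfl⟩
    refine ⟨(S.piL_in3 b hn (by omega) hz).trans ?_, (S.piM_in3 b hn (by omega) hz).trans ?_⟩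
    · rw [if_neg (by omega), if_neg (by omega)]
    · rw [if_neg (by omega), if_neg (by omega), LinearMap.mem_ker.1 hz', map_zero, sub_zero,
        ite_self]
      rfl
  · rintro t h1 h2 h3 h4 _ ⟨z, hz, rfl⟩
    exact ⟨(S.piL_in4 b (by omega) hz).trans (if_neg (by omega)),
      (S.piM_in4 b (by omega) hz).trans (if_neg (by omega))⟩
  · rintro h _ ⟨z, hz, rfl⟩
    refine ⟨(S.piL_in3 b hn (by omega) hz).trans ?_, (S.piM_in3 b hn (by omega) hz).trans ?_⟩
    · rw [if_neg (by omega), if_neg (by omega)]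
    · rw [if_neg (by omega), if_neg (by omega), if_neg (by omega)]
      rfl
  · rintro h _ ⟨z, hz, rfl⟩
    have hz' := S.botIm_le r hz
    refine ⟨(S.piL_in3 b hn (by omega) hz').trans ?_, (S.piM_in3 b hn (by omega) hz').trans ?_⟩
    · rw [if_neg (by omega), if_neg (by omega)]
    · rw [if_neg (by omega), if_neg (by omega), if_neg (by omega)]
      rfl
  · rintro h _ ⟨z, hz, rfl⟩
    have hz' := S.topIm_le b r hz
    refine ⟨(S.piL_in3 b hn (by omega) hz').trans ?_, (S.piM_in3 b hn (by omega) hz').trans ?_⟩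
    · rw [if_neg (by omega), if_neg (by omega)]
    · rw [if_neg (by omega), if_neg (by omega), if_neg (by omega)]
      rfl
  · rintro h _ ⟨z, hz, rfl⟩
    refine ⟨(S.piL_in3 b hn (by omega) hz).trans ?_, (S.piM_in3 b hn (by omega) hz).trans ?_⟩
    · rw [if_neg (by omega), if_neg (by omega)]
    · rw [if_neg (by omega), if_neg (by omega), if_neg (by omega)]
      rfl

end Decomposition

end Splittings

/-! ### The three submodules span 𝔽. -/

namespace Splittings

variable {R : Type u} [CommRing R] {F : Type v} [AddCommGroup F] [Module R F] {n : ℕ}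
  {D : Data R F n} (S : Splittings D)

section Decomposition

variable (b : Module.Basis (Fin n) R F) (hn : 3 ≤ n) (r : ℤ)

theorem map_in2_le_FF {s t : ℤ} (h : s + t = r) {A : Submodule R (Ex R F ⊗[R] Co R F)}
    (hA : A ≤ ec R F s t) : A.map (in2 R F) ≤ FF R F r :=
  (Submodule.map_mono hA).trans ((map_ec_in2_eq h).trans_le (F2_le_FF r s))

theorem map_in3_le_FF {s t : ℤ} (h : s + t = r) {A : Submodule R (Ex R F ⊗[R] Co R F)}
    (hA : A ≤ ec R F s t) : A.map (in3 R F) ≤ FF R F r :=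
  (Submodule.map_mono hA).trans ((map_ec_in3_eq h).trans_le (F3_le_FF r s))

include b

theorem LL_le_FF : S.LL r ≤ FF R F r :=
  LL_le (fun _ => F1_le_FF _ _) (fun _ => F1_le_FF _ _)
    (fun _ => map_in2_le_FF r (by omega) (S.topIm_le b r)) (fun _ => F2_le_FF _ _)
    (fun _ => map_in3_le_FF r (by omega) (S.topIm_le b r)) (fun _ => F3_le_FF _ _)
    (fun _ => F4_le_FF _ _) (fun _ => F4_le_FF _ _)

omit b in
theorem Nhat_le_FF : S.Nhat r ≤ FF R F r :=
  Nhat_le (fun _ => F1_le_FF _ _) (fun _ => F1_le_FF _ _) (fun _ => F2_le_FF _ _)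
    (fun _ => map_in2_le_FF r (by omega) (S.botIm_le r)) (fun _ => F3_le_FF _ _)
    (fun _ => map_in3_le_FF r (by omega) (S.botIm_le r))
    (fun _ => F4_le_FF _ _) (fun _ => F4_le_FF _ _)

theorem MM_le_FF : S.MM r ≤ FF R F r :=
  MM_le (Mhat_le (fun _ _ _ _ _ => F1_le_FF _ _)
      (map_in2_le_FF r (by omega : (n : ℤ) - 1 + (r + 1 - n) = r) inf_le_left)
      (fun _ _ => F2_le_FF _ _) (map_in2_le_FF r (by omega : 1 + (r - 1) = r) inf_le_left)
      (map_in3_le_FF r (by omega : (n : ℤ) - 1 + (r + 1 - n) = r) inf_le_left)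
      (fun _ _ => F3_le_FF _ _) (map_in3_le_FF r (by omega : 1 + (r - 1) = r) inf_le_left)
      (fun _ _ _ _ _ => F4_le_FF _ _))
    (fun _ => F3_le_FF _ _) (fun _ => map_in3_le_FF r (by omega) (S.botIm_le r))
    (fun _ => map_in3_le_FF r (by omega) (S.topIm_le b r)) (fun _ => F3_le_FF _ _)

/-- `⋀ⁿ⁻¹F ⊗ ⋀F*` is spanned by `Ker λ` and `Im σ`. -/
theorem ec_top_le {s t : ℤ} (hs : s = n - 1) (ht : s + t = r) :
    ec R F s t ≤ S.topKer r ⊔ S.topIm r := by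
  intro z hz
  obtain rfl : t = r + 1 - n := by omega
  subst hs
  rw [← sub_add_cancel z (D.sigma (S.lam z))]
  refine Submodule.add_mem_sup ⟨sub_mem hz (S.sigma_lam_mem b hz), ?_⟩ ⟨S.lam z, ?_, rfl⟩
  · rw [SetLike.mem_coe, LinearMap.mem_ker, map_sub, S.lam_sigma_lam b hz, sub_self]
  · have := S.lam_mem _ z hz
    rwa [(by omega : r + 1 - (n : ℤ) + 1 = r + 2 - n)] at this

/-- `F ⊗ ⋀F*` is spanned by `Ker μ` and `Im ℓ`. -/
theorem ec_bot_le {s t : ℤ} (hs : s = 1) (ht : s + t = r) :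
    ec R F s t ≤ S.botKer r ⊔ S.botIm r := by
  intro z hz
  obtain rfl : t = r - 1 := by omega
  subst hs
  rw [← sub_add_cancel z (S.ell (mu R F z))]
  refine Submodule.add_mem_sup ⟨sub_mem hz (S.ell_mu_mem hz), ?_⟩ ⟨mu R F z, ?_, rfl⟩
  · rw [SetLike.mem_coe, LinearMap.mem_ker, map_sub, S.mu_ell_mu b hz, sub_self]
  · have := mu_mem hz
    rwa [(by omega : r - 1 - 1 = r - 2)] at this

theorem topIm_eq_bot (h : ¬ (n - 1 ≤ r ∧ r ≤ 2 * n - 2)) : S.topIm r = ⊥ := by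
  rw [Submodule.eq_bot_iff]
  rintro _ ⟨α, hα, rfl⟩
  -- At `r = n - 2` the source of `σ` is the nonzero module of scalars, but `σ` itself vanishes.
  -- Every other excluded `r` has a zero source.
  rcases eq_or_ne r (n - 2) with rfl | hr
  · refine D.sigma_eq_zero b ?_
    rwa [(by omega : (n : ℤ) - 2 + 2 - n = 0)] at hα
  · rw [eq_zero_of_mem_extPow b.dualBasis (by omega) hα, map_zero]

theorem botIm_eq_bot (h : ¬ (2 ≤ r ∧ r ≤ n + 1)) : S.botIm r = ⊥ := by
  rw [Submodule.eq_bot_iff]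
  rintro _ ⟨α, hα, rfl⟩
  -- At `r = n + 2` the source of `ℓ` is the top exterior power, where `ℓ` is zero by convention.
  -- Every other excluded `r` has a zero source.
  rcases eq_or_ne r (n + 2) with rfl | hr
  · refine S.ell_top α ?_
    rwa [(by omega : (n : ℤ) + 2 - 2 = n)] at hα
  · rw [eq_zero_of_mem_extPow b.dualBasis (by omega) hα, map_zero]

include hn

set_option maxHeartbeats 1000000 in
theorem FF_le_sup : FF R F r ≤ S.LL r ⊔ S.MM r ⊔ S.Nhat r := by
  have hL : S.LL r ≤ S.LL r ⊔ S.MM r ⊔ S.Nhat r := le_sup_left.trans le_sup_left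
  have hM : S.MM r ≤ S.LL r ⊔ S.MM r ⊔ S.Nhat r := le_sup_right.trans le_sup_left
  have hN : S.Nhat r ≤ S.LL r ⊔ S.MM r ⊔ S.Nhat r := le_sup_right
  refine FF_le ?_ ?_ ?_ ?_
  · intro s t h
    by_cases hd : 0 ≤ s ∧ s ≤ n ∧ 0 ≤ t ∧ t ≤ n
    swap
    · rintro _ ⟨z, hz, rfl⟩
      rw [eq_zero_of_mem_cc b hd hz, map_zero]
      exact zero_mem _
    rw [map_cc_in1_eq h]
    -- The tests for degree 0 precede those for degree `n`, because the corners of 𝔽(1) lie in 𝕃.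
    by_cases h1 : s = 0
    · subst h1
      exact (S.F1_zero_le_LL (by omega)).trans hL
    by_cases h2 : t = 0
    · obtain rfl : s = r + 1 := by omega
      exact (S.F1_succ_le_LL (by omega)).trans hL
    by_cases h3 : s = n
    · subst h3
      exact (S.F1_top_le_Nhat (by omega)).trans hN
    by_cases h4 : t = n
    · obtain rfl : s = r + 1 - n := by omega
      exact (S.F1_sub_le_Nhat (by omega)).trans hN
    exact (S.F1_le_MM (by omega) (by omega) (by omega) (by omega)).trans hM
  · intro s t h
    by_cases hd : 0 ≤ s ∧ s ≤ n ∧ 0 ≤ t ∧ t ≤ n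
    swap
    · rintro _ ⟨z, hz, rfl⟩
      rw [eq_zero_of_mem_ec b hd hz, map_zero]
      exact zero_mem _
    have hs : s = 0 ∨ s = 1 ∨ s = n - 1 ∨ s = n ∨ (2 ≤ s ∧ s ≤ n - 2) := by omega
    rcases hs with h0 | h0 | h0 | h0 | h0
    · rw [map_ec_in2_eq h]
      subst h0
      exact (S.F2_zero_le_Nhat (by omega)).trans hN
    · refine (Submodule.map_mono (S.ec_bot_le b r h0 h)).trans ?_
      rw [Submodule.map_sup]
      refine sup_le (S.botKer_in2_le_MM.trans hM) ?_
      by_cases h1 : 2 ≤ r ∧ r ≤ n + 1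
      · exact (S.botIm_in2_le_Nhat h1).trans hN
      · rw [S.botIm_eq_bot b r h1, Submodule.map_bot]
        exact bot_le
    · refine (Submodule.map_mono (S.ec_top_le b r h0 h)).trans ?_
      rw [Submodule.map_sup]
      refine sup_le (S.topKer_in2_le_MM.trans hM) ?_
      by_cases h1 : n - 1 ≤ r ∧ r ≤ 2 * n - 2
      · exact (S.topIm_in2_le_LL h1).trans hL
      · rw [S.topIm_eq_bot b r h1, Submodule.map_bot]
        exact bot_le
    · rw [map_ec_in2_eq h]
      subst h0
      exact (S.F2_top_le_LL (by omega)).trans hL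
    · rw [map_ec_in2_eq h]
      exact (S.F2_le_MM h0).trans hM
  · intro s t h
    by_cases hd : 0 ≤ s ∧ s ≤ n ∧ 0 ≤ t ∧ t ≤ n
    swap
    · rintro _ ⟨z, hz, rfl⟩
      rw [eq_zero_of_mem_ec b hd hz, map_zero]
      exact zero_mem _
    have hs : s = 0 ∨ s = 1 ∨ s = n - 1 ∨ s = n ∨ (2 ≤ s ∧ s ≤ n - 2) := by omega
    rcases hs with h0 | h0 | h0 | h0 | h0
    · rw [map_ec_in3_eq h]
      subst h0
      -- For 𝔽(3) the extreme values of `r` are separated, since there the piece lies in 𝕄 rather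
      -- than in ℕ̂ or 𝕃.
      by_cases h1 : r = 0
      · exact (S.F3_zero_le_MM h1).trans hM
      · exact (S.F3_zero_le_Nhat (by omega)).trans hN
    · refine (Submodule.map_mono (S.ec_bot_le b r h0 h)).trans ?_
      rw [Submodule.map_sup]
      refine sup_le (S.botKer_in3_le_MM.trans hM) ?_
      by_cases h1 : 2 ≤ r ∧ r ≤ n + 1
      · by_cases h2 : r = 2
        · exact (S.botIm_le_MM h2).trans hM
        · exact (S.botIm_in3_le_Nhat (by omega)).trans hN
      · rw [S.botIm_eq_bot b r h1, Submodule.map_bot]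
        exact bot_le
    · refine (Submodule.map_mono (S.ec_top_le b r h0 h)).trans ?_
      rw [Submodule.map_sup]
      refine sup_le (S.topKer_in3_le_MM.trans hM) ?_
      by_cases h1 : n - 1 ≤ r ∧ r ≤ 2 * n - 2
      · by_cases h2 : r = 2 * n - 2
        · exact (S.topIm_le_MM hn h2).trans hM
        · exact (S.topIm_in3_le_LL (by omega)).trans hL
      · rw [S.topIm_eq_bot b r h1, Submodule.map_bot]
        exact bot_le
    · rw [map_ec_in3_eq h]
      subst h0
      by_cases h1 : r = 2 * n
      · exact (S.F3_top_le_MM hn h1).trans hM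
      · exact (S.F3_top_le_LL (by omega)).trans hL
    · rw [map_ec_in3_eq h]
      exact (S.F3_le_MM h0).trans hM
  · intro s t h
    by_cases hd : 0 ≤ s ∧ s ≤ n ∧ 0 ≤ t ∧ t ≤ n
    swap
    · rintro _ ⟨z, hz, rfl⟩
      rw [eq_zero_of_mem_cc b hd hz, map_zero]
      exact zero_mem _
    rw [map_cc_in4_eq h]
    -- In 𝔽(4) the order of the tests is reversed, because its corners lie in ℕ̂.
    by_cases h1 : s = n
    · subst h1
      exact (S.F4_top_le_Nhat (by omega)).trans hN
    by_cases h2 : t = n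
    · obtain rfl : s = r - 1 - n := by omega
      exact (S.F4_sub_le_Nhat (by omega)).trans hN
    by_cases h3 : s = 0
    · subst h3
      exact (S.F4_zero_le_LL (by omega)).trans hL
    by_cases h4 : t = 0
    · obtain rfl : s = r - 1 := by omega
      exact (S.F4_pred_le_LL (by omega)).trans hL
    exact (S.F4_le_MM (by omega) (by omega) (by omega) (by omega)).trans hM

theorem decomposes : S.Decomposes r :=
  ⟨le_antisymm (S.FF_le_sup b hn r)
    (sup_le (sup_le (S.LL_le_FF b r) (S.MM_le_FF b r)) (S.Nhat_le_FF r)),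
    S.projections_on_LL b hn r, S.projections_on_MM b hn r, S.projections_on_Nhat b hn r⟩

end Decomposition

end Splittings

/-! ### Tensors with a factor in degree 0 or `n`. -/

section RankOne

variable {R : Type u} [CommRing R] {P Q : Type*} [AddCommGroup P] [AddCommGroup Q] [Module R P]
  [Module R Q]

/-- If one factor is generated by a single element, scalars can be moved across the tensor sign, so
every tensor is pure. -/
theorem exists_tmul_of_mem_tens_left {P' : Submodule R P} {Q' : Submodule R Q} {p : P}
    (hp : ∀ x ∈ P', ∃ c : R, x = c • p) {z : P ⊗[R] Q} (hz : z ∈ tens P' Q') :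
    ∃ q ∈ Q', p ⊗ₜ[R] q = z := by
  refine (tens_le (T := Q'.map (TensorProduct.mk R P Q p)) fun x hx q hq => ?_) hz
  obtain ⟨c, rfl⟩ := hp x hx
  exact ⟨c • q, Q'.smul_mem c hq, (TensorProduct.smul_tmul c p q).symm⟩

theorem exists_tmul_of_mem_tens_right {P' : Submodule R P} {Q' : Submodule R Q} {q : Q}
    (hq : ∀ x ∈ Q', ∃ c : R, x = c • q) {z : P ⊗[R] Q} (hz : z ∈ tens P' Q') :
    ∃ p ∈ P', p ⊗ₜ[R] q = z := by
  refine (tens_le (T := P'.map ((TensorProduct.mk R P Q).flip q)) fun p hp x hx => ?_) hz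
  obtain ⟨c, rfl⟩ := hq x hx
  exact ⟨c • p, P'.smul_mem c hp, TensorProduct.smul_tmul c p q⟩

end RankOne

section Generators

variable {R : Type u} [CommRing R] {F : Type v} [AddCommGroup F] [Module R F] {n : ℕ}

theorem aug_one {M : Type*} [AddCommGroup M] [Module R M] :
    aug R M (1 : ExteriorAlgebra R M) = 1 := by
  rw [← map_one (algebraMap R (ExteriorAlgebra R M)), aug_algebraMap]

theorem aug_smul_one {M : Type*} [AddCommGroup M] [Module R M] {x : ExteriorAlgebra R M}
    (hx : x ∈ extPow R M 0) : aug R M x • (1 : ExteriorAlgebra R M) = x := by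
  rw [← Algebra.algebraMap_eq_smul_one, algebraMap_aug hx]

theorem exists_smul_one {M : Type*} [AddCommGroup M] [Module R M] (x : ExteriorAlgebra R M)
    (hx : x ∈ extPow R M 0) : ∃ c : R, x = c • (1 : ExteriorAlgebra R M) :=
  ⟨_, (aug_smul_one hx).symm⟩

/-- Evaluation at `ε` carries top degree to scalars, and evaluation at `η` carries the scalar back
to a multiple of `η`. -/
theorem Data.exists_smul_eta (D : Data R F n) (b : Module.Basis (Fin n) R F) (x : Ex R F)
    (hx : x ∈ extPow R F n) : ∃ c : R, x = c • D.eta := by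
  have h := D.onEps_mem hx
  rw [sub_self] at h
  obtain ⟨c, hc⟩ := exists_smul_one _ h
  refine ⟨c, ?_⟩
  rw [← D.onEta_onEps b x, hc, map_smul, D.onEta_one]

theorem Data.exists_smul_eps (D : Data R F n) (b : Module.Basis (Fin n) R F) (x : Co R F)
    (hx : x ∈ extPow R (Module.Dual R F) n) : ∃ c : R, x = c • D.eps := by
  have h := D.onEta_mem hx
  rw [sub_self] at h
  obtain ⟨c, hc⟩ := exists_smul_one _ h
  refine ⟨c, ?_⟩
  rw [← D.onEps_onEta b x, hc, map_smul, D.onEps_one]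

theorem dropL_one_tmul (β : Co R F) : dropL R F (1 ⊗ₜ[R] β) = β := by
  have h : dropL R F (1 ⊗ₜ[R] β) = aug R (Module.Dual R F) 1 • β := rfl
  rw [h, aug_one, one_smul]

theorem dropR_tmul_one (β : Co R F) : dropR R F (β ⊗ₜ[R] 1) = β := by
  have h : dropR R F (β ⊗ₜ[R] 1) = aug R (Module.Dual R F) 1 • β := rfl
  rw [h, aug_one, one_smul]

theorem Data.topCoeff_eta_tmul (D : Data R F n) (b : Module.Basis (Fin n) R F) (β : Co R F) :
    D.topCoeff (D.eta ⊗ₜ[R] β) = β := by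
  have h : D.topCoeff (D.eta ⊗ₜ[R] β) = aug R F (D.onEta D.eps) • β := rfl
  rw [h, D.onEta_eps b, aug_one, one_smul]

end Generators

/-! ### The values of `τ` on generators of 𝕃. -/

namespace Splittings

variable {R : Type u} [CommRing R] {F : Type v} [AddCommGroup F] [Module R F] {n : ℕ}
  {D : Data R F n} (S : Splittings D)

theorem tau_in1 (r : ℤ) (z : Co R F ⊗[R] Co R F) : S.tau r (in1 R F z) = S.tau1 r z := by
  simp only [tau, LinearMap.add_apply, LinearMap.comp_apply, pr_in1, map_zero, add_zero]

theorem tau_in2 (r : ℤ) (z : Ex R F ⊗[R] Co R F) : S.tau r (in2 R F z) = S.tau2 r z := by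
  simp only [tau, LinearMap.add_apply, LinearMap.comp_apply, pr_in2, map_zero, add_zero, zero_add]

theorem tau_in3 (r : ℤ) (z : Ex R F ⊗[R] Co R F) : S.tau r (in3 R F z) = S.tau3 r z := by
  simp only [tau, LinearMap.add_apply, LinearMap.comp_apply, pr_in3, map_zero, add_zero, zero_add]

theorem tau_in4 (r : ℤ) (z : Co R F ⊗[R] Co R F) : S.tau r (in4 R F z) = S.tau4 r z := by
  simp only [tau, LinearMap.add_apply, LinearMap.comp_apply, pr_in4, map_zero, zero_add]

section TauValues

variable {r : ℤ} {β : Co R F}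

theorem tau_one_tmul_in1 (hr : -1 ≤ r ∧ r ≤ n - 1) (hβ : β ∈ extPow R (Module.Dual R F) (r + 1)) :
    S.tau r (in1 R F (1 ⊗ₜ[R] β)) = (r + 1).negOnePow • in2 R F (1 ⊗ₜ[R] β) := by
  have hz : 1 ⊗ₜ[R] β ∈ cc R F 0 (r + 1) := tmul_mem_tens extPow_one_mem hβ
  rw [tau_in1, tau1, if_pos hr]
  simp only [LinearMap.add_apply, ite_linearMap_apply, LinearMap.smul_apply, LinearMap.comp_apply,
    LinearMap.zero_apply, ccProj_eq_ite hz]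
  rw [if_pos ⟨trivial, trivial⟩, dropL_one_tmul]
  -- The tensor can also be of the form `β ⊗ 1` only when `r = -1`, and there the second part of `τ`
  -- is switched off by its range.
  split_ifs <;> first | omega | skip
  all_goals simp only [map_zero, smul_zero, add_zero]
  all_goals rfl

theorem tau_tmul_one_in1 (hr : 0 ≤ r ∧ r ≤ n - 1) (hβ : β ∈ extPow R (Module.Dual R F) (r + 1)) :
    S.tau r (in1 R F (β ⊗ₜ[R] 1)) = r.negOnePow • in3 R F (1 ⊗ₜ[R] β) := by
  have hz : β ⊗ₜ[R] 1 ∈ cc R F (r + 1) 0 := tmul_mem_tens hβ extPow_one_mem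
  rw [tau_in1, tau1, if_pos hr, if_pos (by omega), LinearMap.add_apply, LinearMap.smul_apply,
    LinearMap.comp_apply, LinearMap.comp_apply, LinearMap.comp_apply, ccProj_eq_ite hz,
    if_neg (by omega), map_zero, map_zero, map_zero, smul_zero, zero_add, LinearMap.smul_apply,
    LinearMap.comp_apply, LinearMap.comp_apply, LinearMap.comp_apply, ccProj_eq_ite hz,
    if_pos ⟨rfl, rfl⟩, dropR_tmul_one]
  rfl

theorem tau_one_tmul_in4 (hr : 1 ≤ r ∧ r ≤ n) (hβ : β ∈ extPow R (Module.Dual R F) (r - 1)) :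
    S.tau r (in4 R F (1 ⊗ₜ[R] β)) = in2 R F (S.ell β) := by
  have hz : 1 ⊗ₜ[R] β ∈ cc R F 0 (r - 1) := tmul_mem_tens extPow_one_mem hβ
  rw [tau_in4, tau4, if_pos hr, LinearMap.sub_apply, LinearMap.comp_apply,
    LinearMap.comp_apply, LinearMap.comp_apply, ccProj_eq_ite hz, if_pos ⟨rfl, rfl⟩, dropL_one_tmul]
  split_ifs with h
  · rw [LinearMap.comp_apply, LinearMap.comp_apply, LinearMap.comp_apply,
      ccProj_eq_ite hz, if_neg (by omega), map_zero, map_zero, map_zero, sub_zero]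
  · rw [LinearMap.zero_apply, sub_zero]

theorem tau_tmul_one_in4 (hr : 2 ≤ r ∧ r ≤ n) (hβ : β ∈ extPow R (Module.Dual R F) (r - 1)) :
    S.tau r (in4 R F (β ⊗ₜ[R] 1)) = -in3 R F (S.ell β) := by
  have hz : β ⊗ₜ[R] 1 ∈ cc R F (r - 1) 0 := tmul_mem_tens hβ extPow_one_mem
  rw [tau_in4, tau4, if_pos hr, if_pos (by omega), LinearMap.sub_apply,
    LinearMap.comp_apply, LinearMap.comp_apply, LinearMap.comp_apply, ccProj_eq_ite hz,
    if_neg (by omega), map_zero, map_zero, map_zero, zero_sub,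
    LinearMap.comp_apply, LinearMap.comp_apply, LinearMap.comp_apply, ccProj_eq_ite hz,
    if_pos ⟨rfl, rfl⟩, dropR_tmul_one]

/-- The bound `n - 1 ≤ r` keeps the index `r + 1 - n` of `λ` away from `-1`, the only index where
`λσ = id` is not assumed. -/
theorem unsigma_sigma (b : Module.Basis (Fin n) R F) (hr : n - 1 ≤ r)
    (hβ : β ∈ extPow R (Module.Dual R F) (r + 2 - n)) : S.unsigma r (D.sigma β) = β := by
  have hz := D.sigma_mem b hβ
  rw [unsigma, LinearMap.comp_apply, ecProj_eq_ite hz, if_pos ⟨rfl, by omega⟩]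
  exact S.lam_sigma (r + 1 - n) (by omega) β (by rwa [(by omega : r + 1 - (n : ℤ) + 1 = r + 2 - n)])

theorem untop_eta_tmul (b : Module.Basis (Fin n) R F)
    (hβ : β ∈ extPow R (Module.Dual R F) (r - n)) : S.untop r (D.eta ⊗ₜ[R] β) = β := by
  have hz : D.eta ⊗ₜ[R] β ∈ ec R F n (r - n) := tmul_mem_tens D.eta_mem hβ
  rw [untop, LinearMap.comp_apply, ecProj_eq_ite hz, if_pos ⟨rfl, rfl⟩, D.topCoeff_eta_tmul b]

theorem untop_sigma (b : Module.Basis (Fin n) R F)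
    (hβ : β ∈ extPow R (Module.Dual R F) (r + 2 - n)) : S.untop r (D.sigma β) = 0 := by
  have hz := D.sigma_mem b hβ
  rw [untop, LinearMap.comp_apply, ecProj_eq_ite hz, if_neg (by omega), map_zero]

theorem unsigma_eta_tmul
    (hβ : β ∈ extPow R (Module.Dual R F) (r - n)) : S.unsigma r (D.eta ⊗ₜ[R] β) = 0 := by
  have hz : D.eta ⊗ₜ[R] β ∈ ec R F n (r - n) := tmul_mem_tens D.eta_mem hβ
  rw [unsigma, LinearMap.comp_apply, ecProj_eq_ite hz, if_neg (by omega), map_zero]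

theorem tau_sigma_in2 (b : Module.Basis (Fin n) R F) (hr : n - 1 ≤ r ∧ r ≤ 2 * n - 2)
    (hβ : β ∈ extPow R (Module.Dual R F) (r + 2 - n)) :
    S.tau r (in2 R F (D.sigma β)) = in1 R F (D.eps ⊗ₜ[R] β) +
      if r = n - 1 then (n : ℤ).negOnePow •
        aug R (Module.Dual R F) (D.vAct β) • in3 R F (1 ⊗ₜ[R] D.eps) else 0 := by
  rw [tau_in2, tau2, if_pos hr]
  simp only [LinearMap.add_apply, ite_linearMap_apply, LinearMap.comp_apply, LinearMap.smul_apply,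
    LinearMap.smulRight_apply, LinearMap.zero_apply, S.unsigma_sigma b hr.1 hβ,
    S.untop_sigma b hβ, map_zero, zero_smul, smul_zero, ite_self, add_zero]
  rfl

theorem tau_sigma_in3 (b : Module.Basis (Fin n) R F) (hr : n - 1 ≤ r ∧ r ≤ 2 * n - 3)
    (hβ : β ∈ extPow R (Module.Dual R F) (r + 2 - n)) :
    S.tau r (in3 R F (D.sigma β)) = in1 R F (β ⊗ₜ[R] D.eps) -
      if r = n - 1 then aug R (Module.Dual R F) (D.uAct β) • in2 R F (1 ⊗ₜ[R] D.eps) else 0 := by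
  rw [tau_in3, tau3, if_pos hr]
  simp only [LinearMap.add_apply, LinearMap.sub_apply, ite_linearMap_apply, LinearMap.comp_apply,
    LinearMap.smul_apply,
    LinearMap.smulRight_apply, LinearMap.zero_apply, S.unsigma_sigma b hr.1 hβ,
    S.untop_sigma b hβ, map_zero, zero_smul, smul_zero, ite_self, add_zero]
  rfl

theorem tau_eta_tmul_in2 (b : Module.Basis (Fin n) R F) (hr : n ≤ r ∧ r ≤ 2 * n)
    (hβ : β ∈ extPow R (Module.Dual R F) (r - n)) :
    S.tau r (in2 R F (D.eta ⊗ₜ[R] β)) = (r + 1).negOnePow • in4 R F (D.eps ⊗ₜ[R] β) +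
      if r = n then aug R (Module.Dual R F) β • in3 R F (S.ell (D.uAct D.eps)) else 0 := by
  rw [tau_in2, tau2, if_pos hr]
  simp only [LinearMap.add_apply, ite_linearMap_apply, LinearMap.comp_apply, LinearMap.smul_apply,
    LinearMap.smulRight_apply, LinearMap.zero_apply, S.unsigma_eta_tmul hβ,
    S.untop_eta_tmul b hβ, map_zero, zero_smul, smul_zero, ite_self, add_zero, zero_add]
  rfl

theorem tau_eta_tmul_in3 (b : Module.Basis (Fin n) R F) (hr : n ≤ r ∧ r ≤ 2 * n - 1)
    (hβ : β ∈ extPow R (Module.Dual R F) (r - n)) :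
    S.tau r (in3 R F (D.eta ⊗ₜ[R] β)) = (r + 1).negOnePow • in4 R F (β ⊗ₜ[R] D.eps) +
      if r = n then (n : ℤ).negOnePow •
        aug R (Module.Dual R F) β • in2 R F (S.ell (D.vAct D.eps)) else 0 := by
  rw [tau_in3, tau3, if_pos hr]
  simp only [LinearMap.add_apply, LinearMap.sub_apply, ite_linearMap_apply, LinearMap.comp_apply,
    LinearMap.smul_apply,
    LinearMap.smulRight_apply, LinearMap.zero_apply, S.unsigma_eta_tmul hβ,
    S.untop_eta_tmul b hβ, map_zero, zero_smul, ite_self, zero_add, sub_zero]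
  rfl

end TauValues

end Splittings

/-! ### The 𝕃-component of `f` on generators of ℕ̂. -/

namespace Splittings

variable {R : Type u} [CommRing R] {F : Type v} [AddCommGroup F] [Module R F] {n : ℕ}
  {D : Data R F n} (S : Splittings D)

open Data

section Components

variable (r : ℤ)

theorem map_units_smul (c : ℤˣ) {V W : Type*} [AddCommGroup V] [Module R V] [AddCommGroup W]
    [Module R W] (g : V →ₗ[R] W) (x : V) : g (c • x) = c • g x := by
  obtain rfl | rfl := Int.units_eq_one_or c
  · rw [one_smul, one_smul]
  · rw [Units.neg_smul, Units.neg_smul, one_smul, one_smul, map_neg]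

theorem f_in1 (z : Co R F ⊗[R] Co R F) : D.f r (in1 R F z) = in1 R F (contR D.v z) +
    r.negOnePow • in1 R F (contL D.u z) + in2 R F (D.gat D.X.flip z) +
      in3 R F (D.gat D.X (swap z)) := by
  have h : D.f1 r z = in1 R F (contR D.v z + r.negOnePow • contL D.u z) +
    in2 R F (D.gat D.X.flip z) + in3 R F (D.gat D.X (swap z)) := rfl
  simp only [Data.f, LinearMap.add_apply, LinearMap.comp_apply, pr_in1, map_zero, add_zero]
  rw [h, map_add, map_units_smul]

theorem f_in2 (z : Ex R F ⊗[R] Co R F) : D.f r (in2 R F z) = r.negOnePow • in1 R F (mapL D.X z) +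
    in2 R F (conER D.v z) - r.negOnePow • in2 R F (conEL (D.X.flip D.u) z) +
      in4 R F (sca D.X z) := by
  have h : D.f2 r z = in1 R F (r.negOnePow • mapL D.X z) +
    in2 R F (conER D.v z + (r + 1).negOnePow • conEL (D.X.flip D.u) z) +
      in4 R F (sca D.X z) := rfl
  simp only [Data.f, LinearMap.add_apply, LinearMap.comp_apply, pr_in2, map_zero, add_zero,
    zero_add]
  rw [h, map_add, map_units_smul, map_units_smul, Int.negOnePow_succ, Units.neg_smul]
  abel

theorem f_in3 (z : Ex R F ⊗[R] Co R F) :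
    D.f r (in3 R F z) = -r.negOnePow • in1 R F (swap (mapL D.X.flip z)) -
      r.negOnePow • in3 R F (conER D.u z) + in3 R F (conEL (D.X D.v) z) -
      in4 R F (swap (sca D.X.flip z)) := by
  have h : D.f3 r z = in1 R F ((r + 1).negOnePow • swap (mapL D.X.flip z)) +
    in3 R F ((r + 1).negOnePow • conER D.u z + conEL (D.X D.v) z) -
      in4 R F (swap (sca D.X.flip z)) := rfl
  simp only [Data.f, LinearMap.add_apply, LinearMap.comp_apply, pr_in3, map_zero, add_zero,
    zero_add]
  rw [h, map_add, map_units_smul, map_units_smul, Int.negOnePow_succ, Units.neg_smul,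
    Units.neg_smul]
  abel

theorem f_in4 (z : Co R F ⊗[R] Co R F) :
    D.f r (in4 R F z) = r.negOnePow • in2 R F (D.cofL D.X.flip z) +
      r.negOnePow • in3 R F (D.cofL D.X (swap z)) + in4 R F (contR D.v z) +
      r.negOnePow • in4 R F (contL D.u z) := by
  have h : D.f4 r z = in2 R F (r.negOnePow • D.cofL D.X.flip z) +
    in3 R F (r.negOnePow • D.cofL D.X (swap z)) +
      in4 R F (contR D.v z + r.negOnePow • contL D.u z) := rfl
  simp only [Data.f, LinearMap.add_apply, LinearMap.comp_apply, pr_in4, map_zero, zero_add]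
  rw [h, map_add, map_units_smul, map_units_smul, map_units_smul, ← add_assoc]

end Components

section Bidegrees

variable {s t : ℤ}

theorem mapL_mem (Z : F →ₗ[R] Module.Dual R F) {z : Ex R F ⊗[R] Co R F} (hz : z ∈ ec R F s t) :
    mapL Z z ∈ cc R F s t :=
  (tens_le (T := (cc R F s t).comap (mapL Z)) fun _ hp _ hq =>
    tmul_mem_tens (extPow_map_mem Z hp) hq) hz

theorem swap_mem {z : Co R F ⊗[R] Co R F} (hz : z ∈ cc R F s t) : swap z ∈ cc R F t s :=
  (tens_le (T := (cc R F t s).comap swap) fun _ hp _ hq => tmul_mem_tens hq hp) hz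

theorem conER_mem (w : F) {z : Ex R F ⊗[R] Co R F} (hz : z ∈ ec R F s t) :
    conER w z ∈ ec R F s (t - 1) :=
  (tens_le (T := (ec R F s (t - 1)).comap (conER w)) fun _ hp _ hq =>
    tmul_mem_tens hp (contr_ι_mem _ _ hq)) hz

theorem conEL_mem (w : Module.Dual R F) {z : Ex R F ⊗[R] Co R F} (hz : z ∈ ec R F s t) :
    conEL w z ∈ ec R F (s - 1) t :=
  (tens_le (T := (ec R F (s - 1) t).comap (conEL w)) fun _ hp _ hq =>
    tmul_mem_tens (contr_ι_mem _ _ hp) hq) hz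

theorem gat_tmul_mem (b : Module.Basis (Fin n) R F) (Z : F →ₗ[R] Module.Dual R F) {α β : Co R F}
    (hα : α ∈ extPow R (Module.Dual R F) s) (hβ : β ∈ extPow R (Module.Dual R F) t) :
    D.gat Z (α ⊗ₜ[R] β) ∈ ec R F (s - 1) (t - 1) := by
  rw [gat, D.gather_tmul b]
  exact sum_mem fun i _ => tmul_mem_tens (contr_ι_mem _ _ (D.cof_mem Z hα)) (contr_ι_mem _ _ hβ)

/-- Because `cof Z ε = η`, the map `Z` disappears and `gather` becomes `σ`. This is the leading term
of `f` on `ε ⊗ β` in 𝔽(1). -/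
theorem gat_eps_tmul (b : Module.Basis (Fin n) R F) (Z : F →ₗ[R] Module.Dual R F) (β : Co R F) :
    D.gat Z (D.eps ⊗ₜ[R] β) = D.sigma β := by
  rw [gat, D.gather_tmul b, D.cof_eps b, D.sigma_apply b]

theorem sca_one_tmul (b : Module.Basis (Fin n) R F) (Z : F →ₗ[R] Module.Dual R F) (β : Co R F) :
    sca Z (1 ⊗ₜ[R] β) = 0 := by
  rw [sca, scatter_tmul b]
  refine Finset.sum_eq_zero fun i _ => ?_
  have : conD b i 1 = 0 := contr_ι_one _ _
  rw [this, map_zero, TensorProduct.zero_tmul]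

/-- Contracting a vector with the dual basis leaves scalars, on which `⋀Z` is the identity, and the
sum reassembles the vector. Thus `f` undoes `ℓ` by means of `μ`. -/
theorem sca_of_mem_ec_one (b : Module.Basis (Fin n) R F) (Z : F →ₗ[R] Module.Dual R F)
    {z : Ex R F ⊗[R] Co R F} (hz : z ∈ ec R F 1 t) : sca Z z = 1 ⊗ₜ[R] mu R F z := by
  refine (tens_le (T := LinearMap.eqLocus (sca Z)
    (TensorProduct.mk R (Co R F) (Co R F) 1 ∘ₗ mu R F)) fun p hp β _ => ?_) hz
  have hp : p ∈ ⋀[R]^1 F := hp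
  rw [ExteriorAlgebra.exteriorPower, pow_one] at hp
  obtain ⟨m, rfl⟩ := hp
  have h1 : (TensorProduct.mk R (Co R F) (Co R F) 1 ∘ₗ mu R F) (ExteriorAlgebra.ι R m ⊗ₜ[R] β) =
    1 ⊗ₜ[R] actF (ExteriorAlgebra.ι R m) β := rfl
  have h2 : ∀ i, ExteriorAlgebra.map Z (conD b i (ExteriorAlgebra.ι R m)) =
      b.coord i m • (1 : Co R F) := fun i => by
    rw [conD, actD, contr_ι_ι, AlgHom.commutes, Algebra.algebraMap_eq_smul_one, LinearMap.id_apply]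
  rw [LinearMap.mem_eqLocus, sca, scatter_tmul b, h1]
  conv_rhs => rw [← basis_expansion b m]
  simp_rw [h2, TensorProduct.smul_tmul, map_sum, map_smul, LinearMap.sum_apply,
    TensorProduct.tmul_sum]
  rfl

variable {r : ℤ}

/-- A vanishing criterion for the side terms of `f`. The alternative `t = n` is allowed because `λ`
then maps into degree `n + 1`; the version for 𝔽(3) also uses its exceptional values of `r`. -/
theorem piL_in2_eq_zero (b : Module.Basis (Fin n) R F) (h : s + t = r) {z : Ex R F ⊗[R] Co R F}
    (hz : z ∈ ec R F s t) (hs : s ≠ n - 1 ∨ t = n) (hs' : s ≠ n) : S.piL r (in2 R F z) = 0 := by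
  rw [S.piL_in2 b h hz, if_neg hs']
  split_ifs with h1
  · subst h1
    rw [eq_zero_of_mem_extPow b.dualBasis (by omega) (S.lam_mem _ _ hz), map_zero, map_zero]
  · rfl

theorem piL_in3_eq_zero (b : Module.Basis (Fin n) R F) (hn : 3 ≤ n) (h : s + t = r)
    {z : Ex R F ⊗[R] Co R F} (hz : z ∈ ec R F s t) (hs : s ≠ n - 1 ∨ t = n ∨ r = 2 * n - 2)
    (hs' : s ≠ n ∨ r = 2 * n) : S.piL r (in3 R F z) = 0 := by
  rw [S.piL_in3 b hn h hz, if_neg (c := s = n ∧ _) (by omega)]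
  split_ifs with h1
  · obtain ⟨rfl, h1⟩ := h1
    rw [eq_zero_of_mem_extPow b.dualBasis (by omega) (S.lam_mem _ _ hz), map_zero, map_zero]
  · rfl

variable {β : Co R F}

theorem piL_f_one_tmul_in2 (b : Module.Basis (Fin n) R F)
    (hn : 3 ≤ n) (hβ : β ∈ extPow R (Module.Dual R F) (r + 1)) :
    S.piL r (D.f (r + 1) (in2 R F (1 ⊗ₜ[R] β))) =
      (r + 1).negOnePow • in1 R F (1 ⊗ₜ[R] β) := by
  have h0 : (1 : Ex R F) ⊗ₜ[R] β ∈ ec R F 0 (r + 1) := tmul_mem_tens extPow_one_mem hβ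
  have e1 : mapL D.X (1 ⊗ₜ[R] β) = 1 ⊗ₜ[R] β := by
    rw [mapL, LinearMap.rTensor_tmul, AlgHom.toLinearMap_apply, map_one]
  have e2 : conEL (D.X.flip D.u) (1 ⊗ₜ[R] β) = 0 := by
    rw [conEL, LinearMap.rTensor_tmul, actD, contr_ι_one, TensorProduct.zero_tmul]
  have h1 : (1 : Co R F) ⊗ₜ[R] β ∈ cc R F 0 (r + 1) := tmul_mem_tens extPow_one_mem hβ
  rw [f_in2, e1, e2, sca_one_tmul b, map_zero, map_zero, smul_zero, add_zero, sub_zero, map_add,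
    map_units_smul, S.piL_in1 b (by omega) h1, if_pos (by omega),
    S.piL_in2_eq_zero b (by omega) (conER_mem D.v h0) (by omega) (by omega), add_zero]

theorem piL_f_one_tmul_in3 (b : Module.Basis (Fin n) R F)
    (hn : 3 ≤ n) (hβ : β ∈ extPow R (Module.Dual R F) (r + 1)) :
    S.piL r (D.f (r + 1) (in3 R F (1 ⊗ₜ[R] β))) =
      -(r + 1).negOnePow • in1 R F (β ⊗ₜ[R] 1) := by
  have h0 : (1 : Ex R F) ⊗ₜ[R] β ∈ ec R F 0 (r + 1) := tmul_mem_tens extPow_one_mem hβ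
  have e1 : swap (mapL D.X.flip (1 ⊗ₜ[R] β)) = β ⊗ₜ[R] 1 := by
    rw [mapL, LinearMap.rTensor_tmul, AlgHom.toLinearMap_apply, map_one]
    rfl
  have e2 : conEL (D.X D.v) (1 ⊗ₜ[R] β) = 0 := by
    rw [conEL, LinearMap.rTensor_tmul, actD, contr_ι_one, TensorProduct.zero_tmul]
  have h1 : β ⊗ₜ[R] (1 : Co R F) ∈ cc R F (r + 1) 0 := tmul_mem_tens hβ extPow_one_mem
  rw [f_in3, e1, e2, sca_one_tmul b, map_zero, map_zero, map_zero, add_zero, sub_zero, map_sub,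
    map_units_smul, map_units_smul, S.piL_in1 b (by omega) h1, if_pos (by omega),
    S.piL_in3_eq_zero b hn (by omega) (conER_mem D.u h0) (by omega) (by omega), smul_zero,
    sub_zero]

/-- Only the component in 𝔽(4) counts: the side terms have left degree 0 or 1 in 𝔽(2), where 𝕃 has
only left degrees `n - 1` and `n`, or bidegree `(1, r)` with `r ≥ 1` in 𝔽(1). -/
theorem piL_f_ell_in2 (b : Module.Basis (Fin n) R F) (hn : 3 ≤ n) (hr : 1 ≤ r ∧ r ≤ n)
    (hβ : β ∈ extPow R (Module.Dual R F) (r - 1)) :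
    S.piL r (D.f (r + 1) (in2 R F (S.ell β))) = in4 R F (1 ⊗ₜ[R] β) := by
  have h0 := S.ell_mem _ _ hβ
  have h1 : (1 : Co R F) ⊗ₜ[R] β ∈ cc R F 0 (r - 1) := tmul_mem_tens extPow_one_mem hβ
  rw [f_in2, sca_of_mem_ec_one b _ h0, S.mu_ell _ (by omega) _ hβ, map_add, map_sub, map_add,
    map_units_smul, map_units_smul, S.piL_in1 b (by omega) (mapL_mem D.X h0), if_neg (by omega),
    S.piL_in2_eq_zero b (by omega) (conER_mem D.v h0) (by omega) (by omega),
    S.piL_in2_eq_zero b (by omega) (conEL_mem (D.X.flip D.u) h0) (by omega) (by omega),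
    S.piL_in4 b (by omega) h1, if_pos (by omega), smul_zero, add_zero, sub_zero, zero_add]

theorem piL_f_ell_in3 (b : Module.Basis (Fin n) R F) (hn : 3 ≤ n) (hr : 2 ≤ r ∧ r ≤ n)
    (hβ : β ∈ extPow R (Module.Dual R F) (r - 1)) :
    S.piL r (D.f (r + 1) (in3 R F (S.ell β))) = -in4 R F (β ⊗ₜ[R] 1) := by
  have h0 := S.ell_mem _ _ hβ
  have h1 : β ⊗ₜ[R] (1 : Co R F) ∈ cc R F (r - 1) 0 := tmul_mem_tens hβ extPow_one_mem
  have e1 : swap (1 ⊗ₜ[R] β) = β ⊗ₜ[R] (1 : Co R F) := rfl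
  rw [f_in3, sca_of_mem_ec_one b _ h0, S.mu_ell _ (by omega) _ hβ, e1, map_sub, map_add, map_sub,
    map_units_smul, map_units_smul, S.piL_in1 b (by omega) (swap_mem (mapL_mem D.X.flip h0)),
    if_neg (by omega),
    S.piL_in3_eq_zero b hn (by omega) (conER_mem D.u h0) (by omega) (by omega),
    S.piL_in3_eq_zero b hn (by omega) (conEL_mem (D.X D.v) h0) (by omega) (by omega),
    S.piL_in4 b (by omega) h1, if_pos (by omega), smul_zero, smul_zero, add_zero, sub_zero,
    zero_sub]

/-- For `r = n - 1` the element `β` has degree one, so `v(β)` is a scalar and `ε ⊗ v(β)` falls into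
the corner of 𝔽(1) that belongs to 𝕃. For `r = 2n - 2` the term in 𝔽(3) has left degree `n - 1`, and
it drops out because that piece was assigned to 𝕄. -/
theorem piL_f_eps_tmul_in1 (b : Module.Basis (Fin n) R F) (hn : 3 ≤ n)
    (hr : n - 1 ≤ r ∧ r ≤ 2 * n - 2) (hβ : β ∈ extPow R (Module.Dual R F) (r + 2 - n)) :
    S.piL r (D.f (r + 1) (in1 R F (D.eps ⊗ₜ[R] β))) = in2 R F (D.sigma β) +
      if r = n - 1 then in1 R F (D.eps ⊗ₜ[R] D.vAct β) else 0 := by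
  have h1 : contR D.v (D.eps ⊗ₜ[R] β) ∈ cc R F n (r + 2 - n - 1) :=
    tmul_mem_tens D.eps_mem (contr_ι_mem _ _ hβ)
  have h2 : contL D.u (D.eps ⊗ₜ[R] β) ∈ cc R F (n - 1) (r + 2 - n) :=
    tmul_mem_tens (contr_ι_mem _ _ D.eps_mem) hβ
  have h3 : D.gat D.X (swap (D.eps ⊗ₜ[R] β)) ∈ ec R F (r + 2 - n - 1) (n - 1) :=
    gat_tmul_mem b D.X hβ D.eps_mem
  have h4 := D.sigma_mem b hβ
  have e1 : contR D.v (D.eps ⊗ₜ[R] β) = D.eps ⊗ₜ[R] D.vAct β := rfl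
  have p1 : S.piL r (in1 R F (contR D.v (D.eps ⊗ₜ[R] β))) =
      if r = n - 1 then in1 R F (D.eps ⊗ₜ[R] D.vAct β) else 0 := by
    rw [S.piL_in1 b (by omega) h1, e1]
    split_ifs <;> first | omega | rfl
  have p2 := (S.piL_in1 b (by omega : _ = r + 1) h2).trans (if_neg (by omega))
  have p4 := (S.piL_in2 b (by omega : _ = r) h4).trans (if_pos rfl)
  rw [f_in1, gat_eps_tmul b, map_add, map_add, map_add, map_units_smul, p1, p2, p4,
    S.sigma_lam_sigma b hβ, S.piL_in3_eq_zero b hn (by omega) h3 (by omega) (by omega),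
    smul_zero, add_zero, add_zero, add_comm]

theorem piL_f_tmul_eps_in1 (b : Module.Basis (Fin n) R F) (hn : 3 ≤ n)
    (hr : n - 1 ≤ r ∧ r ≤ 2 * n - 3) (hβ : β ∈ extPow R (Module.Dual R F) (r + 2 - n)) :
    S.piL r (D.f (r + 1) (in1 R F (β ⊗ₜ[R] D.eps))) = in3 R F (D.sigma β) +
      (r + 1).negOnePow • if r = n - 1 then in1 R F (D.uAct β ⊗ₜ[R] D.eps) else 0 := by
  have h1 : contR D.v (β ⊗ₜ[R] D.eps) ∈ cc R F (r + 2 - n) (n - 1) :=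
    tmul_mem_tens hβ (contr_ι_mem _ _ D.eps_mem)
  have h2 : contL D.u (β ⊗ₜ[R] D.eps) ∈ cc R F (r + 2 - n - 1) n :=
    tmul_mem_tens (contr_ι_mem _ _ hβ) D.eps_mem
  have h3 : D.gat D.X.flip (β ⊗ₜ[R] D.eps) ∈ ec R F (r + 2 - n - 1) (n - 1) :=
    gat_tmul_mem b D.X.flip hβ D.eps_mem
  have h4 := D.sigma_mem b hβ
  have e1 : contL D.u (β ⊗ₜ[R] D.eps) = D.uAct β ⊗ₜ[R] D.eps := rfl
  have e2 : swap (β ⊗ₜ[R] D.eps) = D.eps ⊗ₜ[R] β := rfl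
  have p1 := (S.piL_in1 b (by omega : _ = r + 1) h1).trans (if_neg (by omega))
  have p2 : S.piL r (in1 R F (contL D.u (β ⊗ₜ[R] D.eps))) =
      if r = n - 1 then in1 R F (D.uAct β ⊗ₜ[R] D.eps) else 0 := by
    rw [S.piL_in1 b (by omega) h2, e1]
    split_ifs <;> first | omega | rfl
  have p4 := (S.piL_in3 b hn (by omega : _ = r) h4).trans (if_pos (by omega))
  rw [f_in1, e2, gat_eps_tmul b, map_add, map_add, map_add, map_units_smul, p1, p2, p4,
    S.sigma_lam_sigma b hβ, S.piL_in2_eq_zero b (by omega) h3 (by omega) (by omega), zero_add,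
    add_zero, add_comm]

/-- For `r = n` the element `β` is a scalar, so `u(ε) ⊗ β` has right degree 0 and belongs to 𝕃. For
`r = 2n` the term in 𝔽(3) is a multiple of `η ⊗ ε`, which lies in 𝕄. -/
theorem piL_f_eps_tmul_in4 (b : Module.Basis (Fin n) R F) (hn : 3 ≤ n)
    (hr : n ≤ r ∧ r ≤ 2 * n) (hβ : β ∈ extPow R (Module.Dual R F) (r - n)) :
    S.piL r (D.f (r + 1) (in4 R F (D.eps ⊗ₜ[R] β))) = (r + 1).negOnePow •
      (in2 R F (D.eta ⊗ₜ[R] β) + if r = n then in4 R F (D.uAct D.eps ⊗ₜ[R] β) else 0) := by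
  have h1 : contR D.v (D.eps ⊗ₜ[R] β) ∈ cc R F n (r - n - 1) :=
    tmul_mem_tens D.eps_mem (contr_ι_mem _ _ hβ)
  have h2 : contL D.u (D.eps ⊗ₜ[R] β) ∈ cc R F (n - 1) (r - n) :=
    tmul_mem_tens (contr_ι_mem _ _ D.eps_mem) hβ
  have h3 : D.cofL D.X (swap (D.eps ⊗ₜ[R] β)) ∈ ec R F (r - n) n :=
    tmul_mem_tens (D.cof_mem D.X hβ) D.eps_mem
  have h4 : D.eta ⊗ₜ[R] β ∈ ec R F n (r - n) := tmul_mem_tens D.eta_mem hβ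
  have e1 : contL D.u (D.eps ⊗ₜ[R] β) = D.uAct D.eps ⊗ₜ[R] β := rfl
  have e2 : D.cofL D.X.flip (D.eps ⊗ₜ[R] β) = D.eta ⊗ₜ[R] β := by
    rw [cofL, LinearMap.rTensor_tmul, D.cof_eps b]
  have p1 := (S.piL_in4 b (by omega : _ = r - 1) h1).trans (if_neg (by omega))
  have p2 : S.piL r (in4 R F (contL D.u (D.eps ⊗ₜ[R] β))) =
      if r = n then in4 R F (D.uAct D.eps ⊗ₜ[R] β) else 0 := by
    rw [S.piL_in4 b (by omega) h2, e1]
    split_ifs <;> first | omega | rfl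
  have p4 := ((S.piL_in2 b (by omega : _ = r) h4).trans (if_neg (by omega))).trans (if_pos rfl)
  rw [f_in4, e2, map_add, map_add, map_add, map_units_smul, map_units_smul, map_units_smul,
    p1, p2, p4, S.piL_in3_eq_zero b hn (by omega) h3 (by omega) (by omega), smul_zero, add_zero,
    add_zero, ← smul_add]

theorem piL_f_tmul_eps_in4 (b : Module.Basis (Fin n) R F) (hn : 3 ≤ n)
    (hr : n ≤ r ∧ r ≤ 2 * n - 1) (hβ : β ∈ extPow R (Module.Dual R F) (r - n)) :
    S.piL r (D.f (r + 1) (in4 R F (β ⊗ₜ[R] D.eps))) = (r + 1).negOnePow •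
      in3 R F (D.eta ⊗ₜ[R] β) + if r = n then in4 R F (β ⊗ₜ[R] D.vAct D.eps) else 0 := by
  have h1 : contR D.v (β ⊗ₜ[R] D.eps) ∈ cc R F (r - n) (n - 1) :=
    tmul_mem_tens hβ (contr_ι_mem _ _ D.eps_mem)
  have h2 : contL D.u (β ⊗ₜ[R] D.eps) ∈ cc R F (r - n - 1) n :=
    tmul_mem_tens (contr_ι_mem _ _ hβ) D.eps_mem
  have h3 : D.cofL D.X.flip (β ⊗ₜ[R] D.eps) ∈ ec R F (r - n) n :=
    tmul_mem_tens (D.cof_mem D.X.flip hβ) D.eps_mem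
  have h4 : D.eta ⊗ₜ[R] β ∈ ec R F n (r - n) := tmul_mem_tens D.eta_mem hβ
  have e1 : contR D.v (β ⊗ₜ[R] D.eps) = β ⊗ₜ[R] D.vAct D.eps := rfl
  have e2 : D.cofL D.X (swap (β ⊗ₜ[R] D.eps)) = D.eta ⊗ₜ[R] β := by
    have e3 : swap (β ⊗ₜ[R] D.eps) = D.eps ⊗ₜ[R] β := rfl
    rw [e3, cofL, LinearMap.rTensor_tmul, D.cof_eps b]
  have p1 : S.piL r (in4 R F (contR D.v (β ⊗ₜ[R] D.eps))) =
      if r = n then in4 R F (β ⊗ₜ[R] D.vAct D.eps) else 0 := by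
    rw [S.piL_in4 b (by omega) h1, e1]
    split_ifs <;> first | omega | rfl
  have p2 := (S.piL_in4 b (by omega : _ = r - 1) h2).trans (if_neg (by omega))
  have p4 := ((S.piL_in3 b hn (by omega : _ = r) h4).trans (if_neg (by omega))).trans
    (if_pos (by omega))
  rw [f_in4, e2, map_add, map_add, map_add, map_units_smul, map_units_smul, map_units_smul,
    p1, p2, p4, S.piL_in2_eq_zero b (by omega) h3 (by omega) (by omega), smul_zero, zero_add,
    add_zero]

end Bidegrees

end Splittings

/-! ### The map `τ` as an inverse of the 𝕃-component of `f`. -/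

namespace Splittings

variable {R : Type u} [CommRing R] {F : Type v} [AddCommGroup F] [Module R F] {n : ℕ}
  {D : Data R F n} (S : Splittings D)

open Data

section Homotopy

variable (b : Module.Basis (Fin n) R F) (r : ℤ)

theorem uAct_mem (D : Data R F n) {s : ℤ} {β : Co R F} (hβ : β ∈ extPow R (Module.Dual R F) s) :
    D.uAct β ∈ extPow R (Module.Dual R F) (s - 1) := contr_ι_mem _ _ hβ

theorem vAct_mem (D : Data R F n) {s : ℤ} {β : Co R F} (hβ : β ∈ extPow R (Module.Dual R F) s) :
    D.vAct β ∈ extPow R (Module.Dual R F) (s - 1) := contr_ι_mem _ _ hβ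

include b in
/-- A submodule that contains the elements on which `τ_r` is defined contains `𝕃_r`. -/
theorem LL_le_of_generators {T : Submodule R (Tot R F)}
    (h1 : -1 ≤ r ∧ r ≤ n - 1 → ∀ β ∈ extPow R (Module.Dual R F) (r + 1),
      in1 R F (1 ⊗ₜ[R] β) ∈ T)
    (h2 : 0 ≤ r ∧ r ≤ n - 1 → ∀ β ∈ extPow R (Module.Dual R F) (r + 1),
      in1 R F (β ⊗ₜ[R] 1) ∈ T)
    (h3 : n - 1 ≤ r ∧ r ≤ 2 * n - 2 → ∀ β ∈ extPow R (Module.Dual R F) (r + 2 - n),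
      in2 R F (D.sigma β) ∈ T)
    (h4 : n ≤ r ∧ r ≤ 2 * n → ∀ β ∈ extPow R (Module.Dual R F) (r - n),
      in2 R F (D.eta ⊗ₜ[R] β) ∈ T)
    (h5 : n - 1 ≤ r ∧ r ≤ 2 * n - 3 → ∀ β ∈ extPow R (Module.Dual R F) (r + 2 - n),
      in3 R F (D.sigma β) ∈ T)
    (h6 : n ≤ r ∧ r ≤ 2 * n - 1 → ∀ β ∈ extPow R (Module.Dual R F) (r - n),
      in3 R F (D.eta ⊗ₜ[R] β) ∈ T)
    (h7 : 1 ≤ r ∧ r ≤ n → ∀ β ∈ extPow R (Module.Dual R F) (r - 1),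
      in4 R F (1 ⊗ₜ[R] β) ∈ T)
    (h8 : 2 ≤ r ∧ r ≤ n → ∀ β ∈ extPow R (Module.Dual R F) (r - 1),
      in4 R F (β ⊗ₜ[R] 1) ∈ T) : S.LL r ≤ T := by
  refine LL_le ?_ ?_ ?_ ?_ ?_ ?_ ?_ ?_
  · rintro h _ ⟨z, hz, rfl⟩
    obtain ⟨β, hβ, rfl⟩ := exists_tmul_of_mem_tens_left exists_smul_one hz
    exact h1 h β (by rwa [sub_zero] at hβ)
  · rintro h _ ⟨z, hz, rfl⟩
    rw [SetLike.mem_coe, sub_self] at hz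
    obtain ⟨β, hβ, rfl⟩ := exists_tmul_of_mem_tens_right exists_smul_one hz
    exact h2 h β hβ
  · rintro h _ ⟨_, ⟨β, hβ, rfl⟩, rfl⟩
    exact h3 h β hβ
  · rintro h _ ⟨z, hz, rfl⟩
    obtain ⟨β, hβ, rfl⟩ := exists_tmul_of_mem_tens_left (D.exists_smul_eta b) hz
    exact h4 h β hβ
  · rintro h _ ⟨_, ⟨β, hβ, rfl⟩, rfl⟩
    exact h5 h β hβ
  · rintro h _ ⟨z, hz, rfl⟩
    obtain ⟨β, hβ, rfl⟩ := exists_tmul_of_mem_tens_left (D.exists_smul_eta b) hz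
    exact h6 h β hβ
  · rintro h _ ⟨z, hz, rfl⟩
    obtain ⟨β, hβ, rfl⟩ := exists_tmul_of_mem_tens_left exists_smul_one hz
    exact h7 h β (by rwa [sub_zero] at hβ)
  · rintro h _ ⟨z, hz, rfl⟩
    rw [SetLike.mem_coe, sub_self] at hz
    obtain ⟨β, hβ, rfl⟩ := exists_tmul_of_mem_tens_right exists_smul_one hz
    exact h8 h β hβ

theorem in1_tmul_mem {s t : ℤ} (h : s + t = r + 1) {α β : Co R F}
    (hα : α ∈ extPow R (Module.Dual R F) s) (hβ : β ∈ extPow R (Module.Dual R F) t) :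
    in1 R F (α ⊗ₜ[R] β) ∈ F1 R F r s := by
  rw [← map_cc_in1_eq h]
  exact Submodule.mem_map_of_mem (tmul_mem_tens hα hβ)

theorem in2_tmul_mem {s t : ℤ} (h : s + t = r) {α : Ex R F} {β : Co R F}
    (hα : α ∈ extPow R F s) (hβ : β ∈ extPow R (Module.Dual R F) t) :
    in2 R F (α ⊗ₜ[R] β) ∈ F2 R F r s := by
  rw [← map_ec_in2_eq h]
  exact Submodule.mem_map_of_mem (tmul_mem_tens hα hβ)

theorem in3_tmul_mem {s t : ℤ} (h : s + t = r) {α : Ex R F} {β : Co R F}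
    (hα : α ∈ extPow R F s) (hβ : β ∈ extPow R (Module.Dual R F) t) :
    in3 R F (α ⊗ₜ[R] β) ∈ F3 R F r s := by
  rw [← map_ec_in3_eq h]
  exact Submodule.mem_map_of_mem (tmul_mem_tens hα hβ)

theorem in4_tmul_mem {s t : ℤ} (h : s + t = r - 1) {α β : Co R F}
    (hα : α ∈ extPow R (Module.Dual R F) s) (hβ : β ∈ extPow R (Module.Dual R F) t) :
    in4 R F (α ⊗ₜ[R] β) ∈ F4 R F r s := by
  rw [← map_cc_in4_eq h]
  exact Submodule.mem_map_of_mem (tmul_mem_tens hα hβ)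

theorem map_ell_mem_botIm {s : ℤ} (h : s + 2 = r) {β : Co R F}
    (hβ : β ∈ extPow R (Module.Dual R F) s) : S.ell β ∈ S.botIm r := by
  obtain rfl : s = r - 2 := by omega
  exact Submodule.mem_map_of_mem hβ

include b in
theorem tau_mem_Nhat (hn : 3 ≤ n) {x : Tot R F} (hx : x ∈ S.LL r) :
    S.tau r x ∈ S.Nhat (r + 1) := by
  refine S.LL_le_of_generators b r (T := (S.Nhat (r + 1)).comap (S.tau r))
    ?_ ?_ ?_ ?_ ?_ ?_ ?_ ?_ hx <;> intro h β hβ <;> rw [Submodule.mem_comap]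
  · rw [S.tau_one_tmul_in1 h hβ]
    exact negOnePow_smul_mem _ (S.F2_zero_le_Nhat (by omega)
      (in2_tmul_mem _ (by omega) extPow_one_mem hβ))
  · rw [S.tau_tmul_one_in1 h hβ]
    exact negOnePow_smul_mem _ (S.F3_zero_le_Nhat (by omega)
      (in3_tmul_mem _ (by omega) extPow_one_mem hβ))
  · rw [S.tau_sigma_in2 b h hβ]
    refine add_mem (S.F1_top_le_Nhat (by omega) (in1_tmul_mem _ (by omega) D.eps_mem hβ)) ?_
    split_ifs
    · exact negOnePow_smul_mem _ (Submodule.smul_mem _ _ (S.F3_zero_le_Nhat (by omega)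
        (in3_tmul_mem _ (by omega) extPow_one_mem D.eps_mem)))
    · exact zero_mem _
  · rw [S.tau_eta_tmul_in2 b h hβ]
    refine add_mem (negOnePow_smul_mem _ (S.F4_top_le_Nhat (by omega)
      (in4_tmul_mem _ (by omega) D.eps_mem hβ))) ?_
    split_ifs
    · exact Submodule.smul_mem _ _ (S.botIm_in3_le_Nhat (by omega)
        (Submodule.mem_map_of_mem (S.map_ell_mem_botIm _ (by omega) (uAct_mem D D.eps_mem))))
    · exact zero_mem _
  · rw [S.tau_sigma_in3 b h hβ]
    refine sub_mem (S.F1_sub_le_Nhat (by omega) ?_) ?_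
    · have := in1_tmul_mem (r + 1) (by omega) hβ D.eps_mem
      rwa [(by omega : r + 2 - (n : ℤ) = r + 1 + 1 - n)] at this
    split_ifs
    · exact Submodule.smul_mem _ _ (S.F2_zero_le_Nhat (by omega)
        (in2_tmul_mem _ (by omega) extPow_one_mem D.eps_mem))
    · exact zero_mem _
  · rw [S.tau_eta_tmul_in3 b h hβ]
    refine add_mem (negOnePow_smul_mem _ (S.F4_sub_le_Nhat (by omega) ?_)) ?_
    · have := in4_tmul_mem (r + 1) (by omega) hβ D.eps_mem
      rwa [(by omega : r - (n : ℤ) = r + 1 - 1 - n)] at this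
    split_ifs
    · exact negOnePow_smul_mem _ (Submodule.smul_mem _ _ (S.botIm_in2_le_Nhat (by omega)
        (Submodule.mem_map_of_mem (S.map_ell_mem_botIm _ (by omega) (vAct_mem D D.eps_mem)))))
    · exact zero_mem _
  · rw [S.tau_one_tmul_in4 h hβ]
    exact S.botIm_in2_le_Nhat (by omega)
      (Submodule.mem_map_of_mem (S.map_ell_mem_botIm _ (by omega) hβ))
  · rw [S.tau_tmul_one_in4 h hβ]
    exact neg_mem (S.botIm_in3_le_Nhat (by omega)
      (Submodule.mem_map_of_mem (S.map_ell_mem_botIm _ (by omega) hβ)))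

theorem negOnePow_smul_smul {V : Type*} [AddCommGroup V] (x : V) :
    r.negOnePow • r.negOnePow • x = x := by
  rw [smul_smul, ← Int.negOnePow_add, ← two_mul, Int.negOnePow_even _ (even_two_mul r), one_smul]

set_option maxHeartbeats 1000000 in
include b in
theorem piL_f_tau (hn : 3 ≤ n) {x : Tot R F} (hx : x ∈ S.LL r) :
    S.piL r (D.f (r + 1) (S.tau r x)) = x := by
  obtain ⟨g, hg⟩ : ∃ g : Tot R F →ₗ[R] Tot R F, ∀ x, g x = S.piL r (D.f (r + 1) (S.tau r x)) :=
    ⟨S.piL r ∘ₗ D.f (r + 1) ∘ₗ S.tau r, fun x => by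
      rw [LinearMap.comp_apply, LinearMap.comp_apply]⟩
  suffices h : S.LL r ≤ LinearMap.ker (g - LinearMap.id) by
    rw [← hg, ← sub_eq_zero]
    exact h hx
  refine S.LL_le_of_generators b r ?_ ?_ ?_ ?_ ?_ ?_ ?_ ?_ <;> intro h β hβ <;>
    rw [LinearMap.mem_ker, LinearMap.sub_apply, sub_eq_zero, hg, LinearMap.id_apply]
  · rw [S.tau_one_tmul_in1 h hβ, map_units_smul, map_units_smul, S.piL_f_one_tmul_in2 b hn hβ,
      negOnePow_smul_smul]
  · rw [S.tau_tmul_one_in1 h hβ, map_units_smul, map_units_smul, S.piL_f_one_tmul_in3 b hn hβ,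
      Int.negOnePow_succ, neg_neg, negOnePow_smul_smul]
  · rw [S.tau_sigma_in2 b h hβ, map_add, map_add, S.piL_f_eps_tmul_in1 b hn h hβ, add_assoc]
    split_ifs with hr
    -- The unwanted term is the scalar `v(β)` times `ε ⊗ 1`. The correction `(-1)^n v(β) ⊗ ε` in
    -- 𝔽(3) has 𝕃-component equal to its negative.
    · subst hr
      have hβ' := vAct_mem D hβ
      rw [(by omega : (n : ℤ) - 1 + 2 - n - 1 = 0)] at hβ'
      have he : D.eps ∈ extPow R (Module.Dual R F) (n - 1 + 1) := by
        rw [sub_add_cancel]; exact D.eps_mem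
      have e : in1 R F (D.eps ⊗ₜ[R] D.vAct β) =
          aug R (Module.Dual R F) (D.vAct β) • in1 R F (D.eps ⊗ₜ[R] 1) := by
        rw [← map_smul, ← TensorProduct.tmul_smul, aug_smul_one hβ']
      rw [map_units_smul, map_units_smul, map_smul, map_smul, S.piL_f_one_tmul_in3 b hn he,
        sub_add_cancel, e]
      obtain hs | hs := Int.units_eq_one_or (n : ℤ).negOnePow <;> rw [hs] <;>
      simp only [neg_neg, one_smul, Units.neg_smul, smul_neg, add_neg_cancel, add_zero]
    · rw [map_zero, map_zero, add_zero, add_zero]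
  · rw [S.tau_eta_tmul_in2 b h hβ, map_add, map_add, map_units_smul, map_units_smul,
      S.piL_f_eps_tmul_in4 b hn h hβ, negOnePow_smul_smul, add_assoc]
    split_ifs with hr
    -- The unwanted term `u(ε) ⊗ β` is cancelled by the correction `β ℓ(u(ε))`. Here `μℓ = id`
    -- applies since `u(ε)` has degree `n - 1`, not `n`.
    · subst hr
      rw [sub_self] at hβ
      rw [map_smul, map_smul, S.piL_f_ell_in3 b hn (by omega) (uAct_mem D D.eps_mem), smul_neg,
        ← map_smul, ← TensorProduct.tmul_smul, aug_smul_one hβ, add_neg_cancel, add_zero]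
    · rw [map_zero, map_zero, add_zero, add_zero]
  · rw [S.tau_sigma_in3 b h hβ, map_sub, map_sub, S.piL_f_tmul_eps_in1 b hn h hβ, add_sub_assoc]
    split_ifs with hr
    · subst hr
      have hβ' := uAct_mem D hβ
      rw [(by omega : (n : ℤ) - 1 + 2 - n - 1 = 0)] at hβ'
      have he : D.eps ∈ extPow R (Module.Dual R F) (n - 1 + 1) := by
        rw [sub_add_cancel]; exact D.eps_mem
      have e : in1 R F (D.uAct β ⊗ₜ[R] D.eps) =
          aug R (Module.Dual R F) (D.uAct β) • in1 R F (1 ⊗ₜ[R] D.eps) := by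
        rw [← map_smul, TensorProduct.smul_tmul', aug_smul_one hβ']
      rw [map_smul, map_smul, S.piL_f_one_tmul_in2 b hn he, e]
      obtain hs | hs := Int.units_eq_one_or ((n : ℤ) - 1 + 1).negOnePow <;> rw [hs] <;>
      simp only [one_smul, Units.neg_smul, smul_neg, sub_self, add_zero]
    · rw [map_zero, map_zero, smul_zero, sub_zero, add_zero]
  · rw [S.tau_eta_tmul_in3 b h hβ, map_add, map_add, map_units_smul, map_units_smul,
      S.piL_f_tmul_eps_in4 b hn h hβ, smul_add, negOnePow_smul_smul, add_assoc]
    split_ifs with hr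
    · subst hr
      rw [sub_self] at hβ
      have e : in4 R F (β ⊗ₜ[R] D.vAct D.eps) =
          aug R (Module.Dual R F) β • in4 R F (1 ⊗ₜ[R] D.vAct D.eps) := by
        rw [← map_smul, TensorProduct.smul_tmul', aug_smul_one hβ]
      rw [map_units_smul, map_units_smul, map_smul, map_smul,
        S.piL_f_ell_in2 b hn (by omega) (vAct_mem D D.eps_mem), e]
      -- The outer sign is `(-1)^(n+1)` and the sign in the correction is `(-1)^n`, so the two terms
      -- cancel in either parity.
      obtain hs | hs := Int.units_eq_one_or (n : ℤ).negOnePow <;> rw [Int.negOnePow_succ, hs] <;>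
      simp only [neg_neg, one_smul, Units.neg_smul, add_neg_cancel, neg_add_cancel,
        add_zero]
    · rw [map_zero, map_zero, smul_zero, add_zero, add_zero]
  · rw [S.tau_one_tmul_in4 h hβ, S.piL_f_ell_in2 b hn h hβ]
  · rw [S.tau_tmul_one_in4 h hβ, map_neg, map_neg, S.piL_f_ell_in3 b hn h hβ, neg_neg]

-- The matrix of `τ` is triangular. The generators `1 ⊗ β` and `ℓ(β)` are hit exactly, up to sign.
-- Those with a factor `ε` are hit up to corrections that are multiples of the former, which are
-- already in the image.
include b in
theorem Nhat_le_map_tau (hn : 3 ≤ n) : S.Nhat (r + 1) ≤ (S.LL r).map (S.tau r) := by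
  -- The four facts `g1`, `g2`, `g7`, `g8` are the generators hit exactly; all correction terms
  -- below are multiples of them.
  have g1 : -1 ≤ r ∧ r ≤ n - 1 → ∀ β ∈ extPow R (Module.Dual R F) (r + 1),
      in2 R F (1 ⊗ₜ[R] β) ∈ (S.LL r).map (S.tau r) := fun h β hβ => by
    rw [← negOnePow_smul_smul (r + 1) (in2 R F (1 ⊗ₜ[R] β)), ← S.tau_one_tmul_in1 h hβ]
    exact negOnePow_smul_mem _ (Submodule.mem_map_of_mem (S.F1_zero_le_LL h
      (in1_tmul_mem r (by omega) extPow_one_mem hβ)))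
  have g2 : 0 ≤ r ∧ r ≤ n - 1 → ∀ β ∈ extPow R (Module.Dual R F) (r + 1),
      in3 R F (1 ⊗ₜ[R] β) ∈ (S.LL r).map (S.tau r) := fun h β hβ => by
    rw [← negOnePow_smul_smul r (in3 R F (1 ⊗ₜ[R] β)), ← S.tau_tmul_one_in1 h hβ]
    exact negOnePow_smul_mem _ (Submodule.mem_map_of_mem (S.F1_succ_le_LL h
      (in1_tmul_mem r (by omega) hβ extPow_one_mem)))
  have g7 : 1 ≤ r ∧ r ≤ n → ∀ β ∈ extPow R (Module.Dual R F) (r - 1),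
      in2 R F (S.ell β) ∈ (S.LL r).map (S.tau r) := fun h β hβ => by
    rw [← S.tau_one_tmul_in4 h hβ]
    exact Submodule.mem_map_of_mem (S.F4_zero_le_LL h
      (in4_tmul_mem r (by omega) extPow_one_mem hβ))
  have g8 : 2 ≤ r ∧ r ≤ n → ∀ β ∈ extPow R (Module.Dual R F) (r - 1),
      in3 R F (S.ell β) ∈ (S.LL r).map (S.tau r) := fun h β hβ => by
    rw [← neg_neg (in3 R F (S.ell β)), ← S.tau_tmul_one_in4 h hβ]
    exact neg_mem (Submodule.mem_map_of_mem (S.F4_pred_le_LL h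
      (in4_tmul_mem r (by omega) hβ extPow_one_mem)))
  refine Nhat_le ?_ ?_ ?_ ?_ ?_ ?_ ?_ ?_
  · rintro h _ ⟨z, hz, rfl⟩
    obtain ⟨β, hβ, rfl⟩ := exists_tmul_of_mem_tens_left (D.exists_smul_eps b) hz
    rw [(by omega : r + 1 + 1 - (n : ℤ) = r + 2 - n)] at hβ
    rw [eq_sub_of_add_eq (S.tau_sigma_in2 b (by omega) hβ).symm]
    refine sub_mem (Submodule.mem_map_of_mem (S.topIm_in2_le_LL (by omega)
      (Submodule.mem_map_of_mem (Submodule.mem_map_of_mem hβ)))) ?_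
    split_ifs with hr
    · refine negOnePow_smul_mem _ (Submodule.smul_mem _ _ (g2 (by omega) _ ?_))
      rw [hr, sub_add_cancel]
      exact D.eps_mem
    · exact zero_mem _
  · rintro h _ ⟨z, hz, rfl⟩
    rw [SetLike.mem_coe, sub_sub_cancel] at hz
    obtain ⟨β, hβ, rfl⟩ := exists_tmul_of_mem_tens_right (D.exists_smul_eps b) hz
    rw [(by omega : r + 1 + 1 - (n : ℤ) = r + 2 - n)] at hβ
    rw [eq_add_of_sub_eq (S.tau_sigma_in3 b (by omega) hβ).symm]
    refine add_mem (Submodule.mem_map_of_mem (S.topIm_in3_le_LL (by omega)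
      (Submodule.mem_map_of_mem (Submodule.mem_map_of_mem hβ)))) ?_
    split_ifs with hr
    · refine Submodule.smul_mem _ _ (g1 (by omega) _ ?_)
      rw [hr, sub_add_cancel]
      exact D.eps_mem
    · exact zero_mem _
  · rintro h _ ⟨z, hz, rfl⟩
    obtain ⟨β, hβ, rfl⟩ := exists_tmul_of_mem_tens_left exists_smul_one hz
    exact g1 (by omega) β (by rwa [sub_zero] at hβ)
  · rintro h _ ⟨_, ⟨β, hβ, rfl⟩, rfl⟩
    exact g7 (by omega) β (by rwa [(by omega : r + 1 - 2 = r - 1)] at hβ)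
  · rintro h _ ⟨z, hz, rfl⟩
    obtain ⟨β, hβ, rfl⟩ := exists_tmul_of_mem_tens_left exists_smul_one hz
    exact g2 (by omega) β (by rwa [sub_zero] at hβ)
  · rintro h _ ⟨_, ⟨β, hβ, rfl⟩, rfl⟩
    exact g8 (by omega) β (by rwa [(by omega : r + 1 - 2 = r - 1)] at hβ)
  · rintro h _ ⟨z, hz, rfl⟩
    obtain ⟨β, hβ, rfl⟩ := exists_tmul_of_mem_tens_left (D.exists_smul_eps b) hz
    rw [(by omega : r + 1 - 1 - (n : ℤ) = r - n)] at hβ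
    rw [← negOnePow_smul_smul (r + 1) (in4 R F _),
      eq_sub_of_add_eq (S.tau_eta_tmul_in2 b (by omega) hβ).symm]
    refine negOnePow_smul_mem _ (sub_mem (Submodule.mem_map_of_mem (S.F2_top_le_LL (by omega)
      (in2_tmul_mem r (by omega) D.eta_mem hβ))) ?_)
    split_ifs with hr
    · refine Submodule.smul_mem _ _ (g8 (by omega) _ ?_)
      rw [hr]
      exact uAct_mem D D.eps_mem
    · exact zero_mem _
  · rintro h _ ⟨z, hz, rfl⟩
    rw [SetLike.mem_coe, sub_sub_cancel] at hz
    obtain ⟨β, hβ, rfl⟩ := exists_tmul_of_mem_tens_right (D.exists_smul_eps b) hz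
    rw [(by omega : r + 1 - 1 - (n : ℤ) = r - n)] at hβ
    rw [← negOnePow_smul_smul (r + 1) (in4 R F _),
      eq_sub_of_add_eq (S.tau_eta_tmul_in3 b (by omega) hβ).symm]
    refine negOnePow_smul_mem _ (sub_mem (Submodule.mem_map_of_mem (S.F3_top_le_LL (by omega)
      (in3_tmul_mem r (by omega) D.eta_mem hβ))) ?_)
    split_ifs with hr
    · refine negOnePow_smul_mem _ (Submodule.smul_mem _ _ (g7 (by omega) _ ?_))
      rw [hr]
      exact vAct_mem D D.eps_mem
    · exact zero_mem _

end Homotopy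

section Apply

variable {R : Type u} [CommRing R] {F : Type v} [AddCommGroup F] [Module R F] {n : ℕ}
  {D : Data R F n} (S : Splittings D) (r : ℤ) (x : Tot R F)

theorem psi_apply : S.psi r x = S.piM r x - S.piM r (D.f (r + 1) (S.tau r (S.piL r x))) := by
  rw [psi, LinearMap.sub_apply, LinearMap.comp_apply, LinearMap.comp_apply, LinearMap.comp_apply]

theorem m_apply : S.m r x = S.psi (r - 1) (D.f r x) := by
  rw [m, LinearMap.comp_apply]

theorem rho_apply : S.rho r x = x - S.tau (r - 1) (S.piL (r - 1) (D.f r x)) := by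
  rw [rho, LinearMap.sub_apply, LinearMap.comp_apply, LinearMap.comp_apply, LinearMap.id_apply]

end Apply

end Splittings

theorem exists_basis_of_finrank {R : Type*} [CommRing R] {F : Type*} [AddCommGroup F] [Module R F]
    [Module.Free R F] [Module.Finite R F] {n : ℕ} (h : Module.finrank R F = n) :
    Nonempty (Module.Basis (Fin n) R F) := by
  cases subsingleton_or_nontrivial R with
  | inl hR =>
    -- Over the zero ring both `F` and `Fin n → R` are zero modules, so the zero map is an
    -- equivalence for every `n`.
    have : Subsingleton F := Module.subsingleton R F
    exact ⟨.ofEquivFun 0⟩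
  | inr hR => exact ⟨Module.finBasisOfFinrankEq R F h⟩

end

end SeqMat

attribute [local irreducible] SeqMat.Data.f SeqMat.Splittings.tau SeqMat.Splittings.piL
  SeqMat.Splittings.piM SeqMat.Splittings.psi SeqMat.Splittings.m SeqMat.Splittings.rho in
theorem proposition3p14 {R : Type*} [CommRing R] [IsNoetherianRing R]
    {F : Type*} [AddCommGroup F] [Module R F] [Module.Free R F] [Module.Finite R F]
    (n : ℕ) (hn : 3 ≤ n) (hrank : Module.finrank R F = n)
    (D : SeqMat.Data R F n) (S : SeqMat.Splittings D) :
    (∀ r : ℤ, S.Decomposes r) ∧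
    ∃ (hF : SeqMat.IsComplex (SeqMat.FF R F) D.f)
      (hN : SeqMat.IsComplex S.NN D.f)
      (hM : SeqMat.IsComplex S.MM S.m)
      (hincl : SeqMat.IsChainMap S.NN D.f (SeqMat.FF R F) D.f (fun _ => LinearMap.id))
      (hpsi : SeqMat.IsChainMap (SeqMat.FF R F) D.f S.MM S.m S.psi)
      (hrho : SeqMat.IsChainMap S.MM S.m (SeqMat.FF R F) D.f S.rho)
      (hzero : hincl.toHom hN hF ≫ hpsi.toHom hF hM = 0),
      Nonempty (Homotopy (𝟙 hN.toChainComplex) 0) ∧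
      (ShortComplex.mk (hincl.toHom hN hF) (hpsi.toHom hF hM) hzero).ShortExact ∧
      hrho.toHom hM hF ≫ hpsi.toHom hF hM = 𝟙 hM.toChainComplex := by
  -- The basis serves only to verify identities and vanishing; none of the complexes or maps depends
  -- on it.
  obtain ⟨b⟩ := SeqMat.exists_basis_of_finrank hrank
  refine ⟨fun r => S.decomposes b hn r, ?_⟩
  exact SeqMat.exists_splitting_complexes (SeqMat.FF R F) S.LL S.MM S.Nhat D.f S.piL S.piM S.tau
    S.psi S.m S.rho S.NN (fun _ => rfl) S.psi_apply S.m_apply S.rho_apply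
    (fun r _ hx => D.f_mem_FF b r hx) (fun r x _ => D.f_f b r x)
    (fun r => (S.decomposes b hn r).1) (fun r => (S.decomposes b hn r).2.1)
    (fun r => (S.decomposes b hn r).2.2.1) (fun r => (S.decomposes b hn r).2.2.2)
    (fun r _ hx => S.tau_mem_Nhat b r hn hx) (fun r _ hx => S.piL_f_tau b r hn hx)
    (fun r => S.Nhat_le_map_tau b r hn)
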